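/- There is a deterministic algorithm that, given an instance of the scheduling problem $P\,|\,\mathrm{prec},p_j=1\,|\,C_{\max}$, i.e. a number $m\ge 1$ of identical machines (in binary) and a finite set $V$ of unit-length jobs with a strict partial order $\prec$ on $V$, outputs an optimal schedule: a sequence $(S_1,\dots,S_T)$ of pairwise disjoint subsets of $V$ with union $V$, with $|S_t|\le m$ for all $t$, and with $t<t'$ whenever $v\prec w$, $v\in S_t$ and $w\in S_{t'}$, for which the makespan $T$ is minimum. The algorithm runs in $\mathcal{O}^\star(169^{|C|})$ time: there is a polynomial $p$ such that on every instance with input length $N$, and for every vertex cover $C$ of the comparability graph of $\prec$ (the undirected graph on $V$ in which two jobs are adjacent if and only if they are comparable under $\prec$), the algorithm halts after at most $p(N)\cdot 169^{|C|}$ steps. The vertex cover $C$ is not part of the input. -/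

import Mathlib

/-!
Scheduling unit jobs with precedence constraints on identical machines, and a machine model with a
step count in which the running time of an algorithm for it is measured.
-/

namespace PrecSched

/-! ### The machine model: first-order recursive programs on binary trees, with unit cost -/

/-- The data of a program: binary trees with a single kind of leaf (LISP data with the atom `nil`
only). In memory a tree is a pointer to a cell. -/
inductive SExp : Type
  | nil : SExp
  | cons (l r : SExp) : SExp

/-- First component; `nil` has first component `nil`. -/
def SExp.hd : SExp → SExp
  | .nil => .nil
  | .cons l _ => l

/-- Second component; `nil` has second component `nil`. -/
def SExp.tl : SExp → SExp
  | .nil => .nil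
  | .cons _ r => r

/-- The number of nodes of a tree: the length of an input. -/
def SExp.size : SExp → ℕ
  | .nil => 1
  | .cons l r => l.size + r.size + 1

/-- Expressions of the programming language. Variables are de Bruijn indices into the environment;
in a conditional, `nil` counts as false and every other tree as true; `call f a` calls the `f`-th
function of the program on the value of `a`. -/
inductive Expr : Type
  | var (i : ℕ) : Expr
  | nil : Expr
  | cons (a b : Expr) : Expr
  | hd (a : Expr) : Expr
  | tl (a : Expr) : Expr
  | cond (c a b : Expr) : Expr
  | bind (a b : Expr) : Expr
  | call (f : ℕ) (a : Expr) : Expr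

/-- A program is a finite list of bodies of (mutually recursive) functions of one argument. The
function with index `0` is the main function. -/
abbrev Program : Type := List Expr

/-- `Eval P env e v t`: in the program `P`, with the environment `env`, the call-by-value evaluation
of the expression `e` terminates with value `v` after exactly `t` elementary steps. Each evaluation
of a constructor of the language is one step, and each is a bounded number of pointer operations
(there is no primitive that inspects or copies a whole tree), so that the steps agree with the steps
of a Turing machine up to a polynomial. -/
inductive Eval (P : Program) : List SExp → Expr → SExp → ℕ → Prop
  | var {env : List SExp} {i : ℕ} {v : SExp} (h : env[i]? = some v) :
      Eval P env (.var i) v 1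
  | nil {env : List SExp} : Eval P env .nil .nil 1
  | cons {env : List SExp} {a b : Expr} {u v : SExp} {s t : ℕ}
      (ha : Eval P env a u s) (hb : Eval P env b v t) :
      Eval P env (.cons a b) (.cons u v) (s + t + 1)
  | hd {env : List SExp} {a : Expr} {u : SExp} {s : ℕ} (ha : Eval P env a u s) :
      Eval P env (.hd a) u.hd (s + 1)
  | tl {env : List SExp} {a : Expr} {u : SExp} {s : ℕ} (ha : Eval P env a u s) :
      Eval P env (.tl a) u.tl (s + 1)
  | cond_true {env : List SExp} {c a b : Expr} {x y v : SExp} {s t : ℕ}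
      (hc : Eval P env c (.cons x y) s) (ha : Eval P env a v t) :
      Eval P env (.cond c a b) v (s + t + 1)
  | cond_false {env : List SExp} {c a b : Expr} {v : SExp} {s t : ℕ}
      (hc : Eval P env c .nil s) (hb : Eval P env b v t) :
      Eval P env (.cond c a b) v (s + t + 1)
  | bind {env : List SExp} {a b : Expr} {u v : SExp} {s t : ℕ}
      (ha : Eval P env a u s) (hb : Eval P (u :: env) b v t) :
      Eval P env (.bind a b) v (s + t + 1)
  | call {env : List SExp} {f : ℕ} {a e : Expr} {u v : SExp} {s t : ℕ}
      (ha : Eval P env a u s) (hf : P[f]? = some e) (he : Eval P [u] e v t) :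
      Eval P env (.call f a) v (s + t + 1)

/-- Programs are deterministic: the value and the number of steps are unique. -/
theorem Eval.unique {P : Program} {env : List SExp} {e : Expr} {v v' : SExp} {t t' : ℕ}
    (h : Eval P env e v t) (h' : Eval P env e v' t') : v = v' ∧ t = t' := by
  induction h generalizing v' t' with
  | var h => cases h' with | var h₂ => simp_all
  | nil => cases h'; simp
  | cons _ _ iha ihb => cases h' with
    | cons ha hb => obtain ⟨rfl, rfl⟩ := iha ha; obtain ⟨rfl, rfl⟩ := ihb hb; simp
  | hd _ iha => cases h' with | hd ha => obtain ⟨rfl, rfl⟩ := iha ha; simp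
  | tl _ iha => cases h' with | tl ha => obtain ⟨rfl, rfl⟩ := iha ha; simp
  | cond_true _ _ ihc iha => cases h' with
    | cond_true hc ha => obtain ⟨_, rfl⟩ := ihc hc; obtain ⟨rfl, rfl⟩ := iha ha; simp
    | cond_false hc _ => exact absurd (ihc hc).1 (by simp)
  | cond_false _ _ ihc ihb => cases h' with
    | cond_true hc _ => exact absurd (ihc hc).1 (by simp)
    | cond_false hc hb => obtain ⟨_, rfl⟩ := ihc hc; obtain ⟨rfl, rfl⟩ := ihb hb; simp
  | bind _ _ iha ihb => cases h' with
    | bind ha hb => obtain ⟨rfl, rfl⟩ := iha ha; obtain ⟨rfl, rfl⟩ := ihb hb; simp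
  | call _ hf _ iha ihe => cases h' with
    | call ha hf' he =>
      obtain ⟨rfl, rfl⟩ := iha ha
      obtain rfl := Option.some.inj (hf.symm.trans hf')
      obtain ⟨rfl, rfl⟩ := ihe he
      simp

/-- `RunsIn P x y t`: on input `x`, the program `P` halts with output `y` after exactly `t` steps. -/
def RunsIn (P : Program) (x y : SExp) (t : ℕ) : Prop :=
  ∃ e : Expr, P[0]? = some e ∧ Eval P [x] e y t

/-! ### Encodings -/

/-- Booleans as trees. -/
def encBool : Bool → SExp
  | false => .nil
  | true => .cons .nil .nil

/-- Lists as trees. -/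
def encList {α : Type} (enc : α → SExp) : List α → SExp
  | [] => .nil
  | a :: l => .cons (enc a) (encList enc l)

/-- A natural number as the list of its binary digits, least significant digit first. -/
def encNat (k : ℕ) : SExp := encList encBool k.bits

/-- A set of jobs as a 0-1-vector. -/
def encSet {n : ℕ} (X : Finset (Fin n)) : SExp :=
  encList encBool (List.ofFn fun j : Fin n => decide (j ∈ X))

/-! ### The scheduling problem -/

/-- An instance of `P | prec, p_j = 1 | C_max`: `n` unit jobs, `m ≥ 1` identical machines, and a
strict partial order (a transitively closed precedence graph) on the jobs; `prec i j` says that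
job `i` has to be completed before job `j` can start. -/
structure Instance where
  n : ℕ
  m : ℕ
  prec : Fin n → Fin n → Bool
  m_pos : 0 < m
  irrefl : ∀ i, ¬ prec i i
  trans : ∀ i j k, prec i j → prec j k → prec i k

/-- The input of the algorithm: the number of machines in binary and the adjacency matrix of the
precedence graph. -/
def Instance.enc (I : Instance) : SExp :=
  .cons (encNat I.m)
    (encList (encList encBool) (List.ofFn fun i : Fin I.n => List.ofFn fun j : Fin I.n => I.prec i j))

/-- The comparability graph of the precedence order. -/
def Instance.compGraph (I : Instance) : SimpleGraph (Fin I.n) where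
  Adj i j := I.prec i j ∨ I.prec j i
  symm := ⟨fun _ _ h => h.symm⟩
  loopless := ⟨fun i h => h.elim (I.irrefl i) (I.irrefl i)⟩

/-- `S` is a feasible schedule `(S_1, …, S_T)` of all jobs, of makespan `T`: every job is in exactly
one time slot, no slot holds more than `m` jobs, and the precedence constraints are obeyed. -/
structure Instance.IsSchedule (I : Instance) {T : ℕ} (S : Fin T → Finset (Fin I.n)) : Prop where
  partition : ∀ j, ∃! t, j ∈ S t
  capacity : ∀ t, (S t).card ≤ I.m
  order : ∀ i j t t', I.prec i j → i ∈ S t → j ∈ S t' → t < t'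

/-- `S` is a feasible schedule of minimum makespan. -/
def Instance.IsOptimal (I : Instance) {T : ℕ} (S : Fin T → Finset (Fin I.n)) : Prop :=
  I.IsSchedule S ∧ ∀ (T' : ℕ) (S' : Fin T' → Finset (Fin I.n)), I.IsSchedule S' → T ≤ T'

/-- The output of the algorithm: the list of the time slots. -/
def encSchedule {n T : ℕ} (S : Fin T → Finset (Fin n)) : SExp :=
  encList encSet (List.ofFn S)

end PrecSched

/-! ### Sets as bit vectors -/

namespace PrecSched

open Finset

/-! Making the instance rigid. Capping the number of machines at `n + 1` loses nothing. For a fixed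
number `T` of slots, `m * T - n` isolated jobs fill all idle places, so that every slot holds
exactly `m` jobs; a minimum `bot` in slot `0` and a maximum `top` in slot `T + 1` serve as
boundaries. The program tries `T = 0, 1, 2, …` until the dynamic program returns something:
`answer_sound` says that a result is a schedule, `answer_ne_nil` that a schedule is never missed.

Why a vertex cover helps. The jobs outside a cover `C` are pairwise incomparable, so each of them
sees only `C`: its predecessors give a release time, its first successor a deadline. With the
schedule of `C` fixed, an exchange argument (`exists_earliestFirst`) lets all other jobs run
earliest deadline first. If then slot `a` runs a job outside `C` without a successor in a set `β` of
cover jobs started before some time, every job with a successor in `β` that could run in slot `a` is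
finished after it (`separates_of_loose`). Such a slot is a cut: the jobs outside `C` with a
successor in `β` that run after cut `a` and up to cut `s` are those that are blocked at `a` and
unblocked at `s`. This set, `forced`, depends only on which cover jobs have started at the two ends.

The tables. A slot `s` is described by the cover jobs started before `s` and before `s + 1`. A piece
of schedule is described by a chain `A ⊆ A' ⊆ U ⊆ U' ⊆ c ⊆ B`: the slot at which it starts
(exclusive), the slot with which it ends (inclusive), the level `c` whose forced jobs must all be in
it, and the level `B` from which further jobs may be taken as fillers. One piece per chain and
length is enough. Its cover jobs are determined, its slots but the last are full, and its last slot
is full unless no candidate is left. Comparing `m` times the number of slots with the number of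
candidates (`card_le`, `le_card`) therefore shows that the stored piece contains all candidates, or
that it is full, whichever is needed (`Good.forced_subset_of_card_le`, `Good.allFull_of_le_card`).

The recursion. If some job strictly between the ends has no successor in `c`, the piece is cut at
the last such job and glued from two shorter pieces. Otherwise the level is lowered to `U'`; if
there is no cut at that level either, the last slot can be reduced to its cover jobs and removed. In
all cases the last slot is filled up afterwards. Soundness is `tableOK_entry`, completeness is
`complete`.

Running time. There are `7 ^ |C|` chains of six subsets of `C`, and one entry tries at most three
subsets of `C` (two for the cut, one for the removal of a slot), hence `8 ^ |C|` combinations; up to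
a polynomial this gives `56 ^ |C|`, which is below `169 ^ |C|`. The program finds a minimum vertex
cover itself with a bounded search tree in `2 ^ |C|` time, so the bound holds for every vertex
cover.

The program. Its correctness is proved by a weakest-precondition calculus that counts only function
calls, which determine the number of steps up to a constant factor. -/

/-- The characteristic vector of a set. -/
def bits {N : ℕ} (X : Finset (Fin N)) : List Bool := List.ofFn fun j : Fin N => decide (j ∈ X)

/-- The set with a given characteristic vector. -/
def ofBits {N : ℕ} (l : List Bool) : Finset (Fin N) := univ.filter fun j => l.getD j false = true

/-- Keep the first `k` ones of a vector. -/
def takeBits : List Bool → ℕ → List Bool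
  | [], _ => []
  | false :: l, k => false :: takeBits l k
  | true :: l, 0 => false :: takeBits l 0
  | true :: l, k + 1 => true :: takeBits l k

@[simp] theorem length_bits {N : ℕ} (X : Finset (Fin N)) : (bits X).length = N := by simp [bits]

@[simp] theorem ofBits_bits {N : ℕ} (X : Finset (Fin N)) : ofBits (bits X) = X := by
  ext j; simp [ofBits, bits]

theorem bits_ofBits {N : ℕ} {l : List Bool} (h : l.length = N) :
    bits (ofBits l : Finset (Fin N)) = l := by
  subst h
  apply List.ext_getElem
  · simp
  · intro i h₁ h₂
    simp [bits, ofBits]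

theorem card_eq_count_bits {N : ℕ} (X : Finset (Fin N)) : X.card = (bits X).count true := by
  have key : ∀ (N : ℕ) (f : Fin N → Bool),
      (List.ofFn f).count true = ∑ j, if f j then 1 else 0 := by
    intro N
    induction N with
    | zero => simp
    | succ N ih =>
      intro f
      rw [List.ofFn_succ, List.count_cons, ih, Fin.sum_univ_succ]
      cases h : f 0 <;> simp [add_comm]
  rw [bits, key]
  simp

theorem length_takeBits (l : List Bool) (k : ℕ) : (takeBits l k).length = l.length := by
  induction l, k using takeBits.induct <;> simp_all [takeBits]

theorem count_takeBits (l : List Bool) (k : ℕ) :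
    (takeBits l k).count true = min (l.count true) k := by
  induction l, k using takeBits.induct <;> simp_all [takeBits]

theorem getD_takeBits (l : List Bool) (k i : ℕ) (h : (takeBits l k).getD i false = true) :
    l.getD i false = true := by
  induction l, k using takeBits.induct generalizing i <;> cases i <;> simp_all [takeBits]

/-- The first `k` elements of a set. -/
def firstElems {N : ℕ} (X : Finset (Fin N)) (k : ℕ) : Finset (Fin N) := ofBits (takeBits (bits X) k)

theorem bits_firstElems {N : ℕ} (X : Finset (Fin N)) (k : ℕ) :
    bits (firstElems X k) = takeBits (bits X) k :=
  bits_ofBits (by rw [length_takeBits, length_bits])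

theorem firstElems_subset {N : ℕ} (X : Finset (Fin N)) (k : ℕ) : firstElems X k ⊆ X := by
  intro j hj
  have h : (takeBits (bits X) k).getD j false = true := by simpa [firstElems, ofBits] using hj
  have h' := getD_takeBits _ _ _ h
  rw [← ofBits_bits X]
  simpa [ofBits] using h'

theorem card_firstElems {N : ℕ} (X : Finset (Fin N)) (k : ℕ) :
    (firstElems X k).card = min X.card k := by
  rw [card_eq_count_bits, bits_firstElems, count_takeBits, ← card_eq_count_bits]

/-! ### The dynamic program -/

/-- A partial schedule: a list of time slots, the last slot first. In the tables of the dynamic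
program `[]` stands for "none". -/
abbrev Piece (N : ℕ) := List (Finset (Fin N))

/-- A table of partial schedules, indexed by chains of six sets. -/
abbrev Tab (N : ℕ) := Finset (Fin N) → Finset (Fin N) → Finset (Fin N) → Finset (Fin N) →
  Finset (Fin N) → Finset (Fin N) → Piece N

/-- The jobs of a partial schedule. -/
def jobs {N : ℕ} (p : Piece N) : Finset (Fin N) := p.foldr (· ∪ ·) ∅

@[simp] theorem jobs_nil {N : ℕ} : jobs ([] : Piece N) = ∅ := rfl

@[simp] theorem jobs_cons {N : ℕ} (z : Finset (Fin N)) (p : Piece N) :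
    jobs (z :: p) = z ∪ jobs p := rfl

@[simp] theorem jobs_append {N : ℕ} (p q : Piece N) : jobs (p ++ q) = jobs p ∪ jobs q := by
  induction p with
  | nil => simp
  | cons z p ih => simp [ih]

/-- The first nonempty list among the values of `f`. -/
def firstNonempty {α β : Type} (f : α → List β) : List α → List β
  | [] => []
  | a :: l => if f a ≠ [] then f a else firstNonempty f l

theorem firstNonempty_ne_nil {α β : Type} {f : α → List β} {l : List α} {a : α} (ha : a ∈ l)
    (h : f a ≠ []) : firstNonempty f l ≠ [] := by
  induction l with
  | nil => simp at ha
  | cons b l ih =>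
    rw [firstNonempty]
    split_ifs with hb
    · exact hb
    · rcases List.mem_cons.1 ha with rfl | ha
      · exact absurd h hb
      · exact ih ha

theorem exists_of_firstNonempty {α β : Type} {f : α → List β} {l : List α}
    (h : firstNonempty f l ≠ []) : ∃ a ∈ l, firstNonempty f l = f a := by
  induction l with
  | nil => simp [firstNonempty] at h
  | cons b l ih =>
    rw [firstNonempty] at h ⊢
    split_ifs at h ⊢ with hb
    · exact ⟨b, by simp, rfl⟩
    · obtain ⟨a, ha, h⟩ := ih h
      exact ⟨a, by simp [ha], h⟩

/-- The data of the dynamic program: the precedence relation, the number of machines, a vertex cover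
`C` of the comparability graph, and a list of the subsets of `C`. -/
structure Ctx (N : ℕ) where
  R : Fin N → Fin N → Bool
  m : ℕ
  C : Finset (Fin N)
  subs : List (Finset (Fin N))

namespace Ctx

variable {N : ℕ} (G : Ctx N)

/-- Jobs with a predecessor in the cover but not in `X`. -/
def blocked (X : Finset (Fin N)) : Finset (Fin N) :=
  univ.filter fun v => ∃ i ∈ G.C \ X, G.R i v = true

/-- Jobs with a successor in `B`. -/
def preceding (B : Finset (Fin N)) : Finset (Fin N) := univ.filter fun v => ∃ j ∈ B, G.R v j = true

/-- Jobs outside the cover with a predecessor outside `A`, with all predecessors in `U` and with a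
successor in `B`. -/
def forced (A U B : Finset (Fin N)) : Finset (Fin N) :=
  ((G.blocked A ∩ G.preceding B) \ G.blocked U) \ G.C

/-- No job outside the cover has a predecessor outside `W` and a successor in `B`. -/
abbrev Clear (W B : Finset (Fin N)) : Prop := (G.blocked W ∩ G.preceding B) \ G.C = ∅

/-- The jobs `U' \ U` of the cover can be executed together after those in `U`. -/
abbrev SlotOK (U U' : Finset (Fin N)) : Prop :=
  (U' \ U) ∩ G.blocked U = ∅ ∧ (U' \ U).card ≤ G.m

/-- All slots are full. -/
abbrev AllFull (p : Piece N) : Prop := ∀ z ∈ p, G.m ≤ z.card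

/-- A table entry at a chain of sets. -/
def get (τ : Tab N) (A A' U U' c B : Finset (Fin N)) : Piece N :=
  if A ⊆ A' ∧ A' ⊆ U ∧ U ⊆ U' ∧ U' ⊆ c ∧ c ⊆ B then τ A A' U U' c B else []

/-- Append the slot `U' \ U` to a piece that ends with the pair `(W, U)`. -/
def closeAfter (τ : Tab N) (V V' U U' W : Finset (Fin N)) : Piece N :=
  let p := get τ V V' W U U U'
  if p ≠ [] ∧ G.forced V W U' ⊆ jobs p ∧ G.Clear W U' then (U' \ U) :: p else []

/-- A piece from the slot `(V, V')` to the slot `(U, U')` in which all jobs between are forced. -/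
def closeAt (older : List (Tab N)) (V V' U U' : Finset (Fin N)) : Piece N :=
  if G.SlotOK U U' then
    match older with
    -- Without older tables the two slots are adjacent, that is `V' = U`.
    | [] => if V' ⊆ U ∧ U ⊆ V' ∧ G.Clear V U' then [U' \ U] else []
    | τ :: _ => firstNonempty (G.closeAfter τ V V' U U') G.subs
  else []

/-- A piece from the slot `(V, V')` to the slot `(U, U')` with exactly the jobs of level `c`. -/
def segment : List (Tab N) → (V V' U U' c : Finset (Fin N)) → Piece N
  | [], _, _, _, _, _ => []
  | τ :: older, V, V', U, U', c =>
    -- In a chain `c ⊆ U'` means `c = U'`.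
    if c ⊆ U' then G.closeAt older V V' U U' else
      let p := get τ V V' U U' U' c
      if G.forced V U c ⊆ jobs p then p else []

/-- Extend a piece that ends with the slot `(V, V')` by a segment. -/
def glue (τ : Tab N) (fwd : List (Tab N)) (A A' U U' c B V V' : Finset (Fin N)) : Piece N :=
  let p₁ := get τ A A' V V' c B
  let p₂ := G.segment fwd V V' U U' c
  if p₁ ≠ [] ∧ G.AllFull p₁ ∧ p₂ ≠ [] ∧ G.AllFull p₂.tail then p₂ ++ p₁ else []

/-- The first piece that is obtained by gluing two pieces. -/
def split : List (Tab N) → List (Tab N) → (A A' U U' c B : Finset (Fin N)) → Piece N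
  | [], _, _, _, _, _, _, _ => []
  | τ :: rev, fwd, A, A', U, U', c, B =>
    let r := firstNonempty
      (fun V => firstNonempty (fun V' => G.glue τ fwd A A' U U' c B V V') G.subs) G.subs
    if r ≠ [] then r else split rev fwd.tail A A' U U' c B

/-- Put as many jobs as possible into the last slot. -/
def fill (A U B : Finset (Fin N)) : Piece N → Piece N
  | [] => []
  | z :: zs => (z ∪ firstElems (G.forced A U B \ jobs (z :: zs)) (G.m - z.card)) :: zs

/-- A piece, given the candidate that is not glued. -/
def extend (tabs : List (Tab N)) (base : Piece N) (A A' U U' c B : Finset (Fin N)) : Piece N :=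
  G.fill A U B (if base ≠ [] ∧ G.AllFull base.tail then base
    else G.split tabs.reverse tabs A A' U U' c B)

/-- The table of the pieces with `tabs.length + 1` slots, given the tables for fewer slots, the
latest one first. -/
def entry (tabs : List (Tab N)) : Tab N := fun A A' U U' c B =>
  if c ⊆ U' then G.extend tabs (G.closeAt tabs A A' U U') A A' U U' c B else
    -- For `c` beyond `U'`, an inner extension with levels `U'` and `c` comes first; it is a base
    -- only if it already has all forced jobs of level `c`.
    let b := G.extend tabs (G.closeAt tabs A A' U U') A A' U U' U' c
    G.extend tabs (if G.forced A U c ⊆ jobs b then b else []) A A' U U' c B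

/-- The tables of the pieces with at most `L` slots. -/
def tables : ℕ → List (Tab N)
  | 0 => []
  | L + 1 => G.entry (tables L) :: tables L

/-- The result of the dynamic program: a schedule in `T` slots between the slots of `bot` and of
`top`, and with the slot of `top`. -/
def answer (T : ℕ) (bot top : Fin N) : Piece N :=
  G.closeAt (G.tables T) ∅ {bot} (G.C \ {top}) G.C

/-! ### Soundness -/

/-- The jobs of the cover that are completed after a piece. -/
def after (A' : Finset (Fin N)) (p : Piece N) : Finset (Fin N) := A' ∪ (jobs p ∩ G.C)

/-- The slots of a piece obey the constraints if it starts after the jobs `A'` of the cover. -/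
def Valid (A' : Finset (Fin N)) : Piece N → Prop
  | [] => True
  | z :: zs => Valid A' zs ∧ z.card ≤ G.m ∧ (∀ y ∈ z, y ∉ G.blocked (G.after A' zs)) ∧
      (∀ y ∈ z, y ∈ G.C → y ∉ G.after A' zs) ∧
      ∀ y ∈ z, y ∉ G.C → y ∉ jobs zs ∧ y ∉ G.preceding (G.after A' (z :: zs))

/-- What a piece in a table is. -/
structure Good (A A' U U' c B : Finset (Fin N)) (z : Finset (Fin N)) (zs : Piece N) : Prop where
  valid : G.Valid A' (z :: zs)
  before_eq : G.after A' zs = U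
  after_eq : G.after A' (z :: zs) = U'
  le : G.forced A U c ⊆ jobs (z :: zs)
  ge : ∀ v ∈ jobs (z :: zs), v ∉ G.C → v ∈ G.forced A U B

/-! ### Elementary properties of blocked, preceding and forced jobs -/

variable {G}

theorem mem_blocked {X : Finset (Fin N)} {v : Fin N} :
    v ∈ G.blocked X ↔ ∃ i ∈ G.C, i ∉ X ∧ G.R i v = true := by
  simp [blocked, and_assoc]

theorem mem_preceding {X : Finset (Fin N)} {v : Fin N} :
    v ∈ G.preceding X ↔ ∃ i ∈ X, G.R v i = true := by
  simp [preceding]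

theorem mem_forced {A U B : Finset (Fin N)} {v : Fin N} :
    v ∈ G.forced A U B ↔ v ∈ G.blocked A ∧ v ∈ G.preceding B ∧ v ∉ G.blocked U ∧ v ∉ G.C := by
  simp [forced, and_assoc]

theorem clear_iff {W B : Finset (Fin N)} :
    G.Clear W B ↔ ∀ v ∈ G.blocked W, v ∈ G.preceding B → v ∈ G.C := by
  simp [Clear, Finset.ext_iff]

theorem blocked_anti {X Y : Finset (Fin N)} (h : X ⊆ Y) : G.blocked Y ⊆ G.blocked X := by
  intro v hv
  rw [mem_blocked] at *
  obtain ⟨i, hi, hY, hR⟩ := hv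
  exact ⟨i, hi, fun hX => hY (h hX), hR⟩

theorem preceding_mono {X Y : Finset (Fin N)} (h : X ⊆ Y) : G.preceding X ⊆ G.preceding Y := by
  intro v hv
  rw [mem_preceding] at *
  obtain ⟨i, hi, hR⟩ := hv
  exact ⟨i, h hi, hR⟩

theorem subset_after (A' : Finset (Fin N)) (p : Piece N) : A' ⊆ G.after A' p := subset_union_left

theorem after_append (A' : Finset (Fin N)) (p q : Piece N) :
    G.after A' (q ++ p) = G.after (G.after A' p) q := by
  ext; simp [after]; tauto

theorem after_subset_cons (A' z : Finset (Fin N)) (p : Piece N) :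
    G.after A' p ⊆ G.after A' (z :: p) := by
  intro v; simp only [after, jobs_cons, mem_union, mem_inter]; tauto

/-- Later slots see the earlier ones through the completed cover jobs, with one exception:
repetition of a job outside the cover, which `hd` rules out. -/
theorem Valid.append {A' V' : Finset (Fin N)} {p q : Piece N} (hp : G.Valid A' p)
    (hV : G.after A' p = V') (hq : G.Valid V' q)
    (hd : ∀ v ∈ jobs q, v ∉ G.C → v ∉ jobs p) : G.Valid A' (q ++ p) := by
  subst hV
  induction q with
  | nil => exact hp
  | cons z zs ih =>
    obtain ⟨h₁, h₂, h₃, h₄, h₅⟩ := hq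
    rw [List.cons_append]
    refine ⟨ih (fun v hv => hd v (by simp [hv])) h₁, h₂, ?_, ?_, ?_⟩
    · rwa [after_append]
    · rwa [after_append]
    · intro y hy hyC
      obtain ⟨h, h'⟩ := h₅ y hy hyC
      refine ⟨?_, ?_⟩
      · simp only [jobs_append, mem_union, not_or]
        exact ⟨h, hd y (by simp [hy]) hyC⟩
      · rw [← List.cons_append, after_append]
        exact h'

theorem Good.slots_subset {A A' U U' c B z : Finset (Fin N)} {zs : Piece N}
    (h : G.Good A A' U U' c B z zs) : A' ⊆ U ∧ U ⊆ U' :=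
  ⟨h.before_eq ▸ subset_after _ _, h.before_eq ▸ h.after_eq ▸ after_subset_cons _ _ _⟩

/-- A job outside the cover is in the second piece only if it is blocked at `V`, and in the first
only if it is not. So no job occurs twice, and the forced jobs split along the same line. -/
theorem Good.append {A A' V V' U U' c B z₁ z₂ : Finset (Fin N)} {zs₁ zs₂ : Piece N}
    (h₁ : G.Good A A' V V' c B z₁ zs₁) (h₂ : G.Good V V' U U' c c z₂ zs₂)
    (hA : A ⊆ A') (hcB : c ⊆ B) : G.Good A A' U U' c B z₂ (zs₂ ++ z₁ :: zs₁) := by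
  have hVU : V ⊆ U := h₁.slots_subset.2.trans h₂.slots_subset.1
  have hAV : A ⊆ V := hA.trans h₁.slots_subset.1
  refine ⟨?_, ?_, ?_, ?_, ?_⟩
  · refine h₁.valid.append h₁.after_eq h₂.valid fun v hv hC hv' => ?_
    exact (mem_forced.1 (h₁.ge v hv' hC)).2.2.1 (mem_forced.1 (h₂.ge v hv hC)).1
  · rw [after_append, h₁.after_eq, h₂.before_eq]
  · rw [← List.cons_append, after_append, h₁.after_eq, h₂.after_eq]
  · intro v hv
    rw [← List.cons_append, jobs_append, mem_union]
    obtain ⟨ha, hb, hc, hd⟩ := mem_forced.1 hv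
    by_cases hV : v ∈ G.blocked V
    · exact .inl (h₂.le (mem_forced.2 ⟨hV, hb, hc, hd⟩))
    · exact .inr (h₁.le (mem_forced.2 ⟨ha, hb, hV, hd⟩))
  · intro v hv hC
    rw [← List.cons_append, jobs_append, mem_union] at hv
    rcases hv with hv | hv
    · obtain ⟨ha, hb, hc, hd⟩ := mem_forced.1 (h₂.ge v hv hC)
      exact mem_forced.2 ⟨blocked_anti hAV ha, preceding_mono hcB hb, hc, hd⟩
    · obtain ⟨ha, hb, hc, hd⟩ := mem_forced.1 (h₁.ge v hv hC)
      exact mem_forced.2 ⟨ha, hb, fun h => hc (blocked_anti hVU h), hd⟩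

theorem Good.mono {A A' U U' c B B' z : Finset (Fin N)} {zs : Piece N}
    (h : G.Good A A' U U' c B z zs) (hB : B ⊆ B') : G.Good A A' U U' c B' z zs := by
  refine ⟨h.valid, h.before_eq, h.after_eq, h.le, fun v hv hC => ?_⟩
  obtain ⟨ha, hb, hc, hd⟩ := mem_forced.1 (h.ge v hv hC)
  exact mem_forced.2 ⟨ha, preceding_mono hB hb, hc, hd⟩

/-- A piece in the table of the pieces with `L` slots: all slots but the last are full, and the last
one is full unless all jobs that may be in the piece are in it. -/
def TableOK (τ : Tab N) (L : ℕ) : Prop :=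
  ∀ ⦃A A' U U' c B⦄, A ⊆ A' → U ⊆ U' → U' ⊆ c → c ⊆ B → c ⊆ G.C → ∀ ⦃z zs⦄, τ A A' U U' c B = z :: zs →
    G.Good A A' U U' c B z zs ∧ zs.length + 1 = L ∧ G.AllFull zs ∧
      (G.m ≤ z.card ∨ G.forced A U B ⊆ jobs (z :: zs))

/-- A list of tables for `L`, `L - 1`, …, `1` slots. -/
def TablesOK (G : Ctx N) : List (Tab N) → Prop
  | [] => True
  | τ :: l => G.TableOK τ (l.length + 1) ∧ TablesOK G l

theorem get_eq_cons {τ : Tab N} {A A' U U' c B z : Finset (Fin N)} {zs : Piece N}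
    (h : get τ A A' U U' c B = z :: zs) :
    (A ⊆ A' ∧ A' ⊆ U ∧ U ⊆ U' ∧ U' ⊆ c ∧ c ⊆ B) ∧ τ A A' U U' c B = z :: zs := by
  unfold get at h
  split_ifs at h with h'
  exact ⟨h', h⟩

/-- `Clear W U'` makes every job outside the cover with a successor in `U'` unblocked already at
`W`. Hence the jobs forced up to `U` are those forced up to `W`, and the appended slot needs only
cover jobs. The set `W` is part of the conclusion because `answer_sound` uses it. -/
theorem good_closeAt {older : List (Tab N)} (ho : TablesOK G older)
    {V V' U U' z : Finset (Fin N)} {zs : Piece N} (hV : V ⊆ V') (hU : U ⊆ U') (hC : U' ⊆ G.C)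
    (h : G.closeAt older V V' U U' = z :: zs) :
    G.Good V V' U U' U' U' z zs ∧ zs.length = older.length ∧
      z = U' \ U ∧ ∃ W ⊆ U, G.Clear W U' := by
  unfold closeAt at h
  by_cases hs : G.SlotOK U U'
  swap
  · simp [if_neg hs] at h
  rw [if_pos hs] at h
  obtain ⟨hs₁, hs₂⟩ := hs
  have hY : (U' \ U) ∩ G.C = U' \ U := inter_eq_left.2 (sdiff_subset.trans hC)
  cases older with
  | nil =>
    simp only at h
    split_ifs at h with hcl
    obtain ⟨hVU, hUV, hcl⟩ := hcl
    obtain rfl := hVU.antisymm hUV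
    simp only [List.cons.injEq] at h
    obtain ⟨rfl, rfl⟩ := h
    have ha : G.after V' [] = V' := by simp [after]
    have ha' : G.after V' [U' \ V'] = U' := by
      simp [after, hY, hU]
    refine ⟨⟨⟨trivial, hs₂, ?_, ?_, ?_⟩, ha, ha', ?_, ?_⟩, rfl, rfl, V, hV, hcl⟩
    · intro y hy hb
      rw [ha] at hb
      have : y ∈ (U' \ V') ∩ G.blocked V' := mem_inter.2 ⟨hy, hb⟩
      simp [hs₁] at this
    · intro y hy _
      rw [ha]
      exact (mem_sdiff.1 hy).2
    · intro y hy hyC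
      exact absurd (hC (mem_sdiff.1 hy).1) hyC
    · intro v hv
      obtain ⟨h₁, h₂, -, h₄⟩ := mem_forced.1 hv
      exact absurd (clear_iff.1 hcl v h₁ h₂) h₄
    · intro v hv hvC
      simp only [jobs_cons, jobs_nil, union_empty, mem_sdiff] at hv
      exact absurd (hC hv.1) hvC
  | cons τ older =>
    simp only at h
    obtain ⟨W, -, hW⟩ := exists_of_firstNonempty (f := G.closeAfter τ V V' U U') (l := G.subs)
      (by simp [h])
    rw [h] at hW
    unfold closeAfter at hW
    simp only at hW
    split_ifs at hW with hcl
    obtain ⟨hp, hf, hcl⟩ := hcl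
    obtain ⟨w, ws, hp⟩ := List.exists_cons_of_ne_nil hp
    rw [hp] at hW hf
    simp only [List.cons.injEq] at hW
    obtain ⟨rfl, rfl⟩ := hW
    obtain ⟨⟨-, -, hWU, -, -⟩, hp⟩ := get_eq_cons hp
    obtain ⟨hg, hl, -, -⟩ := ho.1 hV hWU subset_rfl hU (hU.trans hC) hp
    have ha' : G.after V' ((U' \ U) :: w :: ws) = U' := by
      have := hg.after_eq
      rw [show (U' \ U) :: w :: ws = [U' \ U] ++ (w :: ws) from rfl, after_append, this]
      simp [after, hY, hU]
    refine ⟨⟨⟨hg.valid, hs₂, ?_, ?_, ?_⟩, hg.after_eq, ha', ?_, ?_⟩, by simpa using hl, rfl, W, hWU,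
      hcl⟩
    · intro y hy hb
      rw [hg.after_eq] at hb
      have : y ∈ (U' \ U) ∩ G.blocked U := mem_inter.2 ⟨hy, hb⟩
      simp [hs₁] at this
    · intro y hy _
      rw [hg.after_eq]
      exact (mem_sdiff.1 hy).2
    · intro y hy hyC
      exact absurd (hC (mem_sdiff.1 hy).1) hyC
    · intro v hv
      obtain ⟨h₁, h₂, h₃, h₄⟩ := mem_forced.1 hv
      rw [jobs_cons]
      exact mem_union_right _ (hf (mem_forced.2 ⟨h₁, h₂,
        fun hb => h₄ (clear_iff.1 hcl v hb h₂), h₄⟩))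
    · intro v hv hvC
      rw [jobs_cons, mem_union] at hv
      rcases hv with hv | hv
      · exact absurd (hC (mem_sdiff.1 hv).1) hvC
      · obtain ⟨h₁, h₂, h₃, h₄⟩ := mem_forced.1 (hg.ge v hv hvC)
        exact mem_forced.2 ⟨h₁, h₂, fun hb => h₃ (blocked_anti hWU hb), h₄⟩

/-- A stored piece with levels `U'` and `c` is only known to contain the forced jobs of level `U'`;
the test in `segment` raises this to level `c`. -/
theorem good_segment {fwd : List (Tab N)} (hf : TablesOK G fwd) {V V' U U' c z : Finset (Fin N)}
    {zs : Piece N} (hV : V ⊆ V') (hU : U ⊆ U') (hUc : U' ⊆ c) (hC : c ⊆ G.C)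
    (h : G.segment fwd V V' U U' c = z :: zs) :
    G.Good V V' U U' c c z zs ∧ zs.length + 1 = fwd.length := by
  cases fwd with
  | nil => simp [segment] at h
  | cons τ older =>
    rw [segment] at h
    by_cases h₁ : c ⊆ U'
    · rw [if_pos h₁] at h
      obtain rfl := h₁.antisymm hUc
      obtain ⟨hg, hl, -⟩ := good_closeAt hf.2 hV hU hC h
      exact ⟨hg, by simp [hl]⟩
    · rw [if_neg h₁] at h
      simp only at h
      split_ifs at h with h₂
      rw [h] at h₂
      obtain ⟨-, hp⟩ := get_eq_cons h
      obtain ⟨hg, hl, -, -⟩ := hf.1 hV hU subset_rfl hUc (hUc.trans hC) hp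
      exact ⟨⟨hg.valid, hg.before_eq, hg.after_eq, h₂, hg.ge⟩, by simp [hl]⟩

/-- `L - fwd.length` is the number of tables dropped so far. The first piece has `L - fwd.length +
1` slots and the segment `fwd.length`, so the total is always `L + 1`. -/
theorem good_split {rev fwd : List (Tab N)} {L : ℕ}
    (hr : ∀ i (h : i < rev.length), G.TableOK rev[i] (i + 1 + (L - fwd.length)))
    (hf : TablesOK G fwd) (hL : fwd.length ≤ L) {A A' U U' c B z : Finset (Fin N)}
    {zs : Piece N} (hA : A ⊆ A') (hU : U ⊆ U') (hUc : U' ⊆ c) (hcB : c ⊆ B) (hC : c ⊆ G.C)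
    (h : G.split rev fwd A A' U U' c B = z :: zs) :
    G.Good A A' U U' c B z zs ∧ zs.length = L ∧ G.AllFull zs := by
  induction rev generalizing fwd with
  | nil => simp [split] at h
  | cons τ rev ih =>
    rw [split] at h
    split_ifs at h with h₁
    · obtain ⟨V, -, hV⟩ := exists_of_firstNonempty h₁
      rw [hV] at h
      obtain ⟨V', -, hV'⟩ := exists_of_firstNonempty
        (f := fun V' => G.glue τ fwd A A' U U' c B V V') (l := G.subs) (by simp [h])
      rw [hV'] at h
      unfold glue at h
      simp only at h
      split_ifs at h with h₂
      obtain ⟨hp₁, hf₁, hp₂, hf₂⟩ := h₂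
      obtain ⟨z₁, zs₁, e₁⟩ := List.exists_cons_of_ne_nil hp₁
      obtain ⟨z₂, zs₂, e₂⟩ := List.exists_cons_of_ne_nil hp₂
      rw [e₁] at hf₁ h
      rw [e₂] at hf₂ h
      simp only [List.cons_append, List.cons.injEq] at h
      obtain ⟨rfl, rfl⟩ := h
      obtain ⟨⟨-, hAV, hVV, hVc, -⟩, e₁⟩ := get_eq_cons e₁
      obtain ⟨g₁, l₁, -⟩ := hr 0 (by simp) hA hVV hVc hcB hC e₁
      obtain ⟨g₂, l₂⟩ := good_segment hf hVV hU hUc hC e₂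
      refine ⟨g₁.append g₂ hA hcB, ?_, ?_⟩
      · simp only [List.length_append, List.length_cons]
        omega
      · intro x hx
        rcases List.mem_append.1 hx with hx | hx
        · exact hf₂ x hx
        · exact hf₁ x hx
    · have hne : fwd ≠ [] ∨ fwd = [] := by tauto
      rcases hne with hne | rfl
      · obtain ⟨σ, fwd, rfl⟩ := List.exists_cons_of_ne_nil hne
        refine ih ?_ hf.2 (by simp at hL ⊢; omega) h
        intro i hi
        have := hr (i + 1) (by simpa using hi)
        simp only [List.length_cons, List.getElem_cons_succ] at this hL ⊢
        rwa [show i + 1 + (L - fwd.length) = i + 1 + 1 + (L - (fwd.length + 1)) by omega]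
      -- With no table left for the segment nothing can be glued.
      · exfalso
        have key : ∀ rev : List (Tab N), G.split rev [] A A' U U' c B = [] := by
          intro rev
          induction rev with
          | nil => rfl
          | cons σ rev ih =>
            rw [split]
            simp only [List.tail_nil, ih]
            split_ifs with h₂
            · obtain ⟨V, -, hV⟩ := exists_of_firstNonempty h₂
              rw [hV] at h₂ ⊢
              obtain ⟨V', -, hV'⟩ := exists_of_firstNonempty h₂
              rw [hV']
              simp [glue, segment]
            · rfl
        rw [List.tail_nil, key] at h
        simp at h

theorem TablesOK.getElem {l : List (Tab N)} (h : TablesOK G l) (i : ℕ) (hi : i < l.length) :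
    G.TableOK l[i] (l.length - i) := by
  induction l generalizing i with
  | nil => simp at hi
  | cons τ l ih =>
    cases i with
    | zero => simpa using h.1
    | succ i => simpa using ih h.2 i (by simpa using hi)

/-- Filling the last slot is safe: an unused job of `forced A U B` has all its predecessors in `U`,
and it has no successor in `U'`, since otherwise it would be forced at level `c` and already used.
Afterwards the slot is full or no candidate remains. -/
theorem good_extend {tabs : List (Tab N)} (ht : TablesOK G tabs) {base : Piece N}
    {A A' U U' c B z : Finset (Fin N)} {zs : Piece N} (hA : A ⊆ A')
    (hU : U ⊆ U') (hUc : U' ⊆ c) (hcB : c ⊆ B) (hC : c ⊆ G.C)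
    (hb : ∀ z zs, base = z :: zs → G.Good A A' U U' c c z zs ∧ zs.length = tabs.length)
    (h : G.extend tabs base A A' U U' c B = z :: zs) :
    G.Good A A' U U' c B z zs ∧ zs.length = tabs.length ∧ G.AllFull zs ∧
      (G.m ≤ z.card ∨ G.forced A U B ⊆ jobs (z :: zs)) := by
  unfold extend at h
  generalize hp : (if base ≠ [] ∧ G.AllFull base.tail then base
    else G.split tabs.reverse tabs A A' U U' c B) = p at h
  cases p with
  | nil => simp [fill] at h
  | cons w ws =>
    have key : G.Good A A' U U' c B w ws ∧ ws.length = tabs.length ∧ G.AllFull ws := by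
      split_ifs at hp with h₁
      · obtain ⟨g, hl⟩ := hb _ _ hp
        exact ⟨g.mono hcB, hl, by simpa [hp] using h₁.2⟩
      · refine good_split (L := tabs.length) ?_ ht le_rfl hA hU hUc hcB hC hp
        intro i hi
        simp only [List.length_reverse] at hi
        rw [List.getElem_reverse]
        have := ht.getElem (tabs.length - 1 - i) (by omega)
        rwa [show tabs.length - (tabs.length - 1 - i) = i + 1 + (tabs.length - tabs.length) by
          omega] at this
    obtain ⟨g, hl, hful⟩ := key
    simp only [fill, List.cons.injEq] at h
    obtain ⟨h, rfl⟩ := h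
    set S := G.forced A U B \ jobs (w :: ws) with hS
    have hSub := firstElems_subset S (G.m - w.card)
    have hnotC : ∀ v ∈ S, v ∉ G.C := fun v hv => (mem_forced.1 (mem_sdiff.1 hv).1).2.2.2
    have hdisj : Disjoint w (firstElems S (G.m - w.card)) := by
      rw [disjoint_left]
      intro v hv hv'
      exact (mem_sdiff.1 (hSub hv')).2 (by simp [hv])
    have hcard : z.card = w.card + min S.card (G.m - w.card) := by
      rw [← h, card_union_of_disjoint hdisj, card_firstElems]
    have hsup : jobs (w :: ws) ⊆ jobs (z :: ws) := by
      rw [← h]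
      intro v
      simp only [jobs_cons, mem_union]
      tauto
    have hafter : G.after A' (z :: ws) = G.after A' (w :: ws) := by
      ext v
      have : v ∈ firstElems S (G.m - w.card) → v ∉ G.C := fun hv => hnotC v (hSub hv)
      simp only [after, jobs_cons, ← h, mem_union, mem_inter]
      tauto
    obtain ⟨v₁, v₂, v₃, v₄, v₅⟩ := g.valid
    have hmem : ∀ y ∈ z, y ∈ w ∨ y ∈ S := by
      intro y hy
      rw [← h, mem_union] at hy
      exact hy.imp_right fun hy => hSub hy
    refine ⟨⟨⟨v₁, ?_, ?_, ?_, ?_⟩, g.before_eq, hafter.trans g.after_eq, g.le.trans hsup, ?_⟩, hl,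
      hful, ?_⟩
    · omega
    · intro y hy
      rcases hmem y hy with hy | hy
      · exact v₃ y hy
      · rw [g.before_eq]
        exact (mem_forced.1 (mem_sdiff.1 hy).1).2.2.1
    · intro y hy hyC
      rcases hmem y hy with hy | hy
      · exact v₄ y hy hyC
      · exact absurd hyC (hnotC y hy)
    · intro y hy hyC
      rw [hafter]
      rcases hmem y hy with hy | hy
      · exact v₅ y hy hyC
      · obtain ⟨hy₁, hy₂⟩ := mem_sdiff.1 hy
        refine ⟨fun h => hy₂ (by simp [h]), ?_⟩
        rw [g.after_eq]
        intro hyU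
        obtain ⟨h₁, h₂, h₃, h₄⟩ := mem_forced.1 hy₁
        exact hy₂ (g.le (mem_forced.2 ⟨h₁, preceding_mono hUc hyU, h₃, h₄⟩))
    · intro v hv hvC
      rw [jobs_cons, mem_union] at hv
      rcases hv with hv | hv
      · rcases hmem v hv with hv | hv
        · exact g.ge v (by simp [hv]) hvC
        · exact (mem_sdiff.1 hv).1
      · exact g.ge v (by simp [hv]) hvC
    · by_cases hS' : S.card ≤ G.m - w.card
      · right
        have hall : firstElems S (G.m - w.card) = S :=
          eq_of_subset_of_card_le hSub (by rw [card_firstElems]; omega)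
        intro v hv
        by_cases hv' : v ∈ jobs (w :: ws)
        · exact hsup hv'
        · have : v ∈ S := mem_sdiff.2 ⟨hv, hv'⟩
          rw [← hall] at this
          simp [← h, this]
      · left
        omega

/-- The inner extension has levels `U'` and `c`; the test on `forced A U c` turns it into a
legitimate base with both levels equal to `c`. -/
theorem tableOK_entry {tabs : List (Tab N)} (ht : TablesOK G tabs) :
    G.TableOK (G.entry tabs) (tabs.length + 1) := by
  intro A A' U U' c B hA hU hUc hcB hC z zs h
  have hclose : ∀ z zs, G.closeAt tabs A A' U U' = z :: zs →
      G.Good A A' U U' U' U' z zs ∧ zs.length = tabs.length := fun z zs h =>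
    ⟨(good_closeAt ht hA hU (hUc.trans hC) h).1, (good_closeAt ht hA hU (hUc.trans hC) h).2.1⟩
  simp only [entry] at h
  by_cases h₁ : c ⊆ U'
  · rw [if_pos h₁] at h
    obtain rfl := h₁.antisymm hUc
    obtain ⟨g, hl, h₂⟩ := good_extend ht hA hU subset_rfl hcB hC hclose h
    exact ⟨g, by rw [hl], h₂⟩
  · rw [if_neg h₁] at h
    suffices hb : _ by
      obtain ⟨g, hl, h₂⟩ := good_extend ht hA hU hUc hcB hC hb h
      exact ⟨g, by rw [hl], h₂⟩
    intro w ws hw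
    split_ifs at hw with h₃
    rw [hw] at h₃
    obtain ⟨g, hl, -⟩ := good_extend ht hA hU subset_rfl hUc (hUc.trans hC) hclose hw
    exact ⟨⟨g.valid, g.before_eq, g.after_eq, h₃, g.ge⟩, hl⟩

theorem length_tables (L : ℕ) : (G.tables L).length = L := by
  induction L with
  | zero => rfl
  | succ L ih => simp [tables, ih]

theorem tablesOK_tables (L : ℕ) : TablesOK G (G.tables L) := by
  induction L with
  | zero => trivial
  | succ L ih => exact ⟨tableOK_entry ih, ih⟩

/-- The constraints on the relation: `C` is a vertex cover that contains a minimum and a maximum. -/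
structure Bounded (G : Ctx N) (bot top : Fin N) : Prop where
  cover : ∀ i j, G.R i j = true → i ∈ G.C ∨ j ∈ G.C
  bot_mem : bot ∈ G.C
  top_mem : top ∈ G.C
  bot_R : ∀ v, v ≠ bot → G.R bot v = true
  R_top : ∀ v, v ≠ top → G.R v top = true

/-- A valid piece obeys the precedence constraints, and its slots are disjoint. -/
theorem Valid.order (hcov : ∀ i j, G.R i j = true → i ∈ G.C ∨ j ∈ G.C) {A' : Finset (Fin N)}
    {p : Piece N} (h : G.Valid A' p) : p.Pairwise (fun z w => Disjoint z w ∧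
      ∀ i ∈ z, ∀ j ∈ w, G.R i j = false) ∧
      ∀ z ∈ p, z.card ≤ G.m ∧ ∀ i ∈ z, ∀ j ∈ z, G.R i j = false := by
  induction p with
  | nil => simp
  | cons z zs ih =>
    obtain ⟨h₁, h₂, h₃, h₄, h₅⟩ := h
    obtain ⟨ih₁, ih₂⟩ := ih h₁
    have hj : ∀ w ∈ zs, ∀ i ∈ w, i ∈ jobs zs := by
      intro w hw i hi
      clear * - hw hi
      induction zs with
      | nil => simp at hw
      | cons a l ih =>
        rcases List.mem_cons.1 hw with rfl | hw
        · simp [hi]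
        · simp [ih hw]
    have hnew : ∀ i ∈ z, i ∉ jobs zs := by
      intro i hi hi'
      by_cases hC : i ∈ G.C
      · exact h₄ i hi hC (by simp [after, hi', hC])
      · exact (h₅ i hi hC).1 hi'
    have hz : ∀ i ∈ z, ∀ j ∈ jobs (z :: zs), G.R i j = false := by
      intro i hi j hj
      by_contra hR
      simp only [Bool.not_eq_false] at hR
      -- A violated constraint has an end in the cover. If this is `i`, then `j` was blocked when it
      -- was scheduled; if it is only `j`, the successor condition on `i` fails.
      by_cases hC : i ∈ G.C
      · rw [jobs_cons, mem_union] at hj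
        rcases hj with hj | hj
        · exact h₃ j hj (mem_blocked.2 ⟨i, hC, h₄ i hi hC, hR⟩)
        -- `j` was unblocked by the cover jobs completed before its own slot, and `i` is not among
        -- them.
        · have key : ∀ p : Piece N, G.Valid A' p → j ∈ jobs p → ∃ X, X ⊆ G.after A' p ∧
              j ∉ G.blocked X := by
            intro p hp hjp
            induction p with
            | nil => simp at hjp
            | cons w ws ih =>
              obtain ⟨g₁, g₂, g₃, g₄, g₅⟩ := hp
              rw [jobs_cons, mem_union] at hjp
              rcases hjp with hjp | hjp
              · exact ⟨_, after_subset_cons _ _ _, g₃ j hjp⟩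
              · obtain ⟨X, hX, hX'⟩ := ih g₁ hjp
                exact ⟨X, hX.trans (after_subset_cons _ _ _), hX'⟩
          obtain ⟨X, hX, hX'⟩ := key zs h₁ hj
          exact hX' (mem_blocked.2 ⟨i, hC, fun h => h₄ i hi hC (hX h), hR⟩)
      · have hjC : j ∈ G.C := (hcov i j hR).resolve_left hC
        exact (h₅ i hi hC).2 (mem_preceding.2 ⟨j, by
          rw [after, mem_union, mem_inter]; exact .inr ⟨hj, hjC⟩, hR⟩)
    refine ⟨List.pairwise_cons.2 ⟨fun w hw => ⟨?_, fun i hi j hjw => ?_⟩, ih₁⟩, ?_⟩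
    · exact disjoint_left.2 fun i hi hi' => hnew i hi (hj w hw i hi')
    · exact hz i hi j (by simp [hj w hw j hjw])
    · intro w hw
      rcases List.mem_cons.1 hw with rfl | hw
      · exact ⟨h₂, fun i hi j hj => hz i hi j (by simp [hj])⟩
      · exact ih₂ w hw

theorem Valid.not_mem_of_mem {A' : Finset (Fin N)} {p : Piece N} (h : G.Valid A' p) {v : Fin N}
    (hv : v ∈ jobs p) (hC : v ∈ G.C) : v ∉ A' := by
  induction p with
  | nil => simp at hv
  | cons z zs ih =>
    obtain ⟨h₁, -, -, h₄, -⟩ := h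
    rw [jobs_cons, mem_union] at hv
    rcases hv with hv | hv
    · exact fun h => h₄ v hv hC (subset_after _ _ h)
    · exact ih h₁ hv

/-- A result of the dynamic program is a schedule. -/
theorem answer_sound {bot top : Fin N} (hG : G.Bounded bot top) {T : ℕ} {z : Finset (Fin N)}
    {p : Piece N} (h : G.answer T bot top = z :: p) :
    p.length = T ∧ (∀ v, v ∈ jobs p ↔ v ≠ bot ∧ v ≠ top) ∧
    p.Pairwise (fun z w => Disjoint z w ∧ ∀ i ∈ z, ∀ j ∈ w, G.R i j = false) ∧
      ∀ z ∈ p, z.card ≤ G.m ∧ ∀ i ∈ z, ∀ j ∈ z, G.R i j = false := by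
  obtain ⟨g, hl, hz, W, hW, hclear⟩ := good_closeAt (tablesOK_tables T) (empty_subset _)
    sdiff_subset subset_rfl h
  have hz' : z = {top} := by
    rw [hz]; ext v; simp only [mem_sdiff, mem_singleton]
    constructor
    · tauto
    · rintro rfl; simp [hG.top_mem]
  have ho := g.valid.1.order hG.cover
  refine ⟨hl.trans (length_tables T), fun v => ?_, ho⟩
  have haft : {bot} ∪ jobs p ∩ G.C = G.C \ {top} := g.before_eq
  obtain ⟨h₁, -⟩ := g.valid
  -- Cover jobs are accounted for by `before_eq`. All other jobs are forced, because they lie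
  -- between `bot` and `top`.
  by_cases hv : v ∈ G.C
  · constructor
    · intro hvp
      refine ⟨fun hb => h₁.not_mem_of_mem hvp hv (by simp [hb]), ?_⟩
      have : v ∈ G.C \ {top} := haft ▸ mem_union_right _ (mem_inter.2 ⟨hvp, hv⟩)
      simpa using (mem_sdiff.1 this).2
    · rintro ⟨h₁, h₂⟩
      have : v ∈ G.C \ {top} := by simp [hv, h₂]
      rw [← haft] at this
      simpa [h₁, hv] using this
  · have hb : v ≠ bot := fun h => hv (h ▸ hG.bot_mem)
    have ht : v ≠ top := fun h => hv (h ▸ hG.top_mem)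
    refine ⟨fun _ => ⟨hb, ht⟩, fun _ => ?_⟩
    have h₁ : v ∈ G.blocked ∅ := mem_blocked.2 ⟨bot, hG.bot_mem, by simp, hG.bot_R v hb⟩
    have h₂ : v ∈ G.preceding G.C := mem_preceding.2 ⟨top, hG.top_mem, hG.R_top v ht⟩
    -- A job blocked at `C \ {top}` is blocked at the smaller set `W`, against `Clear W C`.
    have h₃ : v ∉ G.blocked (G.C \ {top}) := fun h =>
      hv (clear_iff.1 hclear v (blocked_anti hW h) h₂)
    have := g.le (mem_forced.2 ⟨h₁, h₂, h₃, hv⟩)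
    simpa [hz', ht] using this

end Ctx

namespace Ctx
variable {N : ℕ} {G : Ctx N}

/-! ### Completeness -/

/-- The jobs of the cover that are scheduled before the slot `t`. -/
def before (G : Ctx N) (σ : Fin N → ℕ) (t : ℕ) : Finset (Fin N) := G.C.filter fun v => σ v < t

/-- A schedule without idle machines in the slots `1, …, T`, with a minimum job in slot `0` and a
maximum job in slot `T + 1`. -/
structure FullSchedule (G : Ctx N) (bot top : Fin N) (T : ℕ) (σ : Fin N → ℕ) : Prop where
  order : ∀ i j, G.R i j = true → σ i < σ j
  zero_iff : ∀ v, σ v = 0 ↔ v = bot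
  last_iff : ∀ v, σ v = T + 1 ↔ v = top
  le : ∀ v, σ v ≤ T + 1
  full : ∀ t, 1 ≤ t → t ≤ T → (univ.filter fun v => σ v = t).card = G.m

/-- Jobs outside the cover are scheduled with the earliest deadline first. -/
def EarliestFirst (G : Ctx N) (σ : Fin N → ℕ) : Prop :=
  ∀ v w, v ∉ G.C → w ∉ G.C → σ v < σ w → w ∉ G.blocked (G.before σ (σ v)) →
    ∀ b, w ∈ G.preceding (G.before σ b) → v ∈ G.preceding (G.before σ b)

/-- Jobs with a successor in `β` that can be executed in slot `a` are completed after it. -/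
def Separates (G : Ctx N) (σ : Fin N → ℕ) (β : Finset (Fin N)) (a : ℕ) : Prop :=
  ∀ w ∉ G.C, w ∈ G.preceding β → w ∉ G.blocked (G.before σ a) → σ w ≤ a

/-- Between the slots `a` and `u` only jobs of the cover and jobs with a successor in `β` are
executed. -/
def Tight (G : Ctx N) (σ : Fin N → ℕ) (β : Finset (Fin N)) (a u : ℕ) : Prop :=
  ∀ v ∉ G.C, a < σ v → σ v < u → v ∈ G.preceding β

theorem mem_before {σ : Fin N → ℕ} {t : ℕ} {v : Fin N} :
    v ∈ G.before σ t ↔ v ∈ G.C ∧ σ v < t := by simp [before]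

theorem before_mono {σ : Fin N → ℕ} {s t : ℕ} (h : s ≤ t) : G.before σ s ⊆ G.before σ t := by
  intro v
  simp only [mem_before]
  exact fun h' => ⟨h'.1, by omega⟩

theorem before_subset {σ : Fin N → ℕ} {s : ℕ} : G.before σ s ⊆ G.C := filter_subset _ _

theorem Separates.anti {σ : Fin N → ℕ} {β γ : Finset (Fin N)} {a : ℕ} (h : G.Separates σ β a)
    (hγ : γ ⊆ β) : G.Separates σ γ a := fun w hw hp hb => h w hw (preceding_mono hγ hp) hb

theorem Tight.mono {σ : Fin N → ℕ} {β : Finset (Fin N)} {a a' u u' : ℕ} (h : G.Tight σ β a u)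
    (ha : a ≤ a') (hu : u' ≤ u) : G.Tight σ β a' u' :=
  fun v hv h₁ h₂ => h v hv (by omega) (by omega)

/-! ### Counting the jobs of a valid piece -/

theorem Valid.card_jobs {A' : Finset (Fin N)} {p : Piece N} (h : G.Valid A' p) :
    (jobs p).card = (p.map card).sum := by
  induction p with
  | nil => rfl
  | cons z zs ih =>
    obtain ⟨h₁, -, -, h₄, h₅⟩ := h
    rw [jobs_cons, card_union_of_disjoint, ih h₁, List.map_cons, List.sum_cons]
    rw [disjoint_left]
    intro y hy hy'
    by_cases hC : y ∈ G.C
    · exact h₄ y hy hC (by simp [after, hy', hC])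
    · exact (h₅ y hy hC).1 hy'

theorem Valid.card_le {A' : Finset (Fin N)} {p : Piece N} (h : G.Valid A' p) :
    (jobs p).card ≤ G.m * p.length := by
  rw [h.card_jobs]
  induction p with
  | nil => simp
  | cons z zs ih =>
    have := ih h.1
    have := h.2.1
    simp only [List.map_cons, List.sum_cons, List.length_cons, mul_add]
    omega

/-- No slot exceeds `m`, so a total of `m` per slot leaves no slot below `m`. -/
theorem Valid.allFull {A' : Finset (Fin N)} {p : Piece N} (h : G.Valid A' p)
    (hp : G.m * p.length ≤ (jobs p).card) : G.AllFull p := by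
  induction p with
  | nil => simp [AllFull]
  | cons z zs ih =>
    have h₁ := h.1.card_le
    have h₂ := h.2.1
    have h₃ := h.card_jobs
    have h₄ := h.1.card_jobs
    simp only [List.map_cons, List.sum_cons, List.length_cons, mul_add] at hp h₃
    intro w hw
    rcases List.mem_cons.1 hw with rfl | hw
    · omega
    · exact ih h.1 (by omega) w hw

theorem AllFull.le_card_jobs {A' : Finset (Fin N)} {p : Piece N} (hp : G.AllFull p)
    (h : G.Valid A' p) : G.m * p.length ≤ (jobs p).card := by
  rw [h.card_jobs]
  induction p with
  | nil => simp
  | cons z zs ih =>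
    have := ih (fun w hw => hp w (by simp [hw])) h.1
    have := hp z (by simp)
    simp only [List.map_cons, List.sum_cons, List.length_cons, mul_add]
    omega

/-- The cover jobs are `U' \ A'` in every good piece for the chain; only the number of other jobs
can vary. -/
theorem Good.card_jobs {A A' U U' c B z : Finset (Fin N)} {zs : Piece N}
    (h : G.Good A A' U U' c B z zs) :
    (jobs (z :: zs)).card = (U' \ A').card + (jobs (z :: zs) \ G.C).card := by
  have : jobs (z :: zs) ∩ G.C = U' \ A' := by
    rw [← h.after_eq]
    ext v
    have := fun h₁ h₂ => h.valid.not_mem_of_mem (v := v) h₁ h₂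
    simp only [after, mem_inter, mem_sdiff, mem_union]
    tauto
  rw [← this, add_comm, card_sdiff_add_card_inter]

section

variable {A A' U U' c B z : Finset (Fin N)} {zs : Piece N}

theorem Good.jobs_sdiff_subset (h : G.Good A A' U U' c B z zs) :
    jobs (z :: zs) \ G.C ⊆ G.forced A U B := by
  intro v hv
  obtain ⟨h₁, h₂⟩ := mem_sdiff.1 hv
  exact h.ge v h₁ h₂

/-- If there is room for all candidates, no greedy choice can have excluded one: when the last slot
is full, all slots are, and then the piece has as many jobs as there are candidates. This is why one
stored piece per chain suffices. -/
theorem Good.forced_subset_of_card_le (h : G.Good A A' U U' c B z zs) (hfull : G.AllFull zs)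
    (hor : G.m ≤ z.card ∨ G.forced A U B ⊆ jobs (z :: zs))
    (hle : (U' \ A').card + (G.forced A U B).card ≤ G.m * (zs.length + 1)) :
    G.forced A U B ⊆ jobs (z :: zs) := by
  refine hor.elim (fun hz => ?_) id
  have h₁ : G.AllFull (z :: zs) := by
    intro w hw
    rcases List.mem_cons.1 hw with rfl | hw
    · exact hz
    · exact hfull w hw
  have h₂ := h₁.le_card_jobs h.valid
  have h₃ := h.card_jobs
  rw [List.length_cons] at h₂
  rw [← eq_of_subset_of_card_le h.jobs_sdiff_subset (by omega)]
  exact sdiff_subset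

/-- The opposite regime: a piece that contains all candidates, of which there are at least as many
as places, has no idle place. -/
theorem Good.allFull_of_le_card (h : G.Good A A' U U' c B z zs) (hfull : G.AllFull zs)
    (hor : G.m ≤ z.card ∨ G.forced A U B ⊆ jobs (z :: zs))
    (hle : G.m * (zs.length + 1) ≤ (U' \ A').card + (G.forced A U B).card) :
    G.AllFull (z :: zs) := by
  rcases hor with hz | hsub
  · intro w hw
    rcases List.mem_cons.1 hw with rfl | hw
    · exact hz
    · exact hfull w hw
  · refine h.valid.allFull ?_
    have h₃ := h.card_jobs
    have : (G.forced A U B).card ≤ (jobs (z :: zs) \ G.C).card := card_le_card fun v hv =>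
      mem_sdiff.2 ⟨hsub hv, (mem_forced.1 hv).2.2.2⟩
    rw [List.length_cons]
    omega

end

theorem get_eq {τ : Tab N} {A A' U U' c B : Finset (Fin N)}
    (h₁ : A ⊆ A') (h₂ : A' ⊆ U) (h₃ : U ⊆ U') (h₄ : U' ⊆ c) (h₅ : c ⊆ B) :
    get τ A A' U U' c B = τ A A' U U' c B := by
  simp [get, h₁, h₂, h₃, h₄, h₅]

theorem tables_drop (L i : ℕ) : (G.tables L).drop i = G.tables (L - i) := by
  induction L generalizing i with
  | zero => simp [tables]
  | succ L ih =>
    cases i with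
    | zero => simp
    | succ i => rw [tables, List.drop_succ_cons, ih, Nat.add_sub_add_right]

theorem tables_getElem (L i : ℕ) (h : i < (G.tables L).length) :
    (G.tables L)[i] = G.entry (G.tables (L - 1 - i)) := by
  induction L generalizing i with
  | zero => simp [tables] at h
  | succ L ih =>
    cases i with
    | zero => simp [tables]
    | succ i =>
      simp only [tables, List.getElem_cons_succ]
      rw [ih]
      congr 2
      omega

theorem split_ne_nil {A A' U U' c B V V' : Finset (Fin N)} {rev fwd : List (Tab N)} (i : ℕ)
    (hi : i < rev.length) (hV : V ∈ G.subs) (hV' : V' ∈ G.subs)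
    (h : G.glue rev[i] (fwd.drop i) A A' U U' c B V V' ≠ []) :
    G.split rev fwd A A' U U' c B ≠ [] := by
  induction rev generalizing fwd i with
  | nil => simp at hi
  | cons τ rev ih =>
    rw [split]
    by_cases hr : firstNonempty
        (fun V => firstNonempty (fun V' => G.glue τ fwd A A' U U' c B V V') G.subs) G.subs = []
    · rw [if_neg (by simpa using hr)]
      cases i with
      | zero =>
        refine absurd hr (firstNonempty_ne_nil hV (firstNonempty_ne_nil hV' ?_))
        simpa using h
      | succ i => exact ih i (by simpa using hi) (by simpa using h)
    · rwa [if_pos hr]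

section

variable {bot top : Fin N} {T : ℕ} {σ : Fin N → ℕ}

/-! ### Counting the jobs of a full schedule between two slots -/

namespace FullSchedule

theorem not_mem_blocked (h : G.FullSchedule bot top T σ) {w : Fin N} {a : ℕ} (hw : σ w ≤ a) :
    w ∉ G.blocked (G.before σ a) := by
  rw [mem_blocked]
  rintro ⟨i, hi, hi', hR⟩
  have := h.order i w hR
  exact hi' (mem_before.2 ⟨hi, by omega⟩)

theorem lt_of_mem_preceding (h : G.FullSchedule bot top T σ) {w : Fin N} {u : ℕ}
    (hw : w ∈ G.preceding (G.before σ (u + 1))) : σ w < u := by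
  obtain ⟨j, hj, hR⟩ := mem_preceding.1 hw
  have := h.order w j hR
  have := (mem_before.1 hj).2
  omega

/-- A job with a successor in slot `u` or earlier runs before slot `u`, whatever is blocked. -/
theorem separates_self (h : G.FullSchedule bot top T σ) {u t : ℕ} (ht : u ≤ t + 1) :
    G.Separates σ (G.before σ (u + 1)) t := fun w _ hp _ => by
  have := h.lt_of_mem_preceding hp
  omega

theorem card_slots (h : G.FullSchedule bot top T σ) {a s : ℕ} (has : a ≤ s) (hs : s ≤ T) :
    (univ.filter fun v => a < σ v ∧ σ v ≤ s).card = G.m * (s - a) := by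
  induction s, has using Nat.le_induction with
  | base =>
    rw [Nat.sub_self, mul_zero, card_eq_zero]
    ext v
    simp
  | succ s has ih =>
    have : (univ.filter fun v => a < σ v ∧ σ v ≤ s + 1) =
        (univ.filter fun v => a < σ v ∧ σ v ≤ s) ∪ univ.filter fun v => σ v = s + 1 := by
      ext v
      simp only [mem_filter, mem_univ, true_and, mem_union]
      omega
    rw [this, card_union_of_disjoint, ih (by omega), h.full (s + 1) (by omega) hs,
      Nat.sub_add_comm has, mul_add, mul_one]
    rw [disjoint_left]
    intro v
    simp only [mem_filter, mem_univ, true_and]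
    omega

theorem card_split (h : G.FullSchedule bot top T σ) {a s : ℕ} (has : a ≤ s) (hs : s ≤ T) :
    (G.before σ (s + 1) \ G.before σ (a + 1)).card +
      ((univ.filter fun v => a < σ v ∧ σ v ≤ s) \ G.C).card = G.m * (s - a) := by
  rw [← h.card_slots has hs, ← card_inter_add_card_sdiff (univ.filter fun v => a < σ v ∧ σ v ≤ s) G.C]
  congr 2
  ext v
  simp only [mem_sdiff, mem_before, mem_inter, mem_filter, mem_univ, true_and]
  constructor
  · rintro ⟨⟨h₁, h₂⟩, h₃⟩
    have : ¬ σ v < a + 1 := fun h => h₃ ⟨h₁, h⟩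
    exact ⟨by omega, h₁⟩
  · rintro ⟨⟨h₁, h₂⟩, h₃⟩
    exact ⟨⟨h₃, by omega⟩, fun h => by omega⟩

/-- All forced jobs run in the slots `a + 1, …, s` of `σ`: a job blocked at `a` runs after `a`, and
separation at `s` completes those unblocked at `s`. -/
theorem card_le (h : G.FullSchedule bot top T σ) {a s : ℕ} (has : a ≤ s) (hs : s ≤ T)
    {β : Finset (Fin N)} (hβ : G.Separates σ β s) :
    (G.before σ (s + 1) \ G.before σ (a + 1)).card +
      (G.forced (G.before σ a) (G.before σ s) β).card ≤ G.m * (s - a) := by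
  rw [← h.card_split has hs]
  gcongr
  intro v hv
  obtain ⟨h₁, h₂, h₃, h₄⟩ := mem_forced.1 hv
  simp only [mem_sdiff, mem_filter, mem_univ, true_and]
  refine ⟨⟨?_, hβ v h₄ h₂ h₃⟩, h₄⟩
  by_contra hlt
  exact h.not_mem_blocked (by omega) h₁

/-- By tightness and separation at `a`, whatever `σ` runs outside the cover in the slots `a + 1, …,
s` is forced; and these slots are full. -/
theorem le_card (h : G.FullSchedule bot top T σ) {a s : ℕ} (has : a ≤ s) (hs : s ≤ T)
    {β : Finset (Fin N)} (hβ : G.Separates σ β a) (ht : G.Tight σ β a (s + 1)) :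
    G.m * (s - a) ≤ (G.before σ (s + 1) \ G.before σ (a + 1)).card +
      (G.forced (G.before σ a) (G.before σ s) β).card := by
  rw [← h.card_split has hs]
  gcongr
  intro v hv
  simp only [mem_sdiff, mem_filter, mem_univ, true_and] at hv
  obtain ⟨⟨h₁, h₂⟩, h₃⟩ := hv
  have hp := ht v h₃ h₁ (by omega)
  refine mem_forced.2 ⟨?_, hp, h.not_mem_blocked h₂, h₃⟩
  by_contra hb
  have := hβ v h₃ hp hb
  omega

theorem slotOK (h : G.FullSchedule bot top T σ) (hm : 0 < G.m) {s : ℕ} (hs : 1 ≤ s)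
    (hs' : s ≤ T + 1) : G.SlotOK (G.before σ s) (G.before σ (s + 1)) := by
  have key : G.before σ (s + 1) \ G.before σ s ⊆ univ.filter fun v => σ v = s := by
    intro v hv
    simp only [mem_sdiff, mem_before, mem_filter, mem_univ, true_and] at *
    have : ¬ σ v < s := fun h => hv.2 ⟨hv.1.1, h⟩
    omega
  refine ⟨?_, (card_le_card key).trans ?_⟩
  · ext v
    simp only [mem_inter, notMem_empty, iff_false, not_and]
    intro hv
    exact h.not_mem_blocked (by simpa using (mem_filter.1 (key hv)).2.le)
  -- Slot `T + 1` is not full; it holds `top` alone, so one machine is enough.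
  · rcases hs'.eq_or_lt with rfl | hs'
    · rw [show (univ.filter fun v => σ v = T + 1) = {top} by ext v; simp [h.last_iff],
        card_singleton]
      exact hm
    · exact (h.full s hs (by omega)).le

end FullSchedule

/-- The table for `L + 1` slots has the pieces that occur in the schedule `σ`. -/
def Complete (G : Ctx N) (T : ℕ) (σ : Fin N → ℕ) (L : ℕ) : Prop :=
  -- The piece occupies the slots `a + 1, …, s`; `c` and `b` are the last slots of the two deadline
  -- levels. The conditions say that `a` and `c` are cuts for level `b`, with only jobs of this
  -- level between them, and that `s` is a cut for level `c`.
  ∀ a c b s, a < s → s ≤ c → c ≤ T → c ≤ b → s = a + L + 1 →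
    G.Separates σ (G.before σ (b + 1)) a → G.Separates σ (G.before σ (b + 1)) c →
    G.Tight σ (G.before σ (b + 1)) a c → G.Separates σ (G.before σ (c + 1)) s →
    G.entry (G.tables L) (G.before σ a) (G.before σ (a + 1)) (G.before σ s) (G.before σ (s + 1))
      (G.before σ (c + 1)) (G.before σ (b + 1)) ≠ []

/-- Jobs with a successor in slot `s` or earlier run by slot `s - 1`. So they are unblocked there,
which gives `Clear` for the witness `W = before (s - 1)`, and by counting the stored shorter piece
contains all of them. Tightness makes these jobs and the cover jobs fill the `k` slots before `s`.
-/
theorem closeAt_ne_nil (h : G.FullSchedule bot top T σ) (hm : 0 < G.m)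
    (hsub : ∀ X ⊆ G.C, X ∈ G.subs) {v s k : ℕ} (hk : s = v + k + 1) (hs : s ≤ T + 1)
    (ih : ∀ L < k, G.Complete T σ L) (hsep : G.Separates σ (G.before σ (s + 1)) v)
    (ht : G.Tight σ (G.before σ (s + 1)) v s) :
    G.closeAt (G.tables k) (G.before σ v) (G.before σ (v + 1)) (G.before σ s)
      (G.before σ (s + 1)) ≠ [] ∧
    G.AllFull (G.closeAt (G.tables k) (G.before σ v) (G.before σ (v + 1)) (G.before σ s)
      (G.before σ (s + 1))).tail := by
  have hclear : ∀ t, t + 1 ≤ s → G.Separates σ (G.before σ (s + 1)) t → s ≤ t + 1 →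
      G.Clear (G.before σ t) (G.before σ (s + 1)) := by
    intro t h₁ _ h₂
    rw [clear_iff]
    intro w hb hp
    by_contra hC
    exact h.not_mem_blocked (by have := h.lt_of_mem_preceding hp; omega) hb
  have hne : G.closeAt (G.tables k) (G.before σ v) (G.before σ (v + 1)) (G.before σ s)
      (G.before σ (s + 1)) ≠ [] := by
    unfold closeAt
    rw [if_pos (h.slotOK hm (by omega) hs)]
    cases k with
    | zero =>
      obtain rfl : s = v + 1 := hk
      simp only [tables]
      rw [if_pos ⟨subset_rfl, subset_rfl, hclear v le_rfl hsep le_rfl⟩]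
      simp
    | succ k =>
      simp only [tables]
      refine firstNonempty_ne_nil (a := G.before σ (s - 1)) (hsub _ before_subset) ?_
      have hs1 : s - 1 + 1 = s := by omega
      -- The shorter piece ends in slot `s - 1`, which is also its inner level; its outer level is
      -- `s`.
      have hC := ih k (by omega) v (s - 1) s (s - 1) (by omega) le_rfl (by omega) (by omega)
        (by omega) hsep (h.separates_self (by omega)) (ht.mono le_rfl (by omega))
        (h.separates_self (by omega))
      rw [hs1] at hC
      unfold closeAfter
      simp only
      rw [get_eq (before_mono (by omega)) (before_mono (by omega)) (before_mono (by omega))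
        subset_rfl (before_mono (by omega)), if_pos]
      · simp
      refine ⟨hC, ?_, hclear (s - 1) (by omega) (h.separates_self (by omega)) (by omega)⟩
      obtain ⟨z, zs, e⟩ := List.exists_cons_of_ne_nil hC
      obtain ⟨g, hl, hf, hor⟩ := tableOK_entry (tablesOK_tables k) (before_mono (by omega))
        (before_mono (by omega)) subset_rfl (before_mono (by omega)) before_subset e
      rw [e]
      refine g.forced_subset_of_card_le hf hor ?_
      have := h.card_le (a := v) (s := s - 1) (by omega) (by omega)
        (h.separates_self (u := s) (t := s - 1) (by omega))
      rw [hs1] at this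
      rwa [hl, length_tables, show k + 1 = s - 1 - v by omega]
  refine ⟨hne, ?_⟩
  obtain ⟨z, zs, e⟩ := List.exists_cons_of_ne_nil hne
  obtain ⟨g, hl, hz, -⟩ := good_closeAt (tablesOK_tables k) (before_mono (by omega))
    (before_mono (by omega)) before_subset e
  rw [e, List.tail_cons]
  refine g.valid.1.allFull ?_
  rw [hl, length_tables]
  have h₁ := h.le_card (a := v) (s := s - 1) (by omega) (by omega) hsep
    (by rwa [show s - 1 + 1 = s by omega])
  rw [show s - 1 + 1 = s by omega, show s - 1 - v = k by omega] at h₁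
  refine h₁.trans ?_
  -- The counted cover jobs and forced jobs are disjoint, and all of them lie in the tail.
  rw [← card_union_of_disjoint]
  · refine card_le_card fun w hw => ?_
    rcases mem_union.1 hw with hw | hw
    · obtain ⟨h₁, h₂⟩ := mem_sdiff.1 hw
      rw [← g.before_eq, after, mem_union] at h₁
      exact (mem_inter.1 (h₁.resolve_left h₂)).1
    · obtain ⟨h₁, h₂, h₃, h₄⟩ := mem_forced.1 hw
      have hw' : w ∈ G.forced (G.before σ v) (G.before σ s) (G.before σ (s + 1)) :=
        mem_forced.2 ⟨h₁, h₂, h.not_mem_blocked (h.lt_of_mem_preceding h₂).le, h₄⟩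
      have := g.le hw'
      rw [jobs_cons, mem_union, hz, mem_sdiff] at this
      exact this.resolve_left fun h => h₄ (before_subset h.1)
  · rw [disjoint_left]
    intro w hw hw'
    exact (mem_forced.1 hw').2.2.2 (before_subset (mem_sdiff.1 hw).1)

/-- For `c` beyond slot `s`, separation at `s` leaves room for all forced jobs of level `c`, so the
stored piece passes the test. -/
theorem segment_ne_nil (h : G.FullSchedule bot top T σ) (hm : 0 < G.m)
    (hsub : ∀ X ⊆ G.C, X ∈ G.subs) {v s c k : ℕ} (hk : s = v + k + 1) (hs : s ≤ c) (hc : c ≤ T)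
    (ih : ∀ L ≤ k, G.Complete T σ L) (hv : G.Separates σ (G.before σ (c + 1)) v)
    (hs' : G.Separates σ (G.before σ (c + 1)) s) (ht : G.Tight σ (G.before σ (c + 1)) v s) :
    G.segment (G.tables (k + 1)) (G.before σ v) (G.before σ (v + 1)) (G.before σ s)
      (G.before σ (s + 1)) (G.before σ (c + 1)) ≠ [] ∧
    G.AllFull (G.segment (G.tables (k + 1)) (G.before σ v) (G.before σ (v + 1)) (G.before σ s)
      (G.before σ (s + 1)) (G.before σ (c + 1))).tail := by
  rw [tables, segment]
  by_cases hcs : G.before σ (c + 1) ⊆ G.before σ (s + 1)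
  · rw [if_pos hcs]
    have e : G.before σ (c + 1) = G.before σ (s + 1) := hcs.antisymm (before_mono (by omega))
    rw [e] at hv ht
    exact closeAt_ne_nil h hm hsub hk (by omega) (fun L hL => ih L hL.le) hv ht
  · rw [if_neg hcs]
    simp only
    have hC := ih k le_rfl v s c s (by omega) le_rfl (by omega) hs hk hv hs' ht
      (h.separates_self (by omega))
    obtain ⟨z, zs, e⟩ := List.exists_cons_of_ne_nil hC
    obtain ⟨g, hl, hf, hor⟩ := tableOK_entry (tablesOK_tables k) (before_mono (by omega))
        (before_mono (by omega)) subset_rfl (before_mono (by omega)) before_subset e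
    rw [get_eq (before_mono (by omega)) (before_mono (by omega)) (before_mono (by omega))
        subset_rfl (before_mono (by omega)), e, if_pos]
    · exact ⟨by simp, hf⟩
    refine g.forced_subset_of_card_le hf hor ?_
    have := h.card_le (a := v) (s := s) (by omega) (by omega) hs'
    rwa [hl, length_tables, show k + 1 = s - v by omega]

/-- An available job with an earlier deadline would have been run in the place of `v`. Hence the
slot of a job with a late deadline is a cut. -/
theorem separates_of_loose (he : G.EarliestFirst σ) {v : Fin N} (hv : v ∉ G.C) {b : ℕ}
    (hp : v ∉ G.preceding (G.before σ b)) : G.Separates σ (G.before σ b) (σ v) := by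
  intro w hw hpw hb
  by_contra hlt
  exact hp (he v w hv hw (by omega) hb b hpw)

/-- If the base is unusable, some job strictly between `a` and `s` has no successor at level `c`.
The slot `v` of the last such job is a cut, and after it the schedule is tight for level `c`. So
`split` succeeds at `v`: the first part is full by counting at level `b`, the second is a segment of
level `c`. -/
theorem extend_ne_nil (h : G.FullSchedule bot top T σ)
    (he : G.EarliestFirst σ) (hm : 0 < G.m)
    (hsub : ∀ X ⊆ G.C, X ∈ G.subs) {a s c b L : ℕ} (hs : s ≤ c) (hc : c ≤ T) (hcb : c ≤ b)
    (hL : s = a + L + 1) (ih : ∀ k < L, G.Complete T σ k)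
    (ha : G.Separates σ (G.before σ (b + 1)) a) (hcc : G.Separates σ (G.before σ (b + 1)) c)
    (ht : G.Tight σ (G.before σ (b + 1)) a c) (hss : G.Separates σ (G.before σ (c + 1)) s)
    {base : Piece N} (hbase : G.Tight σ (G.before σ (c + 1)) a s →
      base ≠ [] ∧ G.AllFull base.tail) :
    G.extend (G.tables L) base (G.before σ a) (G.before σ (a + 1)) (G.before σ s)
      (G.before σ (s + 1)) (G.before σ (c + 1)) (G.before σ (b + 1)) ≠ [] := by
  have hfill : ∀ {A U B} {p : Piece N}, p ≠ [] → G.fill A U B p ≠ [] := by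
    intro A U B p hp
    obtain ⟨z, zs, rfl⟩ := List.exists_cons_of_ne_nil hp
    simp [fill]
  refine hfill ?_
  split_ifs with hb
  · exact hb.1
  have hloose : ¬ G.Tight σ (G.before σ (c + 1)) a s := fun h => hb (hbase h)
  simp only [Tight, not_forall] at hloose
  obtain ⟨x, hxC, hx₁, hx₂, hxp⟩ := hloose
  obtain ⟨x, hx, hmax⟩ := exists_max_image (univ.filter fun x => x ∉ G.C ∧ a < σ x ∧ σ x < s ∧
    x ∉ G.preceding (G.before σ (c + 1))) σ ⟨x, by simp [hxC, hx₁, hx₂, hxp]⟩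
  simp only [mem_filter, mem_univ, true_and] at hx hmax
  obtain ⟨hxC, hx₁, hx₂, hxp⟩ := hx
  have hxs : G.Separates σ (G.before σ (c + 1)) (σ x) := separates_of_loose he hxC hxp
  have hxt : G.Tight σ (G.before σ (c + 1)) (σ x) s := by
    intro y hy h₁ h₂
    by_contra hyp
    have := hmax y ⟨hy, by omega, h₂, hyp⟩
    omega
  generalize hv : σ x = v at *
  -- The first part has `i + 1` slots and the segment `k + 1`, which is position `i` of `split`.
  obtain ⟨i, rfl⟩ : ∃ i, v = a + i + 1 := ⟨v - a - 1, by omega⟩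
  obtain ⟨k, hk⟩ : ∃ k, s = a + i + 1 + k + 1 := ⟨s - (a + i + 1) - 1, by omega⟩
  refine split_ne_nil i (by rw [List.length_reverse, length_tables]; omega)
    (hsub _ (before_subset (σ := σ) (s := a + i + 1)))
    (hsub _ (before_subset (σ := σ) (s := a + i + 1 + 1))) ?_
  rw [List.getElem_reverse, tables_getElem, tables_drop, length_tables,
    show L - 1 - (L - 1 - i) = i by omega, show L - i = k + 1 by omega]
  unfold glue
  simp only
  have hp₁ := ih i (by omega) a c b (a + i + 1) (by omega) (by omega) hc hcb rfl ha hcc ht hxs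
  have hp₂ := segment_ne_nil h hm hsub hk hs hc (fun L hL => ih L (by omega)) hxs hss hxt
  obtain ⟨z, zs, e⟩ := List.exists_cons_of_ne_nil hp₁
  obtain ⟨g, hl, hf, hor⟩ := tableOK_entry (tablesOK_tables i) (before_mono (by omega))
    (before_mono (by omega)) (before_mono (by omega)) (before_mono (by omega)) before_subset e
  rw [get_eq (before_mono (by omega)) (before_mono (by omega)) (before_mono (by omega))
    (before_mono (by omega)) (before_mono (by omega)), if_pos]
  · simp [hp₁]
  refine ⟨hp₁, ?_, hp₂⟩
  rw [e]
  refine g.allFull_of_le_card hf hor ?_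
  have := h.le_card (a := a) (s := a + i + 1) (by omega) (by omega) ha
    (ht.mono le_rfl (by omega))
  rwa [hl, length_tables, show i + 1 = a + i + 1 - a by omega]

/-- Induction on the length. For `c` beyond `s` the inner extension plays the role of the base:
separation at `s` leaves room for all forced jobs of level `c`, so it contains them. -/
theorem complete (h : G.FullSchedule bot top T σ)
    (he : G.EarliestFirst σ) (hm : 0 < G.m) (hsub : ∀ X ⊆ G.C, X ∈ G.subs) (L : ℕ) :
    G.Complete T σ L := by
  induction L using Nat.strong_induction_on with
  | _ L ih =>
  intro a c b s has hsc hc hcb hL ha hcc ht hss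
  simp only [entry]
  have hac : G.Separates σ (G.before σ (c + 1)) a := ha.anti (before_mono (by omega))
  by_cases hcs : G.before σ (c + 1) ⊆ G.before σ (s + 1)
  · rw [if_pos hcs]
    have e : G.before σ (c + 1) = G.before σ (s + 1) := hcs.antisymm (before_mono (by omega))
    refine extend_ne_nil h he hm hsub hsc hc hcb hL ih ha hcc ht hss fun htc => ?_
    rw [e] at htc hac
    exact closeAt_ne_nil h hm hsub hL (by omega) ih hac htc
  · rw [if_neg hcs]
    refine extend_ne_nil h he hm hsub hsc hc hcb hL ih ha hcc ht hss fun htc => ?_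
    have hne := extend_ne_nil (base := G.closeAt (G.tables L) (G.before σ a) (G.before σ (a + 1))
      (G.before σ s) (G.before σ (s + 1))) h he hm hsub (le_refl s) (hsc.trans hc) hsc hL ih hac
      hss htc (h.separates_self (by omega)) fun hts =>
        closeAt_ne_nil h hm hsub hL (by omega) ih (hac.anti (before_mono (by omega))) hts
    obtain ⟨z, zs, e⟩ := List.exists_cons_of_ne_nil hne
    have e' : G.entry (G.tables L) (G.before σ a) (G.before σ (a + 1)) (G.before σ s)
        (G.before σ (s + 1)) (G.before σ (s + 1)) (G.before σ (c + 1)) = z :: zs := by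
      simp only [entry]
      rw [if_pos subset_rfl]
      exact e
    obtain ⟨g, hl, hf, hor⟩ := tableOK_entry (tablesOK_tables L) (before_mono (by omega))
      (before_mono (by omega)) subset_rfl (before_mono (by omega)) before_subset e'
    have hle := h.card_le (a := a) (s := s) (by omega) (by omega) hss
    rw [e, if_pos]
    · exact ⟨by simp, hf⟩
    refine g.forced_subset_of_card_le hf hor ?_
    rwa [hl, length_tables, show L + 1 = s - a by omega]

/-- The boundary slots are cuts for trivial reasons: at slot `0` everything outside the cover is
blocked by `bot`, and everything outside the cover has `top` as a successor. -/
theorem answer_ne_nil_of_earliestFirst (hG : G.Bounded bot top) (h : G.FullSchedule bot top T σ)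
    (he : G.EarliestFirst σ) (hm : 0 < G.m) (hsub : ∀ X ⊆ G.C, X ∈ G.subs) :
    G.answer T bot top ≠ [] := by
  have h0 : G.before σ 0 = ∅ := by ext v; simp [before]
  have h1 : G.before σ 1 = {bot} := by
    ext v
    rw [mem_before, Nat.lt_one_iff, h.zero_iff, mem_singleton]
    exact ⟨fun h => h.2, fun h => ⟨h ▸ hG.bot_mem, h⟩⟩
  have h2 : G.before σ (T + 1) = G.C \ {top} := by
    ext v
    rw [mem_before, mem_sdiff, mem_singleton, ← h.last_iff]
    have := h.le v
    exact and_congr_right fun _ => by omega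
  have h3 : G.before σ (T + 1 + 1) = G.C := by
    ext v
    rw [mem_before]
    have := h.le v
    exact ⟨fun h => h.1, fun h => ⟨h, by omega⟩⟩
  have hpre : ∀ v ∉ G.C, v ∈ G.preceding (G.before σ (T + 1 + 1)) := fun v hv =>
    mem_preceding.2 ⟨top, h3 ▸ hG.top_mem, hG.R_top v fun h => hv (h ▸ hG.top_mem)⟩
  have := (closeAt_ne_nil (v := 0) (s := T + 1) (k := T) h hm hsub (by omega) le_rfl
    (fun L _ => complete h he hm hsub L) (fun w hw _ hb => ?_) fun v hv _ _ => hpre v hv).1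
  · rwa [h0, zero_add, h1, h2, h3] at this
  · rw [h0] at hb
    exact absurd (mem_blocked.2 ⟨bot, hG.bot_mem, by simp, hG.bot_R w fun h =>
      hw (h ▸ hG.bot_mem)⟩) hb

/-- Among the schedules with a given schedule of the cover there is one with the earliest deadline
first. -/
theorem exists_earliestFirst (hG : G.Bounded bot top) (h : G.FullSchedule bot top T σ) :
    ∃ σ', G.FullSchedule bot top T σ' ∧ G.EarliestFirst σ' := by
  classical
  -- `e v` is larger for earlier deadlines, so minimizing `∑ σ' v * e v` enforces the rule. The
  -- bound `T + 3` is enough because `before` is constant from `T + 2` on.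
  set e : Fin N → ℕ := fun v =>
    ((range (T + 3)).filter fun b => v ∈ G.preceding (G.before σ b)).card with he
  have hex : ∃ x, ∃ σ', G.FullSchedule bot top T σ' ∧ (∀ v ∈ G.C, σ' v = σ v) ∧
      ∑ v, σ' v * e v = x := ⟨_, σ, h, fun _ _ => rfl, rfl⟩
  obtain ⟨σ', h', hC, hx⟩ := Nat.find_spec hex
  have hmin := fun y (hy : y < Nat.find hex) => Nat.find_min hex hy
  rw [← hx] at hmin
  have hbef : ∀ b, G.before σ' b = G.before σ b := by
    intro b
    ext v
    rw [mem_before, mem_before]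
    exact and_congr_right fun hv => by rw [hC v hv]
  refine ⟨σ', h', fun v w hv hw hlt hb b hwb => ?_⟩
  by_contra hvb
  -- Exchanging the slots keeps the constraints: `w` is unblocked in the slot of `v`, and `w` runs
  -- before time `b` while the successors of `v` do not.
  set τ : Fin N → ℕ := σ' ∘ Equiv.swap v w with hτ
  have hvw : v ≠ w := by rintro rfl; omega
  have hτv : τ v = σ' w := by simp [hτ]
  have hτw : τ w = σ' v := by simp [hτ]
  have hτo : ∀ x, x ≠ v → x ≠ w → τ x = σ' x := fun x h₁ h₂ => by
    simp [hτ, Equiv.swap_apply_of_ne_of_ne h₁ h₂]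
  have hτC : ∀ x ∈ G.C, τ x = σ' x := fun x hx =>
    hτo x (fun h => hv (h ▸ hx)) fun h => hw (h ▸ hx)
  have hne : ∀ x ∉ G.C, σ' x ≠ 0 ∧ σ' x ≠ T + 1 := fun x hx =>
    ⟨fun h => hx ((h'.zero_iff x).1 h ▸ hG.bot_mem), fun h => hx ((h'.last_iff x).1 h ▸ hG.top_mem)⟩
  have hbot : bot ≠ v ∧ bot ≠ w := ⟨fun h => hv (h ▸ hG.bot_mem), fun h => hw (h ▸ hG.bot_mem)⟩
  have htop : top ≠ v ∧ top ≠ w := ⟨fun h => hv (h ▸ hG.top_mem), fun h => hw (h ▸ hG.top_mem)⟩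
  have hbb : ∃ b < T + 3, w ∈ G.preceding (G.before σ' b) ∧ v ∉ G.preceding (G.before σ' b) := by
    by_cases hbT : b < T + 3
    · exact ⟨b, hbT, hwb, hvb⟩
    · have : G.before σ' b = G.before σ' (T + 2) := by
        ext x
        rw [mem_before, mem_before]
        have := h'.le x
        exact and_congr_right fun _ => by omega
      exact ⟨T + 2, by omega, this ▸ hwb, this ▸ hvb⟩
  have hfull : G.FullSchedule bot top T τ := by
    refine ⟨?_, ?_, ?_, ?_, ?_⟩
    · intro i j hR
      have hij := h'.order i j hR
      rcases eq_or_ne i v with rfl | hiv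
      · have hjC : j ∈ G.C := (hG.cover _ _ hR).resolve_left hv
        rw [hτv, hτC j hjC]
        by_contra hcon
        have hlt' := h'.order
        obtain ⟨j', hj', hR'⟩ := mem_preceding.1 hwb
        have h₁ := h'.order w j' hR'
        have h₂ := (mem_before.1 hj').2
        exact hvb (mem_preceding.2 ⟨j, mem_before.2 ⟨hjC, by omega⟩, hR⟩)
      rcases eq_or_ne i w with rfl | hiw
      · have hjC : j ∈ G.C := (hG.cover _ _ hR).resolve_left hw
        rw [hτw, hτC j hjC]
        omega
      rw [hτo i hiv hiw]
      rcases eq_or_ne j v with rfl | hjv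
      · rw [hτv]; omega
      rcases eq_or_ne j w with rfl | hjw
      · have hiC : i ∈ G.C := (hG.cover _ _ hR).resolve_right hw
        rw [hτw]
        by_contra hcon
        exact hb (mem_blocked.2 ⟨i, hiC, fun h => hcon (mem_before.1 h).2, hR⟩)
      rw [hτo j hjv hjw]
      exact hij
    · intro x
      rcases eq_or_ne x v with rfl | hxv
      · rw [hτv]; simp [(hne w hw).1, hbot.1.symm]
      rcases eq_or_ne x w with rfl | hxw
      · rw [hτw]; simp [(hne v hv).1, hbot.2.symm]
      rw [hτo x hxv hxw, h'.zero_iff]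
    · intro x
      rcases eq_or_ne x v with rfl | hxv
      · rw [hτv]; simp [(hne w hw).2, htop.1.symm]
      rcases eq_or_ne x w with rfl | hxw
      · rw [hτw]; simp [(hne v hv).2, htop.2.symm]
      rw [hτo x hxv hxw, h'.last_iff]
    · intro x; exact h'.le _
    · intro t h₁ h₂
      rw [← h'.full t h₁ h₂]
      refine card_bij (fun x _ => Equiv.swap v w x) (by simp [hτ]) (by simp) fun x hx => ?_
      exact ⟨Equiv.swap v w x, by simpa [hτ] using hx, by simp⟩
  have hev : e v < e w := by
    obtain ⟨b, hbT, hwb, hvb⟩ := hbb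
    refine card_lt_card ((ssubset_iff_of_subset ?_).2 ⟨b, ?_, ?_⟩)
    · intro b' hb'
      simp only [mem_filter] at hb' ⊢
      refine ⟨hb'.1, ?_⟩
      rw [← hbef] at hb' ⊢
      have hle : b ≤ b' := by
        by_contra hcon
        exact hvb (preceding_mono (before_mono (by omega)) hb'.2)
      exact preceding_mono (before_mono hle) hwb
    · simp [hbT, ← hbef, hwb]
    · simp [← hbef, hvb]
  refine hmin (∑ x, τ x * e x) ?_ ⟨τ, hfull, fun x hx => (hτC x hx).trans (hC x hx), rfl⟩
  have h₁ : ∀ f : Fin N → ℕ, ∑ x, f x = f v + f w + ∑ x ∈ (univ.erase v).erase w, f x := by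
    intro f
    rw [← add_sum_erase univ f (mem_univ v), ← add_sum_erase (univ.erase v) f (a := w)
      (by simp [hvw.symm]), add_assoc]
  rw [h₁, h₁ (fun x => σ' x * e x), hτv, hτw, sum_congr rfl fun x hx => by
    rw [hτo x (by simp at hx; tauto) (by simp at hx; tauto)]]
  -- Rearrangement: `(σ' w - σ' v) * (e w - e v) > 0`.
  have : σ' w * e v + σ' v * e w < σ' v * e v + σ' w * e w := by nlinarith
  omega

theorem answer_ne_nil (hG : G.Bounded bot top) (h : G.FullSchedule bot top T σ) (hm : 0 < G.m)
    (hsub : ∀ X ⊆ G.C, X ∈ G.subs) : G.answer T bot top ≠ [] := by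
  obtain ⟨σ', h', he⟩ := exists_earliestFirst hG h
  exact answer_ne_nil_of_earliestFirst hG h' he hm hsub

end

end Ctx
/-! ### Reasoning about programs -/

/-- The number of constructors of an expression. -/
def Expr.size : Expr → ℕ
  | .var _ => 1
  | .nil => 1
  | .cons a b => a.size + b.size + 1
  | .hd a => a.size + 1
  | .tl a => a.size + 1
  | .cond c a b => c.size + a.size + b.size + 1
  | .bind a b => a.size + b.size + 1
  | .call _ a => a.size + 1

/-- A bound on the sizes of the function bodies of a program. -/
def width (P : Program) : ℕ := (P.map Expr.size).sum

/-- The function `f` of the program `P` maps `x` to `y`, with at most `c` function calls. -/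
def Call (P : Program) (f : ℕ) (x y : SExp) (c : ℕ) : Prop :=
  ∃ e t, P[f]? = some e ∧ Eval P [x] e y t ∧ t ≤ width P * c

theorem Call.mono {P : Program} {f : ℕ} {x y : SExp} {c d : ℕ} (h : Call P f x y c) (hcd : c ≤ d) :
    Call P f x y d := by
  obtain ⟨e, t, h₁, h₂, h₃⟩ := h
  exact ⟨e, t, h₁, h₂, h₃.trans (Nat.mul_le_mul_left _ hcd)⟩

/-- Case distinction by whether a tree is `nil`. -/
def Branch (u : SExp) (A B : Prop) : Prop := (u ≠ .nil → A) ∧ (u = .nil → B)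

/-- The function `f` maps `u` to a value, with a number of function calls, such that `K` holds. -/
def CallThen (P : Program) (f : ℕ) (u : SExp) (K : SExp → ℕ → Prop) : Prop :=
  ∃ v t, Call P f u v t ∧ K v t

/-- The value is `y`, and the number of function calls is less than `c`. -/
def Ends (y : SExp) (c : ℕ) (v : SExp) (t : ℕ) : Prop := v = y ∧ t + 1 ≤ c

/-- The weakest condition on the environment for the evaluation of an expression to end with a value
and a number of function calls that satisfy `Q`. -/
def wp (P : Program) : Expr → List SExp → (SExp → ℕ → Prop) → Prop
  | .var i, env, Q => ∃ v, env[i]? = some v ∧ Q v 0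
  | .nil, _, Q => Q .nil 0
  | .cons a b, env, Q => wp P a env fun u s => wp P b env fun v t => Q (.cons u v) (s + t)
  | .hd a, env, Q => wp P a env fun u s => Q u.hd s
  | .tl a, env, Q => wp P a env fun u s => Q u.tl s
  | .cond c a b, env, Q => wp P c env fun u s =>
      Branch u (wp P a env fun v t => Q v (s + t)) (wp P b env fun v t => Q v (s + t))
  | .bind a b, env, Q => wp P a env fun u s => wp P b (u :: env) fun v t => Q v (s + t)
  | .call f a, env, Q => wp P a env fun u s => CallThen P f u fun v t => Q v (s + t)

/-- A body has no loops, so apart from calls it takes at most `e.size` steps; each unit of call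
count is worth `width P` steps. -/
theorem exists_eval_of_wp {P : Program} {e : Expr} {env : List SExp} {Q : SExp → ℕ → Prop}
    (h : wp P e env Q) :
    ∃ v c t, Q v c ∧ Eval P env e v t ∧ t ≤ e.size + width P * c := by
  induction e generalizing env Q with
  | var i =>
    obtain ⟨v, h₁, h₂⟩ := h
    exact ⟨v, 0, 1, h₂, .var h₁, by simp [Expr.size]⟩
  | nil => exact ⟨.nil, 0, 1, h, .nil, by simp [Expr.size]⟩
  | cons a b iha ihb =>
    obtain ⟨u, s, t, h, hu, hs⟩ := iha h
    obtain ⟨v, s', t', h, hv, hs'⟩ := ihb h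
    exact ⟨_, _, _, h, .cons hu hv, by simp only [Expr.size, mul_add] at *; omega⟩
  | hd a iha =>
    obtain ⟨u, s, t, h, hu, hs⟩ := iha h
    exact ⟨_, _, _, h, .hd hu, by simp only [Expr.size] at *; omega⟩
  | tl a iha =>
    obtain ⟨u, s, t, h, hu, hs⟩ := iha h
    exact ⟨_, _, _, h, .tl hu, by simp only [Expr.size] at *; omega⟩
  | cond c a b ihc iha ihb =>
    obtain ⟨u, s, t, h, hu, hs⟩ := ihc h
    cases u with
    | nil =>
      obtain ⟨v, s', t', h, hv, hs'⟩ := ihb (h.2 rfl)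
      exact ⟨_, _, _, h, .cond_false hu hv, by simp only [Expr.size, mul_add] at *; omega⟩
    | cons l r =>
      obtain ⟨v, s', t', h, hv, hs'⟩ := iha (h.1 (by simp))
      exact ⟨_, _, _, h, .cond_true hu hv, by simp only [Expr.size, mul_add] at *; omega⟩
  | bind a b iha ihb =>
    obtain ⟨u, s, t, h, hu, hs⟩ := iha h
    obtain ⟨v, s', t', h, hv, hs'⟩ := ihb h
    exact ⟨_, _, _, h, .bind hu hv, by simp only [Expr.size, mul_add] at *; omega⟩
  | call f a iha =>
    obtain ⟨u, s, t, ⟨v, s', ⟨e, t', h₁, h₂, h₃⟩, h⟩, hu, hs⟩ := iha h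
    refine ⟨_, _, _, h, .call hu h₁ h₂, ?_⟩
    simp only [Expr.size, mul_add] at *
    omega

theorem size_le_width {P : Program} {f : ℕ} {e : Expr} (h : P[f]? = some e) : e.size ≤ width P := by
  have : e.size ∈ P.map Expr.size := List.mem_map_of_mem (List.mem_of_getElem? h)
  exact List.single_le_sum (by simp) _ this

/-- The `+ 1` in `Ends` pays for the body itself, whose size is at most `width P`. -/
theorem Call.of_wp {P : Program} {f : ℕ} {e : Expr} {x y : SExp} {c : ℕ} (he : P[f]? = some e)
    (h : wp P e [x] (Ends y c)) : Call P f x y c := by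
  obtain ⟨v, s, t, ⟨rfl, hs⟩, hv, ht⟩ := exists_eval_of_wp h
  refine ⟨e, t, he, hv, ?_⟩
  have h₁ := size_le_width he
  have h₂ := Nat.mul_le_mul_left (width P) hs
  simp only [mul_add, mul_one] at *
  omega

/-! ### The program -/

/-- A list of trees as a tree. -/
def lst : List SExp → SExp
  | [] => .nil
  | a :: l => .cons a (lst l)

/-- A unary number. -/
def unary : ℕ → SExp
  | 0 => .nil
  | k + 1 => .cons .nil (unary k)

namespace Code

open PrecSched.Expr

/-- The expression for a list. -/
def mk : List Expr → Expr
  | [] => nil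
  | a :: l => cons a (mk l)

/-- The expression for the list without its first `i` entries. -/
def drops : ℕ → Expr → Expr
  | 0, e => e
  | i + 1, e => tl (drops i e)

/-- The `i`-th entry of the `j`-th variable. -/
def ent (j i : ℕ) : Expr := hd (drops i (var j))

/-- The `i`-th entry of the argument. -/
def arg (i : ℕ) : Expr := ent 0 i

/-- A Boolean constant. -/
def bool : Bool → Expr
  | false => nil
  | true => cons nil nil

/-- A truth table. -/
def table (f : Bool → Bool → Bool) : Expr :=
  cons (cons (bool (f true true)) (bool (f true false)))
    (cons (bool (f false true)) (bool (f false false)))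

/-- The indices are positions in `scheduler`; each `rfl` given to `Call.of_wp` checks one of them.
-/
abbrev iBitop : ℕ := 1
abbrev iAny : ℕ := 2
abbrev iRows : ℕ := 3
abbrev iPreceding : ℕ := 4
abbrev iRoom : ℕ := 5
abbrev iTake : ℕ := 6
abbrev iJobs : ℕ := 7
abbrev iAllFull : ℕ := 8
abbrev iRevApp : ℕ := 9
abbrev iMapCons : ℕ := 10
abbrev iConst : ℕ := 11
abbrev iDrop : ℕ := 12
abbrev iCap : ℕ := 13
abbrev iUnary : ℕ := 14
abbrev iAddJob : ℕ := 15
abbrev iAddPads : ℕ := 16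
abbrev iSubsets : ℕ := 17
abbrev iLook : ℕ := 18
abbrev iGet : ℕ := 19
abbrev iSub : ℕ := 20
abbrev iBlocked : ℕ := 21
abbrev iForced : ℕ := 22
abbrev iClear : ℕ := 23
abbrev iSlotOK : ℕ := 24
abbrev iDone : ℕ := 25
abbrev iCloseAfter : ℕ := 26
abbrev iDispatch : ℕ := 27
abbrev iSearch : ℕ := 28
abbrev iCloseAt : ℕ := 29
abbrev iSegment : ℕ := 30
abbrev iGlue : ℕ := 31
abbrev iSplit : ℕ := 32
abbrev iFill : ℕ := 33
abbrev iExtend : ℕ := 34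
abbrev iEntry : ℕ := 35
abbrev iBuild : ℕ := 36
abbrev iRounds : ℕ := 37
abbrev iCover : ℕ := 38
abbrev iMinCover : ℕ := 39
abbrev iStrip : ℕ := 40
abbrev iLoop : ℕ := 41
abbrev iSolve : ℕ := 42

def bitop (f : Bool → Bool → Bool) (a b : Expr) : Expr := call iBitop (mk [table f, a, b])
def inter (a b : Expr) : Expr := bitop and a b
def union (a b : Expr) : Expr := bitop or a b
def diff (a b : Expr) : Expr := bitop (fun x y => x && !y) a b
def zeros (a : Expr) : Expr := bitop (fun _ _ => false) a a
def compl (a : Expr) : Expr := bitop (fun x _ => !x) a a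
def sub (a b : Expr) : Expr := call iSub (mk [a, b])

/-- The main function: the arguments are the number of machines and the matrix. -/
def main : Expr :=
  -- The matrix with one more entry has length `n + 1`. This caps the binary number of machines, and
  -- keeps the cap positive for `n = 0`.
  call iLoop (mk [tl (var 0), call iUnary (mk [hd (var 0), cons nil (tl (var 0))]), nil, nil])

/-- Arguments: truth table, `X`, `Y`. -/
def bitopBody : Expr :=
  cond (arg 1)
    (cons (cond (hd (arg 1)) (cond (hd (arg 2)) (hd (hd (arg 0))) (tl (hd (arg 0))))
        (cond (hd (arg 2)) (hd (tl (arg 0))) (tl (tl (arg 0)))))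
      (call iBitop (mk [arg 0, tl (arg 1), tl (arg 2)])))
    nil

/-- Argument: `X`. -/
def any : Expr := cond (var 0) (cond (hd (var 0)) (bool true) (call iAny (tl (var 0)))) nil

/-- The union of the rows with indices in `X`. Arguments: matrix, `X`, accumulator. -/
def rows : Expr :=
  cond (arg 0)
    (call iRows (mk [tl (arg 0), tl (arg 1), cond (hd (arg 1)) (union (arg 2) (hd (arg 0))) (arg 2)]))
    (arg 2)

/-- Arguments: matrix, `B`. -/
def preceding : Expr :=
  cond (arg 0)
    (cons (call iAny (inter (hd (arg 0)) (arg 1))) (call iPreceding (mk [tl (arg 0), arg 1]))) nil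

/-- Arguments: `X`, unary number `k`. The value is `k - #X`. -/
def room : Expr :=
  cond (arg 0) (call iRoom (mk [tl (arg 0), cond (hd (arg 0)) (tl (arg 1)) (arg 1)])) (arg 1)

/-- Arguments: `X`, unary number. -/
def take : Expr :=
  cond (arg 0)
    (cond (hd (arg 0))
      (cond (arg 1) (cons (bool true) (call iTake (mk [tl (arg 0), tl (arg 1)])))
        (cons nil (call iTake (mk [tl (arg 0), nil]))))
      (cons nil (call iTake (mk [tl (arg 0), arg 1]))))
    nil

/-- Arguments: piece, accumulator. -/
def jobs : Expr :=
  cond (arg 0) (call iJobs (mk [tl (arg 0), union (arg 1) (hd (arg 0))])) (arg 1)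

/-- Arguments: piece, number of machines. -/
def allFull : Expr :=
  cond (arg 0)
    (cond (call iRoom (mk [hd (arg 0), arg 1])) nil (call iAllFull (mk [tl (arg 0), arg 1])))
    (bool true)

/-- Arguments: list, accumulator. -/
def revApp : Expr :=
  cond (arg 0) (call iRevApp (mk [tl (arg 0), cons (hd (arg 0)) (arg 1)])) (arg 1)

/-- Arguments: tree, list of lists, list to append. -/
def mapCons : Expr :=
  cond (arg 1)
    (cons (cons (arg 0) (hd (arg 1))) (call iMapCons (mk [arg 0, tl (arg 1), arg 2]))) (arg 2)

/-- Arguments: tree, list. -/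
def const : Expr := cond (arg 1) (cons (arg 0) (call iConst (mk [arg 0, tl (arg 1)]))) nil

/-- Arguments: two lists; drop from the second one the length of the first one. -/
def drop : Expr := cond (arg 0) (call iDrop (mk [tl (arg 0), tl (arg 1)])) (arg 1)

/-- The minimum of the lengths of two lists. -/
def cap : Expr :=
  cond (arg 0) (cond (arg 1) (cons nil (call iCap (mk [tl (arg 0), tl (arg 1)]))) nil) nil

/-- Arguments: binary number, list. The value is the unary minimum of the number and the length of
the list. -/
def unary : Expr :=
  cond (arg 0)
    -- The value is capped after every doubling, so the unary numbers stay short.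
    (bind (call iUnary (mk [tl (arg 0), arg 1]))
      (call iCap (mk [ent 1 1, cond (hd (ent 1 0))
        (cons nil (call iRevApp (mk [var 0, var 0]))) (call iRevApp (mk [var 0, var 0]))])))
    nil

/-- Arguments: entry of the new row, entry of the new column, matrix. -/
def addJob : Expr :=
  cons (cons nil (call iConst (mk [arg 0, arg 2]))) (call iMapCons (mk [arg 1, arg 2, nil]))

/-- Arguments: unary number, matrix. -/
def addPads : Expr :=
  cond (arg 0) (call iAddJob (mk [nil, nil, call iAddPads (mk [tl (arg 0), arg 1])])) (arg 1)

/-- Argument: `C`. -/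
def subsets : Expr :=
  cond (var 0)
    (bind (call iSubsets (tl (var 0)))
      (cond (hd (var 1))
        (call iMapCons (mk [nil, var 0, call iMapCons (mk [bool true, var 0, nil])]))
        (call iMapCons (mk [nil, var 0, nil]))))
    (mk [nil])

/-- The child of the `0`-th variable for the heads of the sets `i`, …, `6` in the `1`-st variable. -/
def child : ℕ → ℕ → Expr
  | 0, i => ent 0 (i - 1)
  | k + 1, i => cond (hd (ent 1 i)) (ent 0 (i - 1)) (child k (i + 1))

/-- Arguments: table, six sets. -/
def look : Expr :=
  cond (arg 1)
    -- The recursion goes to the end of the vectors before a child is chosen: the tree branches on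
    -- the last element first.
    (bind (call iLook (mk [arg 0, tl (arg 1), tl (arg 2), tl (arg 3), tl (arg 4), tl (arg 5),
      tl (arg 6)])) (child 6 1))
    (arg 0)

/-- Arguments: table, six sets. -/
def get : Expr :=
  cond (sub (arg 1) (arg 2)) (cond (sub (arg 2) (arg 3)) (cond (sub (arg 3) (arg 4))
    (cond (sub (arg 4) (arg 5)) (cond (sub (arg 5) (arg 6)) (call iLook (var 0)) nil) nil) nil) nil)
    nil

/-- Arguments: `X`, `Y`. -/
def subBody : Expr := cond (call iAny (diff (arg 0) (arg 1))) nil (bool true)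

/-- The entries of a context in the `i`-th argument. -/
def matrixOf (a : Expr) : Expr := hd a
def machinesOf (a : Expr) : Expr := hd (tl a)
def coverOf (a : Expr) : Expr := hd (tl (tl a))
def subsetsOf (a : Expr) : Expr := hd (tl (tl (tl a)))
def revCoverOf (a : Expr) : Expr := hd (tl (tl (tl (tl a))))

/-- Arguments: context, `X`. -/
def blocked : Expr :=
  call iRows (mk [matrixOf (arg 0), diff (coverOf (arg 0)) (arg 1), zeros (arg 1)])

/-- Arguments: context, `A`, `U`, `B`. -/
def forced : Expr :=
  diff (diff (inter (call iBlocked (mk [arg 0, arg 1]))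
    (call iPreceding (mk [matrixOf (arg 0), arg 3]))) (call iBlocked (mk [arg 0, arg 2])))
    (coverOf (arg 0))

/-- Arguments: context, `W`, `B`. -/
def clear : Expr :=
  cond (call iAny (diff (inter (call iBlocked (mk [arg 0, arg 1]))
    (call iPreceding (mk [matrixOf (arg 0), arg 2]))) (coverOf (arg 0)))) nil (bool true)

/-- Arguments: context, `U`, `U'`. -/
def slotOK : Expr :=
  cond (call iAny (inter (diff (arg 2) (arg 1)) (call iBlocked (mk [arg 0, arg 1])))) nil
    (call iRoom (mk [diff (arg 2) (arg 1), cons nil (machinesOf (arg 0))]))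

/-- Arguments: context, piece, `A`, `U`, `B`. -/
def done : Expr :=
  sub (call iForced (mk [arg 0, arg 2, arg 3, arg 4])) (call iJobs (mk [arg 1, zeros (arg 2)]))

/-- Arguments: `W`, context, table, `V`, `V'`, `U`, `U'`. -/
def closeAfter : Expr :=
  bind (call iGet (mk [arg 2, arg 3, arg 4, arg 0, arg 5, arg 5, arg 6]))
    (cond (var 0)
      (cond (call iDone (mk [ent 1 1, var 0, ent 1 3, ent 1 0, ent 1 6]))
        (cond (call iClear (mk [ent 1 1, ent 1 0, ent 1 6]))
          (cons (diff (ent 1 6) (ent 1 5)) (var 0)) nil) nil) nil)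

/-- The values of the first argument of `dispatch`. -/
def tag : ℕ → Expr
  | 0 => nil
  | 1 => mk [nil]
  | _ => mk [mk [nil]]

/-- Arguments: tag, value of the loop variable, list of the other arguments. -/
def dispatch : Expr :=
  -- The language is first-order, so the function to be searched is encoded by a tag: `tag 0` tries
  -- `W` in `closeAfter`; `tag 2` tries `V` and starts the search over `V'` with `tag 1`, which
  -- calls `glue`.
  cond (arg 0)
    (cond (hd (arg 0))
      (call iSearch (mk [tag 1, subsetsOf (hd (tl (tl (arg 2)))), cons (arg 1) (arg 2)]))
      (call iGlue (cons (arg 1) (arg 2))))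
    (call iCloseAfter (cons (arg 1) (arg 2)))

/-- Arguments: tag, list of the values of the loop variable, list of the other arguments. -/
def search : Expr :=
  cond (arg 1)
    (bind (call iDispatch (mk [arg 0, hd (arg 1), arg 2]))
      (cond (var 0) (var 0) (call iSearch (mk [ent 1 0, tl (ent 1 1), ent 1 2]))))
    nil

/-- Arguments: context, tables, `V`, `V'`, `U`, `U'`. -/
def closeAt : Expr :=
  cond (call iSlotOK (mk [arg 0, arg 4, arg 5]))
    (cond (arg 1)
      (call iSearch (mk [tag 0, subsetsOf (arg 0),
        mk [arg 0, hd (arg 1), arg 2, arg 3, arg 4, arg 5]]))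
      (cond (sub (arg 3) (arg 4)) (cond (sub (arg 4) (arg 3))
        (cond (call iClear (mk [arg 0, arg 2, arg 5])) (mk [diff (arg 5) (arg 4)]) nil) nil) nil))
    nil

/-- Arguments: context, tables, `V`, `V'`, `U`, `U'`, `c`. -/
def segment : Expr :=
  cond (arg 1)
    (cond (sub (arg 6) (arg 5))
      (call iCloseAt (mk [arg 0, tl (arg 1), arg 2, arg 3, arg 4, arg 5]))
      (bind (call iGet (mk [hd (arg 1), arg 2, arg 3, arg 4, arg 5, arg 5, arg 6]))
        (cond (call iDone (mk [ent 1 0, var 0, ent 1 2, ent 1 4, ent 1 6])) (var 0) nil)))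
    nil

/-- Arguments: `V'`, `V`, table, tables, context, `A`, `A'`, `U`, `U'`, `c`, `B`. -/
def glue : Expr :=
  bind (call iGet (mk [arg 2, arg 5, arg 6, arg 1, arg 0, arg 9, arg 10]))
    (cond (var 0)
      (cond (call iAllFull (mk [var 0, machinesOf (ent 1 4)]))
        (bind (call iSegment (mk [ent 1 4, ent 1 3, ent 1 1, ent 1 0, ent 1 7, ent 1 8, ent 1 9]))
          (cond (var 0)
            (cond (call iAllFull (mk [tl (var 0), machinesOf (ent 2 4)]))
              (call iRevApp (mk [call iRevApp (mk [var 0, nil]), var 1])) nil) nil))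
        nil) nil)

/-- Arguments: reversed tables, tables, context, `A`, `A'`, `U`, `U'`, `c`, `B`. -/
def split : Expr :=
  cond (arg 0)
    (bind (call iSearch (mk [tag 2, subsetsOf (arg 2), cons (hd (arg 0)) (tl (var 0))]))
      (cond (var 0) (var 0)
        (call iSplit (cons (tl (ent 1 0)) (cons (tl (ent 1 1)) (drops 2 (var 1)))))))
    nil

/-- Arguments: context, `A`, `U`, `B`, piece. -/
def fill : Expr :=
  cond (arg 4)
    (cons (union (hd (arg 4)) (call iTake (mk [
        diff (call iForced (mk [arg 0, arg 1, arg 2, arg 3])) (call iJobs (mk [arg 4, zeros (arg 1)])),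
        call iRoom (mk [hd (arg 4), machinesOf (arg 0)])])))
      (tl (arg 4)))
    nil

/-- Arguments: piece, tables, context, `A`, `A'`, `U`, `U'`, `c`, `B`. -/
def extend : Expr :=
  call iFill (mk [arg 2, arg 3, arg 5, arg 8,
    cond (arg 0)
      (cond (call iAllFull (mk [tl (arg 0), machinesOf (arg 2)])) (arg 0)
        (call iSplit (cons (call iRevApp (mk [arg 1, nil])) (tl (var 0)))))
      (call iSplit (cons (call iRevApp (mk [arg 1, nil])) (tl (var 0))))])

/-- Arguments: tables, context, `A`, `A'`, `U`, `U'`, `c`, `B`. -/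
def entry : Expr :=
  cond (sub (arg 6) (arg 5))
    (call iExtend (cons (call iCloseAt (mk [arg 1, arg 0, arg 2, arg 3, arg 4, arg 5])) (var 0)))
    (bind
      (call iExtend (cons (call iCloseAt (mk [arg 1, arg 0, arg 2, arg 3, arg 4, arg 5]))
        (mk [arg 0, arg 1, arg 2, arg 3, arg 4, arg 5, arg 5, arg 6])))
      (call iExtend (cons
        (cond (call iDone (mk [ent 1 1, var 0, ent 1 2, ent 1 4, ent 1 6])) (var 0) nil) (var 1))))

/-- The call of `build` for the `d`-th child. -/
def buildChild (d : ℕ) : Expr :=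
  call iBuild (mk [tl (arg 0), arg 1, arg 2, cons (bool (d ≤ 0)) (arg 3), cons (bool (d ≤ 1)) (arg 4),
    cons (bool (d ≤ 2)) (arg 5), cons (bool (d ≤ 3)) (arg 6), cons (bool (d ≤ 4)) (arg 7),
    cons (bool (d ≤ 5)) (arg 8)])

/-- Arguments: the remaining part of the reversed cover, tables, context, the six sets. -/
def build : Expr :=
  -- The six vectors grow at the front, so elements are processed from the last to the first; hence
  -- the reversed cover.
  cond (arg 0)
    (cond (hd (arg 0))
      (mk [buildChild 0, buildChild 1, buildChild 2, buildChild 3, buildChild 4, buildChild 5,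
        buildChild 6])
      (mk [nil, nil, nil, nil, nil, nil, buildChild 6]))
    (call iEntry (tl (var 0)))

/-- Arguments: context, unary number, tables. -/
def rounds : Expr :=
  cond (arg 1)
    (call iRounds (mk [arg 0, tl (arg 1),
      cons (call iBuild (mk [revCoverOf (arg 0), arg 2, arg 0, nil, nil, nil, nil, nil, nil]))
        (arg 2)]))
    (arg 2)

/-- Arguments: unary number, matrix, `X`. -/
def cover : Expr :=
  -- These are the lower ends of the uncovered edges. The first of them, or else its first successor
  -- outside `X`, is added to `X`.
  bind (diff (call iPreceding (mk [arg 1, compl (arg 2)])) (arg 2))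
    (cond (call iAny (var 0))
      (cond (ent 1 0)
        (bind (call iTake (mk [var 0, mk [nil]]))
          (bind (call iCover (mk [tl (ent 2 0), ent 2 1, union (ent 2 2) (var 0)]))
            (cond (var 0) (var 0)
              (call iCover (mk [tl (ent 3 0), ent 3 1, union (ent 3 2) (call iTake (mk [
                diff (call iRows (mk [ent 3 1, var 1, zeros (ent 3 2)])) (ent 3 2), mk [nil]]))])))))
        nil)
      (ent 1 2))

/-- Arguments: unary number, matrix, `X`. -/
def minCover : Expr :=
  bind (call iCover (var 0))
    (cond (var 0) (var 0) (call iMinCover (mk [cons nil (ent 1 0), ent 1 1, ent 1 2])))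

/-- Arguments: list whose length is dropped, reversed piece, accumulator. -/
def strip : Expr :=
  cond (arg 1)
    (call iStrip (mk [arg 0, tl (arg 1), cons (call iDrop (mk [arg 0, hd (arg 1)])) (arg 2)])) (arg 2)

/-- Arguments: matrix, number of machines, number of slots, their product. -/
def loop : Expr :=
  bind (call iDrop (mk [arg 0, arg 3]))
    (bind (call iAddPads (mk [var 0, ent 1 0]))
      (bind (call iSolve (mk [call iAddJob (mk [bool true, nil, call iAddJob (mk [nil, bool true,
          var 0])]), ent 2 1, ent 2 2, var 0]))
        (cond (var 0)
          -- `tl` removes the slot of the maximum; each vector then loses the entries of the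
          -- minimum, the maximum and the isolated jobs.
          (call iStrip (mk [cons nil (cons nil (var 2)), tl (var 0), nil]))
          (call iLoop (mk [ent 3 0, ent 3 1, cons nil (ent 3 2),
            call iRevApp (mk [ent 3 1, ent 3 3])])))))

/-- Arguments: matrix with minimum and maximum, number of machines, number of slots, matrix without
minimum and maximum. -/
def solve : Expr :=
  bind (call iConst (mk [nil, arg 3]))
    (bind (call iMinCover (mk [nil, ent 1 0, cons (bool true) (cons (bool true) (var 0))]))
      (bind (mk [ent 2 0, ent 2 1, var 0, call iSubsets (var 0), call iRevApp (mk [var 0, nil])])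
        (call iCloseAt (mk [var 0, call iRounds (mk [var 0, ent 3 2, nil]),
          cons nil (cons nil (var 2)), cons (bool true) (cons nil (var 2)),
          diff (var 1) (cons nil (cons (bool true) (var 2))), var 1]))))

end Code

open Code in
/-- The scheduling algorithm. -/
def scheduler : Program :=
  [main, bitopBody, any, rows, preceding, room, take, Code.jobs, allFull, revApp, mapCons, Code.const,
    Code.drop, Code.cap, Code.unary, addJob, addPads, Code.subsets, look, Code.get, subBody, blocked,
    forced, clear, slotOK, done, closeAfter, dispatch, search, closeAt, segment, glue, split, fill,
    extend, entry, build, rounds, cover, minCover, strip, loop, solve]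

/-! ### The elementary functions of the program -/

/-- A 0-1-vector as a tree. -/
abbrev encBits (l : List Bool) : SExp := encList encBool l

@[simp] theorem hd_cons (a b : SExp) : (SExp.cons a b).hd = a := rfl
@[simp] theorem tl_cons (a b : SExp) : (SExp.cons a b).tl = b := rfl
@[simp] theorem tl_nil : SExp.nil.tl = .nil := rfl
@[simp] theorem tl_unary (k : ℕ) : (unary k).tl = unary (k - 1) := by cases k <;> rfl
@[simp] theorem encBool_true : encBool true = .cons .nil .nil := rfl
@[simp] theorem encBool_false : encBool false = .nil := rfl
@[simp] theorem encList_nil {α : Type} (enc : α → SExp) : encList enc [] = .nil := rfl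
@[simp] theorem encList_cons {α : Type} (enc : α → SExp) (a : α) (l : List α) :
    encList enc (a :: l) = .cons (enc a) (encList enc l) := rfl
theorem encList_eq_nil {α : Type} (enc : α → SExp) (l : List α) :
    encList enc l = .nil ↔ l = [] := by cases l <;> simp
@[simp] theorem unary_zero : unary 0 = .nil := rfl
@[simp] theorem unary_succ (k : ℕ) : unary (k + 1) = .cons .nil (unary k) := rfl
@[simp] theorem lst_nil : lst [] = .nil := rfl
@[simp] theorem lst_cons (a : SExp) (l : List SExp) : lst (a :: l) = .cons a (lst l) := rfl

theorem encSet_eq {N : ℕ} (X : Finset (Fin N)) : encSet X = encBits (bits X) := rfl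

section

variable {env : List SExp} {Q : SExp → ℕ → Prop} {P : Program}

@[simp] theorem branch_nil (A B : Prop) : Branch .nil A B ↔ B := by simp [Branch]
@[simp] theorem branch_cons (a b : SExp) (A B : Prop) : Branch (.cons a b) A B ↔ A := by
  simp [Branch]

theorem Branch.of_ne {u : SExp} {A B : Prop} (h : u ≠ .nil) (hA : A) : Branch u A B :=
  ⟨fun _ => hA, fun h' => absurd h' h⟩

theorem Branch.of_eq {u : SExp} {A B : Prop} (h : u = .nil) (hB : B) : Branch u A B :=
  ⟨fun h' => absurd h h', fun _ => hB⟩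

theorem CallThen.of_call {f : ℕ} {u v : SExp} {K : SExp → ℕ → Prop} {t : ℕ} (h : Call P f u v t)
    (hK : K v t) : CallThen P f u K := ⟨v, t, h, hK⟩

@[simp] theorem wp_var_zero (v : SExp) : wp P (.var 0) (v :: env) Q ↔ Q v 0 := by simp [wp]
@[simp] theorem wp_var_one (u v : SExp) : wp P (.var 1) (u :: v :: env) Q ↔ Q v 0 := by simp [wp]
@[simp] theorem wp_var_two (u v w : SExp) :
    wp P (.var 2) (u :: v :: w :: env) Q ↔ Q w 0 := by simp [wp]
@[simp] theorem wp_var_three (u v w x : SExp) :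
    wp P (.var 3) (u :: v :: w :: x :: env) Q ↔ Q x 0 := by simp [wp]
@[simp] theorem wp_nil : wp P .nil env Q ↔ Q .nil 0 := .rfl
@[simp] theorem wp_cons (a b : Expr) : wp P (.cons a b) env Q ↔
    wp P a env fun u s => wp P b env fun v t => Q (.cons u v) (s + t) := .rfl
@[simp] theorem wp_hd (a : Expr) : wp P (.hd a) env Q ↔ wp P a env fun u s => Q u.hd s := .rfl
@[simp] theorem wp_tl (a : Expr) : wp P (.tl a) env Q ↔ wp P a env fun u s => Q u.tl s := .rfl
@[simp] theorem wp_cond (c a b : Expr) : wp P (.cond c a b) env Q ↔ wp P c env fun u s =>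
    Branch u (wp P a env fun v t => Q v (s + t)) (wp P b env fun v t => Q v (s + t)) := .rfl
@[simp] theorem wp_bind (a b : Expr) : wp P (.bind a b) env Q ↔
    wp P a env fun u s => wp P b (u :: env) fun v t => Q v (s + t) := .rfl
@[simp] theorem wp_call (f : ℕ) (a : Expr) : wp P (.call f a) env Q ↔
    wp P a env fun u s => CallThen P f u fun v t => Q v (s + t) := .rfl

attribute [simp] Code.mk Code.ent Code.arg Code.drops

@[simp] theorem wp_bool (b : Bool) : wp P (Code.bool b) env Q ↔ Q (encBool b) 0 := by
  cases b <;> simp [Code.bool]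

/-- The truth table of a Boolean function as a tree. -/
def encTable (f : Bool → Bool → Bool) : SExp :=
  .cons (.cons (encBool (f true true)) (encBool (f true false)))
    (.cons (encBool (f false true)) (encBool (f false false)))

@[simp] theorem wp_table (f : Bool → Bool → Bool) :
    wp P (Code.table f) env Q ↔ Q (encTable f) 0 := by
  simp [Code.table, encTable]

end

/-- A function of the scheduling algorithm maps `x` to `y`, with at most `c` function calls. -/
abbrev Calls (f : ℕ) (x y : SExp) (c : ℕ) : Prop := Call scheduler f x y c

/-- The pattern of all these lemmas: `simp` evaluates the body up to the next call, `.of_call`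
inserts the value and cost of that call, and the last pair compares the result and the total count.
-/
theorem call_bitop (f : Bool → Bool → Bool) (l l' : List Bool) (h : l.length = l'.length) :
    Calls Code.iBitop (lst [encTable f, encBits l, encBits l']) (encBits (List.zipWith f l l'))
      (l.length + 1) := by
  induction l generalizing l' with
  | nil =>
    refine .of_wp (e := Code.bitopBody) rfl ?_
    simp [Code.bitopBody, Ends]
  | cons a l ih =>
    obtain _ | ⟨b, l'⟩ := l'
    · simp at h
    refine .of_wp (e := Code.bitopBody) rfl ?_
    have := ih l' (by simpa using h)
    cases a <;> cases b <;> simp [Code.bitopBody] <;>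
      exact .of_call this ⟨by simp [encTable], by simp⟩

theorem call_any (l : List Bool) :
    Calls Code.iAny (encBits l) (encBool (l.any id)) (l.length + 1) := by
  induction l with
  | nil =>
    refine .of_wp (e := Code.any) rfl ?_
    simp [Code.any, Ends]
  | cons a l ih =>
    refine .of_wp (e := Code.any) rfl ?_
    cases a
    · simp [Code.any]
      exact .of_call ih ⟨rfl, by simp⟩
    · simp [Code.any, Ends]

theorem call_room (l : List Bool) (k : ℕ) :
    Calls Code.iRoom (lst [encBits l, unary k]) (unary (k - l.count true))
      (l.length + 1) := by
  induction l generalizing k with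
  | nil =>
    refine .of_wp (e := Code.room) rfl ?_
    simp [Code.room, Ends]
  | cons a l ih =>
    refine .of_wp (e := Code.room) rfl ?_
    cases a <;> simp [Code.room]
    · exact .of_call (ih k) ⟨by simp, by simp⟩
    · exact .of_call (ih (k - 1)) ⟨by simp [Nat.sub_sub, add_comm], by simp⟩

theorem encList_eq_lst {α : Type} (enc : α → SExp) (l : List α) :
    encList enc l = lst (l.map enc) := by
  induction l with
  | nil => rfl
  | cons a l ih => simp [ih]

theorem unary_eq_lst (k : ℕ) : unary k = lst (List.replicate k .nil) := by
  induction k with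
  | zero => rfl
  | succ k ih => simp [List.replicate_succ, ih]

theorem call_take (l : List Bool) (k : ℕ) :
    Calls Code.iTake (lst [encBits l, unary k]) (encBits (takeBits l k)) (l.length + 1) := by
  induction l generalizing k with
  | nil =>
    refine .of_wp (e := Code.take) rfl ?_
    simp [Code.take, Ends, takeBits]
  | cons a l ih =>
    refine .of_wp (e := Code.take) rfl ?_
    cases a
    · simp [Code.take]
      exact .of_call (ih k) ⟨by simp [takeBits], by simp⟩
    · cases k
      · simp [Code.take]
        exact .of_call (ih 0) ⟨by simp [takeBits], by simp⟩
      · simp [Code.take]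
        exact .of_call (ih _) ⟨by simp [takeBits], by simp⟩

theorem call_revApp (l l' : List SExp) :
    Calls Code.iRevApp (lst [lst l, lst l']) (lst (l.reverse ++ l')) (l.length + 1) := by
  induction l generalizing l' with
  | nil =>
    refine .of_wp (e := Code.revApp) rfl ?_
    simp [Code.revApp, Ends]
  | cons a l ih =>
    refine .of_wp (e := Code.revApp) rfl ?_
    simp [Code.revApp]
    exact .of_call (ih (a :: l')) ⟨by simp, by simp⟩

theorem call_mapCons (b : SExp) (l l' : List SExp) :
    Calls Code.iMapCons (lst [b, lst l, lst l']) (lst (l.map (SExp.cons b) ++ l'))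
      (l.length + 1) := by
  induction l with
  | nil =>
    refine .of_wp (e := Code.mapCons) rfl ?_
    simp [Code.mapCons, Ends]
  | cons a l ih =>
    refine .of_wp (e := Code.mapCons) rfl ?_
    simp [Code.mapCons]
    exact .of_call ih ⟨by simp, by simp⟩

theorem call_const (b : SExp) (l : List SExp) :
    Calls Code.iConst (lst [b, lst l]) (lst (List.replicate l.length b)) (l.length + 1) := by
  induction l with
  | nil =>
    refine .of_wp (e := Code.const) rfl ?_
    simp [Code.const, Ends]
  | cons a l ih =>
    refine .of_wp (e := Code.const) rfl ?_
    simp [Code.const]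
    exact .of_call ih ⟨by simp [List.replicate_succ], by simp⟩

theorem call_drop (l : List SExp) (x : SExp) :
    Calls Code.iDrop (lst [lst l, x]) (SExp.tl^[l.length] x) (l.length + 1) := by
  induction l generalizing x with
  | nil =>
    refine .of_wp (e := Code.drop) rfl ?_
    simp [Code.drop, Ends]
  | cons a l ih =>
    refine .of_wp (e := Code.drop) rfl ?_
    simp [Code.drop]
    exact .of_call (ih x.tl) ⟨by simp, by simp⟩

theorem call_cap (l l' : List SExp) :
    Calls Code.iCap (lst [lst l, lst l']) (unary (min l.length l'.length)) (l.length + 1) := by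
  induction l generalizing l' with
  | nil =>
    refine .of_wp (e := Code.cap) rfl ?_
    simp [Code.cap, Ends]
  | cons a l ih =>
    refine .of_wp (e := Code.cap) rfl ?_
    cases l' with
    | nil => simp [Code.cap, Ends]
    | cons b l' =>
      simp [Code.cap]
      exact .of_call (ih l') ⟨by simp, by simp⟩

/-- The number with the given binary digits, the least significant digit first. -/
def binary (l : List Bool) : ℕ := l.foldr Nat.bit 0

theorem binary_bits (k : ℕ) : binary k.bits = k := by
  induction k using Nat.binaryRec' with
  | zero => simp [binary]
  | bit b n h ih =>
    rw [Nat.bits_append_bit _ _ h]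
    exact congrArg (Nat.bit b) ih

/-- Horner's scheme commutes with capping: `min n (2 * min n b + a) = min n (2 * b + a)`. -/
theorem call_unary (l : List Bool) (l' : List SExp) :
    Calls Code.iUnary (lst [encBits l, lst l']) (unary (min l'.length (binary l)))
      (l.length * (2 * l'.length + 3) + 1) := by
  induction l with
  | nil =>
    refine .of_wp (e := Code.unary) rfl ?_
    simp [Code.unary, Ends, binary]
  | cons a l ih =>
    refine .of_wp (e := Code.unary) rfl ?_
    simp [Code.unary]
    refine .of_call ih ?_
    generalize hk : min l'.length (binary l) = k
    have hk' : k ≤ l'.length := by omega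
    have hb : binary (a :: l) = 2 * binary l + a.toNat := by
      simp [binary, Nat.bit_val]
    have hr := call_revApp (List.replicate k .nil) (List.replicate k .nil)
    rw [← unary_eq_lst] at hr
    cases a <;> simp
    · refine .of_call hr ?_
      have := call_cap l' ((List.replicate k SExp.nil).reverse ++ List.replicate k SExp.nil)
      refine .of_call this ⟨?_, ?_⟩
      · congr 1
        simp [hb]
        omega
      · simp
        nlinarith
    · refine .of_call hr ?_
      have := call_cap l' (.nil :: ((List.replicate k SExp.nil).reverse ++ List.replicate k SExp.nil))
      refine .of_call this ⟨?_, ?_⟩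
      · congr 1
        simp [hb]
        omega
      · simp
        nlinarith

/-! ### Operations on sets -/

section

variable {N : ℕ}

theorem zipWith_bits (f : Bool → Bool → Bool) (X Y : Finset (Fin N)) :
    List.zipWith f (bits X) (bits Y) =
      bits (univ.filter fun j => f (decide (j ∈ X)) (decide (j ∈ Y)) = true) := by
  apply List.ext_getElem <;> simp [bits]

theorem call_set (f : Bool → Bool → Bool) (X Y Z : Finset (Fin N))
    (h : ∀ j, j ∈ Z ↔ f (decide (j ∈ X)) (decide (j ∈ Y)) = true) :
    Calls Code.iBitop (lst [encTable f, encSet X, encSet Y]) (encSet Z) (N + 1) := by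
  have := call_bitop f (bits X) (bits Y) (by simp)
  rw [zipWith_bits, length_bits] at this
  rwa [show Z = univ.filter fun j => f (decide (j ∈ X)) (decide (j ∈ Y)) = true by
    ext j; simp [h]]

theorem call_inter (X Y : Finset (Fin N)) :
    Calls Code.iBitop (lst [encTable and, encSet X, encSet Y]) (encSet (X ∩ Y)) (N + 1) :=
  call_set _ _ _ _ (by simp)

theorem call_union (X Y : Finset (Fin N)) :
    Calls Code.iBitop (lst [encTable or, encSet X, encSet Y]) (encSet (X ∪ Y)) (N + 1) :=
  call_set _ _ _ _ (by simp)

theorem call_diff (X Y : Finset (Fin N)) :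
    Calls Code.iBitop (lst [encTable fun x y => x && !y, encSet X, encSet Y]) (encSet (X \ Y))
      (N + 1) :=
  call_set _ _ _ _ (by simp)

theorem call_zeros (X : Finset (Fin N)) :
    Calls Code.iBitop (lst [encTable fun _ _ => false, encSet X, encSet X])
      (encSet (∅ : Finset (Fin N))) (N + 1) :=
  call_set _ _ _ _ (by simp)

theorem call_compl (X : Finset (Fin N)) :
    Calls Code.iBitop (lst [encTable fun x _ => !x, encSet X, encSet X]) (encSet Xᶜ) (N + 1) :=
  call_set _ _ _ _ (by simp)

theorem any_bits (X : Finset (Fin N)) : (bits X).any id = decide (X ≠ ∅) := by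
  rw [Bool.eq_iff_iff]
  simp [bits, List.mem_ofFn, ← nonempty_iff_ne_empty, Finset.Nonempty]

theorem call_nonempty (X : Finset (Fin N)) :
    Calls Code.iAny (encSet X) (encBool (decide (X ≠ ∅))) (N + 1) := by
  have := call_any (bits X)
  rwa [any_bits, length_bits] at this

theorem call_room_set (X : Finset (Fin N)) (k : ℕ) :
    Calls Code.iRoom (lst [encSet X, unary k]) (unary (k - X.card)) (N + 1) := by
  have := call_room (bits X) k
  rwa [← card_eq_count_bits, length_bits] at this

theorem call_firstElems (X : Finset (Fin N)) (k : ℕ) :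
    Calls Code.iTake (lst [encSet X, unary k]) (encSet (firstElems X k)) (N + 1) := by
  have := call_take (bits X) k
  rwa [← bits_firstElems, length_bits] at this

theorem call_sub (X Y : Finset (Fin N)) :
    Calls Code.iSub (lst [encSet X, encSet Y]) (encBool (decide (X ⊆ Y))) (2 * N + 3) := by
  refine .of_wp (e := Code.subBody) rfl ?_
  simp [Code.subBody, Code.diff, Code.bitop]
  refine .of_call (call_diff X Y) (.of_call (call_nonempty _) ?_)
  by_cases h : X ⊆ Y
  · refine .of_eq (by simp [sdiff_eq_empty_iff_subset, h]) ⟨by simp [h], by simp; omega⟩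
  · refine .of_ne (by simp [sdiff_eq_empty_iff_subset, h]) ⟨by simp [h], by omega⟩

theorem call_jobs (p : Piece N) (X : Finset (Fin N)) :
    Calls Code.iJobs (lst [encList encSet p, encSet X]) (encSet (X ∪ jobs p))
      (p.length * (N + 2) + 1) := by
  induction p generalizing X with
  | nil =>
    refine .of_wp (e := Code.jobs) rfl ?_
    simp [Code.jobs, Ends]
  | cons z p ih =>
    refine .of_wp (e := Code.jobs) rfl ?_
    simp [Code.jobs, Code.union, Code.bitop]
    refine .of_call (call_union X z) (.of_call (ih _) ⟨by simp, ?_⟩)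
    linarith

theorem call_allFull (p : Piece N) (k : ℕ) :
    Calls Code.iAllFull (lst [encList encSet p, unary k])
      (encBool (decide (∀ z ∈ p, k ≤ z.card))) (p.length * (N + 2) + 1) := by
  induction p with
  | nil =>
    refine .of_wp (e := Code.allFull) rfl ?_
    simp [Code.allFull, Ends]
  | cons z p ih =>
    refine .of_wp (e := Code.allFull) rfl ?_
    simp [Code.allFull, -List.mem_cons]
    refine .of_call (call_room_set z k) ?_
    by_cases h : k ≤ z.card
    · rw [Nat.sub_eq_zero_of_le h]
      simp
      exact .of_call ih ⟨by simp [h], by simp; linarith⟩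
    · obtain ⟨d, hd⟩ := Nat.exists_eq_succ_of_ne_zero (Nat.sub_ne_zero_of_lt (not_le.1 h))
      have hz : decide (∀ w ∈ z :: p, k ≤ w.card) = false := by simp [h]
      rw [hd, Nat.succ_eq_add_one, unary_succ, branch_cons, hz]
      exact ⟨rfl, by simp; nlinarith⟩

/-- The union of the rows that are selected by a 0-1-vector, and of `X`. -/
def unionRows : List (Finset (Fin N)) → List Bool → Finset (Fin N) → Finset (Fin N)
  | R :: l, b :: bs, X => unionRows l bs (if b then X ∪ R else X)
  | _, _, X => X

theorem mem_unionRows {l : List (Finset (Fin N))} {bs : List Bool} {X : Finset (Fin N)}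
    {v : Fin N} : v ∈ unionRows l bs X ↔
      v ∈ X ∨ ∃ i : ℕ, bs[i]? = some true ∧ ∃ R, l[i]? = some R ∧ v ∈ R := by
  induction l generalizing bs X with
  | nil => simp [unionRows]
  | cons R l ih =>
    cases bs with
    | nil => simp [unionRows]
    | cons b bs =>
      rw [unionRows, ih]
      constructor
      · rintro (h | ⟨i, h⟩)
        · cases b
          · exact .inl (by simpa using h)
          · rcases (by simpa using h : v ∈ X ∨ v ∈ R) with h | h
            · exact .inl h
            · exact .inr ⟨0, by simpa using h⟩
        · exact .inr ⟨i + 1, by simpa using h⟩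
      · rintro (h | ⟨_ | i, h₁, h₂⟩)
        · exact .inl (by cases b <;> simp [h])
        · obtain rfl : b = true := by simpa using h₁
          exact .inl (by simpa using Or.inr h₂)
        · exact .inr ⟨i, by simpa using h₁, by simpa using h₂⟩

theorem call_rows (l : List (Finset (Fin N))) (bs : List Bool) (h : bs.length = l.length)
    (X : Finset (Fin N)) :
    Calls Code.iRows (lst [encList encSet l, encBits bs, encSet X]) (encSet (unionRows l bs X))
      (l.length * (N + 2) + 1) := by
  induction l generalizing bs X with
  | nil =>
    refine .of_wp (e := Code.rows) rfl ?_
    simp [Code.rows, Ends, unionRows]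
  | cons R l ih =>
    obtain _ | ⟨b, bs⟩ := bs
    · simp at h
    refine .of_wp (e := Code.rows) rfl ?_
    have ih := fun X => ih bs (by simpa using h) X
    cases b <;> simp [Code.rows, Code.union, Code.bitop]
    · exact .of_call (ih X) ⟨by simp [unionRows], by linarith⟩
    · exact .of_call (call_union X R) (.of_call (ih _) ⟨by simp [unionRows], by simp; nlinarith⟩)

theorem call_preceding_rows (l : List (Finset (Fin N))) (B : Finset (Fin N)) :
    Calls Code.iPreceding (lst [encList encSet l, encSet B])
      (encBits (l.map fun R => decide (R ∩ B ≠ ∅))) (l.length * (2 * N + 3) + 1) := by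
  induction l with
  | nil =>
    refine .of_wp (e := Code.preceding) rfl ?_
    simp [Code.preceding, Ends]
  | cons R l ih =>
    refine .of_wp (e := Code.preceding) rfl ?_
    simp [Code.preceding, Code.inter, Code.bitop]
    refine .of_call (call_inter R B) (.of_call (call_nonempty _) (.of_call ih ⟨by simp, ?_⟩))
    simp
    nlinarith

/-- The successors of a job. -/
def row (R : Fin N → Fin N → Bool) (i : Fin N) : Finset (Fin N) := univ.filter fun j => R i j = true

/-- The matrix of a relation as a tree. -/
def encMatrix (R : Fin N → Fin N → Bool) : SExp := encList encSet (List.ofFn (row R))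

theorem call_rows_matrix (R : Fin N → Fin N → Bool) (X Y : Finset (Fin N)) :
    Calls Code.iRows (lst [encMatrix R, encSet X, encSet Y])
      (encSet (Y ∪ univ.filter fun v => ∃ i ∈ X, R i v = true)) (N * (N + 2) + 1) := by
  have := call_rows (List.ofFn (row R)) (bits X) (by simp) Y
  rw [List.length_ofFn] at this
  suffices h : (Y ∪ univ.filter fun v => ∃ i ∈ X, R i v = true) =
      unionRows (List.ofFn (row R)) (bits X) Y by rwa [h]
  ext v
  rw [mem_unionRows]
  simp only [mem_union, mem_filter, mem_univ, true_and]
  refine or_congr_right ⟨?_, ?_⟩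
  · rintro ⟨i, hi, h⟩
    exact ⟨i, by simp [bits, hi], row R i, by simp, by simpa [row] using h⟩
  · rintro ⟨i, hi, R', hR, h⟩
    have hiN : i < N := by
      by_contra hcon
      simp [bits, hcon] at hi
    refine ⟨⟨i, hiN⟩, ?_, ?_⟩
    · simpa [bits, hiN] using hi
    · simp only [List.getElem?_ofFn, hiN, dite_true, Option.some.injEq] at hR
      subst hR
      simpa [row] using h

theorem call_preceding (R : Fin N → Fin N → Bool) (B : Finset (Fin N)) :
    Calls Code.iPreceding (lst [encMatrix R, encSet B])
      (encSet (univ.filter fun v => ∃ j ∈ B, R v j = true)) (N * (2 * N + 3) + 1) := by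
  have := call_preceding_rows (List.ofFn (row R)) B
  rw [List.length_ofFn, List.map_ofFn] at this
  suffices h : bits (univ.filter fun v => ∃ j ∈ B, R v j = true) =
      List.ofFn ((fun R => decide (R ∩ B ≠ ∅)) ∘ row R) by
    rwa [encSet_eq (univ.filter _), h]
  refine congrArg List.ofFn (funext fun v => ?_)
  simp only [mem_filter, mem_univ, true_and, Function.comp_apply]
  rw [Bool.eq_iff_iff, decide_eq_true_iff, decide_eq_true_iff, ← nonempty_iff_ne_empty]
  constructor
  · rintro ⟨j, hj, h⟩
    exact ⟨j, by simp [row, hj, h]⟩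
  · rintro ⟨j, hj⟩
    simp only [row, mem_inter, mem_filter, mem_univ, true_and] at hj
    exact ⟨j, hj.2, hj.1⟩

end

/-! ### The functions for the dynamic program -/

theorem Branch.decide {p : Prop} [Decidable p] {A B : Prop} (h : p → A) (h' : ¬p → B) :
    Branch (encBool (decide p)) A B := by
  by_cases hp : p <;> simp [hp, h, h']

/-- A partial schedule as a tree. -/
abbrev encPiece {N : ℕ} (p : Piece N) : SExp := encList encSet p

theorem Branch.piece {N : ℕ} {p : Piece N} {A B : Prop} (h : p ≠ [] → A) (h' : p = [] → B) :
    Branch (encPiece p) A B := by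
  cases p <;> simp_all

/-- The time unit for operations on sets. -/
def unit (N : ℕ) : ℕ := (N + 2) * (N + 2)

theorem le_unit (N : ℕ) : N + 2 ≤ unit N := by unfold unit; nlinarith

section

variable {N : ℕ}

theorem call_jobs_le (p : Piece N) (X : Finset (Fin N)) (hp : p.length ≤ 2 * N + 2) :
    Calls Code.iJobs (lst [encPiece p, encSet X]) (encSet (X ∪ jobs p)) (2 * unit N) := by
  refine (call_jobs p X).mono ?_
  have := Nat.mul_le_mul_right (N + 2) hp
  unfold unit
  nlinarith

theorem call_allFull_le (p : Piece N) (k : ℕ) (hp : p.length ≤ 2 * N + 2) :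
    Calls Code.iAllFull (lst [encPiece p, unary k])
      (encBool (decide (∀ z ∈ p, k ≤ z.card))) (2 * unit N) := by
  refine (call_allFull p k).mono ?_
  have := Nat.mul_le_mul_right (N + 2) hp
  unfold unit
  nlinarith

theorem call_rows_le (R : Fin N → Fin N → Bool) (X Y : Finset (Fin N)) :
    Calls Code.iRows (lst [encMatrix R, encSet X, encSet Y])
      (encSet (Y ∪ univ.filter fun v => ∃ i ∈ X, R i v = true)) (unit N) :=
  (call_rows_matrix R X Y).mono (by unfold unit; nlinarith)

theorem call_preceding_le (R : Fin N → Fin N → Bool) (B : Finset (Fin N)) :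
    Calls Code.iPreceding (lst [encMatrix R, encSet B])
      (encSet (univ.filter fun v => ∃ j ∈ B, R v j = true)) (2 * unit N) :=
  (call_preceding R B).mono (by unfold unit; nlinarith)

theorem call_revApp_piece (p q : Piece N) :
    Calls Code.iRevApp (lst [encPiece p, encPiece q]) (encPiece (p.reverse ++ q)) (p.length + 1) := by
  have := call_revApp (p.map encSet) (q.map encSet)
  simpa only [encPiece, encList_eq_lst, ← List.map_reverse, ← List.map_append,
    List.length_map] using this

end

attribute [simp] Code.inter Code.union Code.diff Code.zeros Code.compl Code.bitop Code.sub
  Code.matrixOf Code.machinesOf Code.coverOf Code.subsetsOf Code.revCoverOf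

namespace Ctx

variable {N : ℕ} (G : Ctx N)

/-- The data of the dynamic program as a tree. -/
def enc : SExp :=
  lst [encMatrix G.R, unary G.m, encSet G.C, encPiece G.subs, encBits (bits G.C).reverse]

theorem call_blocked (X : Finset (Fin N)) :
    Calls Code.iBlocked (lst [G.enc, encSet X]) (encSet (G.blocked X)) (4 * unit N) := by
  have h₁ := call_rows_le G.R (G.C \ X) ∅
  have := le_unit N
  refine .of_wp (e := Code.blocked) rfl ?_
  simp [Code.blocked, enc]
  refine .of_call (call_diff _ _) (.of_call (call_zeros X) (.of_call h₁ ⟨?_, by omega⟩))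
  rw [empty_union, blocked]

theorem call_forced (A U B : Finset (Fin N)) :
    Calls Code.iForced (lst [G.enc, encSet A, encSet U, encSet B]) (encSet (G.forced A U B))
      (14 * unit N) := by
  have h₁ := G.call_blocked A
  have h₂ := G.call_blocked U
  have h₃ := call_preceding_le G.R B
  have := le_unit N
  refine .of_wp (e := Code.forced) rfl ?_
  simp [Code.forced]
  refine .of_call h₁ ?_
  simp [enc]
  refine .of_call h₃ (.of_call (call_inter _ _) ?_)
  refine .of_call h₂ ?_
  exact .of_call (call_diff _ _) (.of_call (call_diff _ _) ⟨rfl, by omega⟩)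

theorem call_clear (W B : Finset (Fin N)) :
    Calls Code.iClear (lst [G.enc, encSet W, encSet B]) (encBool (decide (G.Clear W B)))
      (11 * unit N) := by
  have h₁ := G.call_blocked W
  have h₃ := call_preceding_le G.R B
  have := le_unit N
  generalize hv : encBool (decide (G.Clear W B)) = v
  refine .of_wp (e := Code.clear) rfl ?_
  simp [Code.clear]
  refine .of_call h₁ ?_
  simp [enc]
  refine .of_call h₃ (.of_call (call_inter _ _) ?_)
  refine .of_call (call_diff _ _) (.of_call (call_nonempty _) ?_)
  refine .decide (fun h => ⟨?_, by omega⟩) (fun h => ⟨?_, by omega⟩)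
  · rw [← hv, decide_eq_false (show ¬G.Clear W B from h)]; rfl
  · rw [← hv, decide_eq_true (show G.Clear W B from not_not.1 h)]; rfl

/-- Room is computed for `m + 1` jobs, so that it is nonzero exactly when at most `m` are present.
Only the truth value matters, hence the existential value. -/
theorem call_slotOK (U U' : Finset (Fin N)) :
    ∃ y, Calls Code.iSlotOK (lst [G.enc, encSet U, encSet U']) y (11 * unit N) ∧
      (y = .nil ↔ ¬G.SlotOK U U') := by
  have h₁ := G.call_blocked U
  have h₂ := call_room_set (U' \ U) (G.m + 1)
  have := le_unit N
  refine ⟨if (U' \ U) ∩ G.blocked U = ∅ then unary (G.m + 1 - (U' \ U).card) else .nil, ?_, ?_⟩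
  · refine .of_wp (e := Code.slotOK) rfl ?_
    simp [Code.slotOK]
    refine .of_call (call_diff _ _) (.of_call h₁ (.of_call (call_inter _ _)
      (.of_call (call_nonempty _) ?_)))
    refine .decide (fun h => ⟨?_, by omega⟩) fun h => ?_
    · rw [if_neg h]
    · refine .of_call (call_diff _ _) ?_
      simp [enc]
      exact .of_call h₂ ⟨by rw [if_pos (not_not.1 h)], by omega⟩
  · split_ifs with h
    · rw [SlotOK, and_iff_right h, unary_eq_lst]
      rcases hk : G.m + 1 - (U' \ U).card with _ | k
      · simp; omega
      · simp [List.replicate_succ]; omega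
    · simp [SlotOK, h]

theorem call_done (p : Piece N) (hp : p.length ≤ 2 * N + 2) (A U B : Finset (Fin N)) :
    Calls Code.iDone (lst [G.enc, encPiece p, encSet A, encSet U, encSet B])
      (encBool (decide (G.forced A U B ⊆ jobs p))) (20 * unit N) := by
  have h₁ := G.call_forced A U B
  have h₂ := call_jobs_le p ∅ hp
  rw [empty_union] at h₂
  have := le_unit N
  refine .of_wp (e := Code.done) rfl ?_
  simp [Code.done]
  exact .of_call h₁ (.of_call (call_zeros A) (.of_call h₂ (.of_call (call_sub _ _)
    ⟨rfl, by omega⟩)))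

/-- A tree represents a table. -/
def Represents (tab : SExp) (τ : Tab N) : Prop :=
  ∀ ⦃A A' U U' c B : Finset (Fin N)⦄, A ⊆ A' → A' ⊆ U → U ⊆ U' → U' ⊆ c → c ⊆ B → B ⊆ G.C →
    Calls Code.iLook (lst [tab, encSet A, encSet A', encSet U, encSet U', encSet c, encSet B])
      (encPiece (τ A A' U U' c B)) (unit N) ∧ (τ A A' U U' c B).length ≤ N

variable {G}

theorem Represents.length_get {tab : SExp} {τ : Tab N} (h : G.Represents tab τ)
    {A A' U U' c B : Finset (Fin N)} (hB : B ⊆ G.C) : (get τ A A' U U' c B).length ≤ N := by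
  unfold get
  split_ifs with hc
  · exact (h hc.1 hc.2.1 hc.2.2.1 hc.2.2.2.1 hc.2.2.2.2 hB).2
  · simp

/-- The searched sets run through all subsets of the cover, whereas a stored tree is meaningful on
chains only; the inclusion tests keep `look` away from anything else. -/
theorem Represents.call_get {tab : SExp} {τ : Tab N} (h : G.Represents tab τ)
    {A A' U U' c B : Finset (Fin N)} (hB : B ⊆ G.C) :
    Calls Code.iGet (lst [tab, encSet A, encSet A', encSet U, encSet U', encSet c, encSet B])
      (encPiece (get τ A A' U U' c B)) (12 * unit N) := by
  have := le_unit N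
  refine .of_wp (e := Code.get) rfl ?_
  simp [Code.get]
  refine .of_call (call_sub _ _) (.decide (fun h₁ => ?_) fun h₁ => ⟨by simp [get, h₁], by omega⟩)
  refine .of_call (call_sub _ _) (.decide (fun h₂ => ?_) fun h₁ => ⟨by simp [get, h₁], by omega⟩)
  refine .of_call (call_sub _ _) (.decide (fun h₃ => ?_) fun h₁ => ⟨by simp [get, h₁], by omega⟩)
  refine .of_call (call_sub _ _) (.decide (fun h₄ => ?_) fun h₁ => ⟨by simp [get, h₁], by omega⟩)
  refine .of_call (call_sub _ _) (.decide (fun h₅ => ?_) fun h₁ => ⟨by simp [get, h₁], by omega⟩)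
  exact .of_call (h h₁ h₂ h₃ h₄ h₅ hB).1 ⟨by simp [get, *], by omega⟩

theorem length_closeAfter {tab : SExp} {τ : Tab N} (h : G.Represents tab τ)
    {V V' U U' W : Finset (Fin N)} (hC : U' ⊆ G.C) :
    (G.closeAfter τ V V' U U' W).length ≤ N + 1 := by
  unfold closeAfter
  dsimp only
  split_ifs
  · simpa using h.length_get hC
  · simp

theorem call_closeAfter {tab : SExp} {τ : Tab N} (h : G.Represents tab τ)
    {V V' U U' : Finset (Fin N)} (W : Finset (Fin N)) (hC : U' ⊆ G.C) :
    Calls Code.iCloseAfter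
      (lst [encSet W, G.enc, tab, encSet V, encSet V', encSet U, encSet U'])
      (encPiece (G.closeAfter τ V V' U U' W)) (45 * unit N) := by
  have := le_unit N
  have hl := h.length_get (A := V) (A' := V') (U := W) (U' := U) (c := U) hC
  have hd := G.call_done (get τ V V' W U U U') (by omega) V W U'
  refine .of_wp (e := Code.closeAfter) rfl ?_
  simp [Code.closeAfter]
  refine .of_call (h.call_get hC) (.piece (fun h₁ => ?_) fun h₁ => ⟨by simp [closeAfter, h₁], by omega⟩)
  refine .of_call hd (.decide (fun h₂ => ?_) fun h₂ => ⟨by simp [closeAfter, h₂], by omega⟩)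
  refine .of_call (G.call_clear _ _) (.decide (fun h₃ => ?_) fun h₃ => ⟨?_, by omega⟩)
  · refine .of_call (call_diff _ _) ⟨?_, by omega⟩
    have : G.closeAfter τ V V' U U' W = (U' \ U) :: get τ V V' W U U U' := if_pos ⟨h₁, h₂, h₃⟩
    rw [this]
    rfl
  · have : G.closeAfter τ V V' U U' W = [] := if_neg fun h => h₃ h.2.2
    rw [this]
    rfl

theorem call_search {α : Type} (tag env : SExp) (en : α → SExp) (f : α → Piece N) (l : List α)
    (c : ℕ) (h : ∀ a ∈ l, Calls Code.iDispatch (lst [tag, en a, env]) (encPiece (f a)) c) :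
    Calls Code.iSearch (lst [tag, encList en l, env]) (encPiece (firstNonempty f l))
      (l.length * (c + 1) + 1) := by
  induction l with
  | nil =>
    refine .of_wp (e := Code.search) rfl ?_
    simp [Code.search, Ends, firstNonempty]
  | cons a l ih =>
    refine .of_wp (e := Code.search) rfl ?_
    simp [Code.search]
    refine .of_call (h a (by simp)) (.piece (fun h₁ => ⟨?_, by nlinarith⟩) fun h₁ => ?_)
    · rw [firstNonempty, if_pos h₁]
    · refine .of_call (ih fun b hb => h b (by simp [hb])) ⟨?_, by nlinarith⟩
      rw [firstNonempty, if_neg (not_not.2 h₁)]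

variable (G) in
/-- The trees of a list represent the tables of a list. -/
abbrev RepresentsAll (l : List SExp) (tabs : List (Tab N)) : Prop :=
  List.Forall₂ G.Represents l tabs

theorem length_firstNonempty_le {α β : Type} {f : α → List β} {l : List α} {k : ℕ}
    (h : ∀ a ∈ l, (f a).length ≤ k) : (firstNonempty f l).length ≤ k := by
  induction l with
  | nil => simp [firstNonempty]
  | cons a l ih =>
    rw [firstNonempty]
    split_ifs
    · exact h a (by simp)
    · exact ih fun b hb => h b (by simp [hb])

theorem closeAt_of_not {tabs : List (Tab N)} {V V' U U' : Finset (Fin N)} (h : ¬G.SlotOK U U') :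
    G.closeAt tabs V V' U U' = [] := by
  unfold closeAt
  exact if_neg h

theorem closeAt_nil {V V' U U' : Finset (Fin N)} (h : G.SlotOK U U') :
    G.closeAt [] V V' U U' = if V' ⊆ U ∧ U ⊆ V' ∧ G.Clear V U' then [U' \ U] else [] := by
  unfold closeAt
  exact if_pos h

theorem closeAt_cons {τ : Tab N} {tabs : List (Tab N)} {V V' U U' : Finset (Fin N)}
    (h : G.SlotOK U U') :
    G.closeAt (τ :: tabs) V V' U U' = firstNonempty (G.closeAfter τ V V' U U') G.subs := by
  unfold closeAt
  exact if_pos h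

theorem length_closeAt {l : List SExp} {tabs : List (Tab N)} (h : G.RepresentsAll l tabs)
    {V V' U U' : Finset (Fin N)} (hC : U' ⊆ G.C) : (G.closeAt tabs V V' U U').length ≤ N + 1 := by
  by_cases hs : G.SlotOK U U'
  · cases h with
    | nil => rw [closeAt_nil hs]; split_ifs <;> simp
    | cons h _ =>
      rw [closeAt_cons hs]
      exact length_firstNonempty_le fun W _ => length_closeAfter h hC
  · simp [closeAt_of_not hs]

theorem call_closeAt {l : List SExp} {tabs : List (Tab N)} (h : G.RepresentsAll l tabs)
    {V V' U U' : Finset (Fin N)} (hC : U' ⊆ G.C) :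
    Calls Code.iCloseAt (lst [G.enc, lst l, encSet V, encSet V', encSet U, encSet U'])
      (encPiece (G.closeAt tabs V V' U U')) ((G.subs.length + 1) * (50 * unit N)) := by
  have hu := le_unit N
  obtain ⟨y, hy, hy'⟩ := G.call_slotOK U U'
  refine .of_wp (e := Code.closeAt) rfl ?_
  simp [Code.closeAt]
  refine .of_call hy ⟨fun h₁ => ?_, fun h₁ => ⟨by rw [closeAt_of_not (hy'.1 h₁)]; rfl, by nlinarith⟩⟩
  have h₁ := not_not.1 (mt hy'.2 h₁)
  cases h with
  | nil =>
    simp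
    have hn : ¬(V' ⊆ U ∧ U ⊆ V' ∧ G.Clear V U') → G.closeAt [] V V' U U' = [] := fun hn => by
      rw [closeAt_nil h₁]
      exact if_neg hn
    refine .of_call (call_sub _ _) (.decide (fun h₂ => ?_)
      fun h₂ => ⟨by rw [hn fun h => h₂ h.1]; rfl, by nlinarith⟩)
    refine .of_call (call_sub _ _) (.decide (fun h₃ => ?_)
      fun h₃ => ⟨by rw [hn fun h => h₃ h.2.1]; rfl, by nlinarith⟩)
    refine .of_call (G.call_clear _ _) (.decide (fun h₄ => ?_)
      fun h₄ => ⟨by rw [hn fun h => h₄ h.2.2]; rfl, by nlinarith⟩)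
    refine .of_call (call_diff _ _) ⟨?_, by nlinarith⟩
    rw [closeAt_nil h₁, if_pos ⟨h₂, h₃, h₄⟩]
    rfl
  | @cons tab τ l' tabs' ht _ =>
    simp
    rw [enc]
    simp [Code.tag]
    refine .of_call (call_search _ _ encSet (G.closeAfter τ V V' U U') _ (46 * unit N) ?_)
      ⟨?_, by nlinarith⟩
    · intro W _
      refine .of_wp (e := Code.dispatch) rfl ?_
      simp [Code.dispatch]
      exact .of_call (call_closeAfter ht W hC) ⟨rfl, by omega⟩
    · rw [closeAt_cons h₁]

theorem length_segment {l : List SExp} {tabs : List (Tab N)} (h : G.RepresentsAll l tabs)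
    {V V' U U' c : Finset (Fin N)} (hc : c ⊆ G.C) (hU : U' ⊆ G.C) :
    (G.segment tabs V V' U U' c).length ≤ N + 1 := by
  cases h with
  | nil => simp [segment]
  | @cons tab τ l' tabs' ht htt =>
    have := ht.length_get (A := V) (A' := V') (U := U) (U' := U') (c := U') hc
    unfold segment
    dsimp only
    split_ifs
    · exact length_closeAt htt hU
    · omega
    · simp

theorem call_segment {l : List SExp} {tabs : List (Tab N)} (h : G.RepresentsAll l tabs)
    {V V' U U' c : Finset (Fin N)} (hc : c ⊆ G.C) (hU : U' ⊆ G.C) :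
    Calls Code.iSegment (lst [G.enc, lst l, encSet V, encSet V', encSet U, encSet U', encSet c])
      (encPiece (G.segment tabs V V' U U' c)) ((G.subs.length + 1) * (60 * unit N)) := by
  have hu := le_unit N
  refine .of_wp (e := Code.segment) rfl ?_
  simp [Code.segment]
  cases h with
  | nil => simp [segment, Ends]; nlinarith
  | @cons tab τ l' tabs' ht htt =>
    have hl := ht.length_get (A := V) (A' := V') (U := U) (U' := U') (c := U') hc
    simp
    refine .of_call (call_sub _ _) (.decide (fun h₁ => ?_) fun h₁ => ?_)
    · exact .of_call (call_closeAt htt hU) ⟨by simp [segment, h₁], by nlinarith⟩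
    · have hs : G.segment (τ :: tabs') V V' U U' c = if G.forced V U c ⊆
          jobs (get τ V V' U U' U' c) then get τ V V' U U' U' c else [] := if_neg h₁
      refine .of_call (ht.call_get hc) (.of_call (G.call_done _ (by omega) _ _ _)
        (.decide (fun h₂ => ?_) fun h₂ => ⟨?_, by nlinarith⟩))
      · rw [hs, if_pos h₂]
        exact ⟨rfl, by nlinarith⟩
      · rw [hs, if_neg h₂]
        rfl

theorem length_glue {tab : SExp} {τ : Tab N} (ht : G.Represents tab τ) {l : List SExp}
    {fwd : List (Tab N)} (h : G.RepresentsAll l fwd) {A A' U U' c B : Finset (Fin N)}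
    (V V' : Finset (Fin N)) (hB : B ⊆ G.C) (hc : c ⊆ G.C) (hU : U' ⊆ G.C) :
    (G.glue τ fwd A A' U U' c B V V').length ≤ 2 * N + 1 := by
  have := ht.length_get (A := A) (A' := A') (U := V) (U' := V') (c := c) hB
  have := length_segment h (V := V) (V' := V') (U := U) hc hU
  unfold glue
  dsimp only
  split_ifs
  · simp; omega
  · simp

theorem call_glue {tab : SExp} {τ : Tab N} (ht : G.Represents tab τ) {l : List SExp}
    {fwd : List (Tab N)} (h : G.RepresentsAll l fwd) {A A' U U' c B : Finset (Fin N)}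
    (V V' : Finset (Fin N)) (hB : B ⊆ G.C) (hc : c ⊆ G.C) (hU : U' ⊆ G.C) :
    Calls Code.iGlue (lst [encSet V', encSet V, tab, lst l, G.enc, encSet A, encSet A', encSet U,
      encSet U', encSet c, encSet B]) (encPiece (G.glue τ fwd A A' U U' c B V V'))
      ((G.subs.length + 1) * (80 * unit N)) := by
  have hu := le_unit N
  have hl₁ := ht.length_get (A := A) (A' := A') (U := V) (U' := V') (c := c) hB
  have hl₂ := length_segment h (V := V) (V' := V') (U := U) hc hU
  have hn : ∀ h, G.glue τ fwd A A' U U' c B V V' = [] := fun h => if_neg h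
  have hp : ∀ h, G.glue τ fwd A A' U U' c B V V' = _ := fun h => if_pos h
  refine .of_wp (e := Code.glue) rfl ?_
  simp [Code.glue]
  refine .of_call (ht.call_get hB) (.piece (fun h₁ => ?_)
    fun h₁ => ⟨by rw [hn fun h => h.1 h₁]; rfl, by nlinarith⟩)
  have e : G.enc.tl.hd = unary G.m := rfl
  rw [e]
  refine .of_call (call_allFull_le _ _ (by omega)) (.decide (fun h₂ => ?_)
    fun h₂ => ⟨by rw [hn fun h => h₂ h.2.1]; rfl, by nlinarith⟩)
  refine .of_call (call_segment h hc hU) (.piece (fun h₃ => ?_)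
    fun h₃ => ⟨by rw [hn fun h => h.2.2.1 h₃]; rfl, by nlinarith⟩)
  have e' : (encPiece (G.segment fwd V V' U U' c)).tl =
      encPiece (G.segment fwd V V' U U' c).tail := by
    obtain ⟨z, zs, hz⟩ := List.exists_cons_of_ne_nil h₃
    rw [hz]; rfl
  rw [e']
  refine .of_call (call_allFull_le _ _ (by simp; omega)) (.decide (fun h₄ => ?_)
    fun h₄ => ⟨by rw [hn fun h => h₄ h.2.2.2]; rfl, by nlinarith⟩)
  refine .of_call (call_revApp_piece _ []) (.of_call (call_revApp_piece _ _) ⟨?_, ?_⟩)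
  · rw [hp ⟨h₁, h₂, h₃, h₄⟩]
    simp
  · simp
    nlinarith

theorem length_split {l : List SExp} {rev : List (Tab N)} (hr : G.RepresentsAll l rev)
    {l' : List SExp} {fwd : List (Tab N)} (h : G.RepresentsAll l' fwd)
    {A A' U U' c B : Finset (Fin N)} (hB : B ⊆ G.C) (hc : c ⊆ G.C) (hU : U' ⊆ G.C) :
    (G.split rev fwd A A' U U' c B).length ≤ 2 * N + 1 := by
  induction hr generalizing l' fwd with
  | nil => simp [split]
  | cons ht hr ih =>
    unfold split
    dsimp only
    split_ifs
    · exact length_firstNonempty_le fun V _ => length_firstNonempty_le fun V' _ =>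
        length_glue ht h V V' hB hc hU
    · refine ih (l' := l'.tail) ?_
      cases h with
      | nil => exact .nil
      | cons _ h => exact h

theorem tl_lst (l : List SExp) : (lst l).tl = lst l.tail := by cases l <;> rfl

/-- The cube comes from three nested searches: over `V`, over `V'`, and over `W` inside the segment.
The first factor is the number of cut positions. -/
theorem call_split {l : List SExp} {rev : List (Tab N)} (hr : G.RepresentsAll l rev)
    {l' : List SExp} {fwd : List (Tab N)} (h : G.RepresentsAll l' fwd)
    {A A' U U' c B : Finset (Fin N)} (hB : B ⊆ G.C) (hc : c ⊆ G.C) (hU : U' ⊆ G.C) :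
    Calls Code.iSplit (lst [lst l, lst l', G.enc, encSet A, encSet A', encSet U, encSet U',
      encSet c, encSet B]) (encPiece (G.split rev fwd A A' U U' c B))
      (rev.length * ((G.subs.length + 1) ^ 3 * (85 * unit N)) + 1) := by
  have hu := le_unit N
  induction hr generalizing l' fwd with
  | nil =>
    refine .of_wp (e := Code.split) rfl ?_
    simp [Code.split, Ends, split]
  | @cons tab τ l rev ht hr ih =>
    refine .of_wp (e := Code.split) rfl ?_
    simp [Code.split]
    have e : G.enc.tl.tl.tl.hd = encPiece G.subs := rfl
    rw [e]
    have h₁ : ∀ V V', Calls Code.iDispatch (lst [lst [.nil], encSet V', lst [encSet V, tab, lst l',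
        G.enc, encSet A, encSet A', encSet U, encSet U', encSet c, encSet B]])
        (encPiece (G.glue τ fwd A A' U U' c B V V')) ((G.subs.length + 1) * (81 * unit N)) := by
      intro V V'
      refine .of_wp (e := Code.dispatch) rfl ?_
      simp [Code.dispatch]
      exact .of_call (call_glue ht h V V' hB hc hU) ⟨rfl, by nlinarith⟩
    have h₂ : ∀ V, Calls Code.iDispatch (lst [lst [lst [.nil]], encSet V, lst [tab, lst l',
        G.enc, encSet A, encSet A', encSet U, encSet U', encSet c, encSet B]])
        (encPiece (firstNonempty (G.glue τ fwd A A' U U' c B V) G.subs))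
        ((G.subs.length + 1) ^ 2 * (83 * unit N)) := by
      intro V
      refine .of_wp (e := Code.dispatch) rfl ?_
      simp [Code.dispatch, Code.tag]
      rw [e]
      exact .of_call (call_search _ _ encSet _ G.subs _ fun V' _ => h₁ V V') ⟨rfl, by nlinarith⟩
    have h₃ := call_search _ _ encSet _ G.subs _ fun V _ => h₂ V
    have hcost : G.subs.length * ((G.subs.length + 1) ^ 2 * (83 * unit N) + 1) + 1 + 1 ≤
        (G.subs.length + 1) ^ 3 * (85 * unit N) := by
      generalize G.subs.length = s
      have h₁ : 1 ≤ (s + 1) ^ 2 := Nat.one_le_pow _ _ (by omega)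
      rw [pow_succ (s + 1) 2]
      generalize (s + 1) ^ 2 = q at *
      have h₂ : 2 ≤ q * unit N := by nlinarith
      have h₃ := Nat.mul_le_mul_right (s + 1) h₂
      nlinarith
    generalize (G.subs.length + 1) ^ 3 * (85 * unit N) = K at *
    generalize G.subs.length * ((G.subs.length + 1) ^ 2 * (83 * unit N) + 1) + 1 = D at *
    simp [Code.tag]
    refine .of_call h₃ (.piece (fun h₄ => ⟨?_, by nlinarith⟩) fun h₄ => ?_)
    · exact congrArg encPiece (if_pos h₄ : G.split (τ :: rev) fwd A A' U U' c B = _).symm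
    · have hf : G.RepresentsAll l'.tail fwd.tail := by
        cases h with
        | nil => exact .nil
        | cons _ h => exact h
      rw [tl_lst]
      refine .of_call (ih hf) ⟨?_, by nlinarith⟩
      exact congrArg encPiece
        (if_neg (not_not.2 h₄) : G.split (τ :: rev) fwd A A' U U' c B = _).symm

theorem length_fill (A U B : Finset (Fin N)) (p : Piece N) :
    (G.fill A U B p).length = p.length := by
  cases p <;> rfl

theorem call_fill (A U B : Finset (Fin N)) (p : Piece N) (hp : p.length ≤ 2 * N + 2) :
    Calls Code.iFill (lst [G.enc, encSet A, encSet U, encSet B, encPiece p])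
      (encPiece (G.fill A U B p)) (25 * unit N) := by
  have hu := le_unit N
  refine .of_wp (e := Code.fill) rfl ?_
  simp [Code.fill]
  cases p with
  | nil => simp [fill, Ends]; omega
  | cons z zs =>
    have hj := call_jobs_le (z :: zs) ∅ hp
    rw [empty_union] at hj
    have e : G.enc.tl.hd = unary G.m := rfl
    simp
    rw [e]
    refine .of_call (G.call_forced A U B) (.of_call (call_zeros A) (.of_call hj
      (.of_call (call_diff _ _) (.of_call (call_room_set z _) (.of_call (call_firstElems _ _)
        (.of_call (call_union _ _) ⟨?_, by omega⟩))))))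
    simp [fill]

theorem length_extend {l : List SExp} {tabs : List (Tab N)} (h : G.RepresentsAll l tabs)
    {p : Piece N} (hp : p.length ≤ 2 * N + 2)
    {A A' U U' c B : Finset (Fin N)} (hB : B ⊆ G.C) (hc : c ⊆ G.C) (hU : U' ⊆ G.C) :
    (G.extend tabs p A A' U U' c B).length ≤ 2 * N + 2 := by
  rw [extend, length_fill]
  split_ifs
  · exact hp
  · exact (length_split (List.rel_reverse h) h hB hc hU).trans (by omega)

theorem call_extend {l : List SExp} {tabs : List (Tab N)} (h : G.RepresentsAll l tabs)
    (htabs : tabs.length ≤ N) {p : Piece N} (hp : p.length ≤ 2 * N + 2)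
    {A A' U U' c B : Finset (Fin N)} (hB : B ⊆ G.C) (hc : c ⊆ G.C) (hU : U' ⊆ G.C) :
    Calls Code.iExtend (lst [encPiece p, lst l, G.enc, encSet A, encSet A', encSet U, encSet U',
      encSet c, encSet B]) (encPiece (G.extend tabs p A A' U U' c B))
      ((N + 1) * ((G.subs.length + 1) ^ 3 * (85 * unit N)) + 30 * unit N) := by
  have hu := le_unit N
  have hrev := call_revApp l []
  have hl : l.length = tabs.length := h.length_eq
  have hs := call_split (List.rel_reverse h) h (A := A) (A' := A') (U := U) hB hc hU
  have hsl := length_split (List.rel_reverse h) h (A := A) (A' := A') (U := U) hB hc hU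
  rw [List.length_reverse] at hs
  have hN := Nat.mul_le_mul_right ((G.subs.length + 1) ^ 3 * (85 * unit N)) htabs
  generalize (G.subs.length + 1) ^ 3 * (85 * unit N) = K at *
  have hlen := G.length_extend h hp (A := A) (A' := A') (U := U) hB hc hU
  have hn : ∀ h, G.extend tabs p A A' U U' c B = _ := fun h => congrArg (G.fill A U B) (if_neg h)
  have hy : ∀ h, G.extend tabs p A A' U U' c B = _ := fun h => congrArg (G.fill A U B) (if_pos h)
  have hNK : (N + 1) * K = N * K + K := by ring
  refine .of_wp (e := Code.extend) rfl ?_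
  simp [Code.extend]
  refine .piece (fun h₁ => ?_) fun h₁ => ?_
  · have e : G.enc.tl.hd = unary G.m := rfl
    have e' : (encPiece p).tl = encPiece p.tail := by
      obtain ⟨z, zs, rfl⟩ := List.exists_cons_of_ne_nil h₁
      rfl
    rw [e, e']
    refine .of_call (call_allFull_le _ _ (by simp; omega)) (.decide (fun h₂ => ?_) fun h₂ => ?_)
    · refine .of_call (G.call_fill A U B p hp) ⟨?_, by omega⟩
      rw [hy ⟨h₁, h₂⟩]
    · rw [List.append_nil] at hrev
      refine .of_call hrev (.of_call hs (.of_call (G.call_fill A U B _ (by omega)) ⟨?_, by omega⟩))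
      rw [hn fun h => h₂ h.2]
  · rw [List.append_nil] at hrev
    refine .of_call hrev (.of_call hs (.of_call (G.call_fill A U B _ (by omega)) ⟨?_, by omega⟩))
    rw [hn fun h => h.1 h₁]

variable (G) in
/-- A bound on the number of function calls for one entry of a table. -/
def entryCost : ℕ := (N + 1) * ((G.subs.length + 1) ^ 3 * (500 * unit N))

theorem call_entry {l : List SExp} {tabs : List (Tab N)} (h : G.RepresentsAll l tabs)
    (htabs : tabs.length ≤ N)
    {A A' U U' c B : Finset (Fin N)} (hB : B ⊆ G.C) (hc : c ⊆ G.C) (hU : U' ⊆ G.C) :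
    Calls Code.iEntry (lst [lst l, G.enc, encSet A, encSet A', encSet U, encSet U',
      encSet c, encSet B]) (encPiece (G.entry tabs A A' U U' c B)) G.entryCost := by
  have hu := le_unit N
  have hclose := call_closeAt h (V := A) (V' := A') (U := U) hU
  have hlen : (G.closeAt tabs A A' U U').length ≤ 2 * N + 2 :=
    (length_closeAt h (V := A) (V' := A') (U := U) hU).trans (by omega)
  have he := fun p hp => G.call_extend h htabs (p := p) hp (A := A) (A' := A') (U := U) hB hc hU
  have he' := G.call_extend h htabs hlen (A := A) (A' := A') (U := U) hc hU hU
  have hl' := G.length_extend h hlen (A := A) (A' := A') (U := U) hc hU hU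
  have hn : ∀ h, G.entry tabs A A' U U' c B = _ := fun h => if_neg h
  have hy : ∀ h, G.entry tabs A A' U U' c B = _ := fun h => if_pos h
  have hcost : (G.subs.length + 1) * (50 * unit N) + 100 * unit N +
      2 * ((N + 1) * ((G.subs.length + 1) ^ 3 * (85 * unit N)) + 30 * unit N) ≤ G.entryCost := by
    have h₁ : (G.subs.length + 1) ≤ (G.subs.length + 1) ^ 3 := Nat.le_self_pow (by omega) _
    unfold entryCost
    generalize (G.subs.length + 1) ^ 3 = q at *
    generalize unit N = u at *
    have h₂ : q * u ≤ (N + 1) * (q * u) := Nat.le_mul_of_pos_left _ (by omega)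
    have h₃ : (G.subs.length + 1) * u ≤ q * u := Nat.mul_le_mul_right _ h₁
    have h₄ : u ≤ (G.subs.length + 1) * u := Nat.le_mul_of_pos_left _ (by omega)
    nlinarith
  generalize (N + 1) * ((G.subs.length + 1) ^ 3 * (85 * unit N)) + 30 * unit N = K at *
  generalize (G.subs.length + 1) * (50 * unit N) = D at *
  refine .of_wp (e := Code.entry) rfl ?_
  simp [Code.entry]
  refine .of_call (call_sub _ _) (.decide (fun h₁ => ?_) fun h₁ => ?_)
  · refine .of_call hclose (.of_call (he _ hlen) ⟨?_, by omega⟩)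
    rw [hy h₁]
  · refine .of_call hclose (.of_call he' (.of_call (G.call_done _ hl' _ _ _)
      (.decide (fun h₂ => ?_) fun h₂ => ?_)))
    · refine .of_call (he _ hl') ⟨?_, by omega⟩
      rw [hn h₁]
      simp [h₂]
    · refine .of_call (he [] (by simp)) ⟨?_, by omega⟩
      rw [hn h₁]
      simp [h₂]

end Ctx
/-! ### The tables as trees -/

/-- The `i`-th set of a chain of six sets that is given by the number of sets without each element. -/
def level (i : ℕ) (ds : List ℕ) : List Bool := ds.map fun d => decide (d ≤ i)

/-- The trees of the sets of a chain. -/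
def levels (ds : List ℕ) : List SExp :=
  [encBits (level 0 ds), encBits (level 1 ds), encBits (level 2 ds), encBits (level 3 ds),
    encBits (level 4 ds), encBits (level 5 ds)]

/-- The sets of a chain are contained in the set with the given characteristic vector. -/
def Fits (cb : List Bool) (ds : List ℕ) : Prop :=
  List.Forall₂ (fun b d => d ≤ 6 ∧ (b = false → d = 6)) cb ds

/-- The tree with the values of `f` at the chains in a set with the reversed characteristic vector
`cb`. -/
def trie (f : List ℕ → SExp) : List Bool → List ℕ → SExp
  | [], ds => f ds
  | true :: cb, ds => lst [trie f cb (0 :: ds), trie f cb (1 :: ds), trie f cb (2 :: ds),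
      trie f cb (3 :: ds), trie f cb (4 :: ds), trie f cb (5 :: ds), trie f cb (6 :: ds)]
  | false :: cb, ds => lst [.nil, .nil, .nil, .nil, .nil, .nil, trie f cb (6 :: ds)]

/-- Looking up the tails of the vectors leads to the node of `ds`, and the heads select one of its
children. Outside the cover only the child `6` is present, which is the one that `Fits` prescribes.
-/
theorem call_look (f : List ℕ → SExp) {all rest cb : List Bool} {ds : List ℕ}
    (h : all = rest.reverse ++ cb) (hd : Fits cb ds) :
    Calls Code.iLook (lst (trie f all.reverse [] :: levels ds)) (trie f rest ds)
      (ds.length + 1) := by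
  induction ds generalizing rest cb with
  | nil =>
    cases hd
    refine .of_wp (e := Code.look) rfl ?_
    simp [Code.look, Ends, levels, level, h]
  | cons d ds ih =>
    obtain _ | ⟨⟨hd₁, hd₂⟩, hd₃⟩ := hd
    rename_i b cb
    have := ih (rest := b :: rest) (by simp [h]) hd₃
    refine .of_wp (e := Code.look) rfl ?_
    simp [levels] at this
    cases b
    · obtain rfl := hd₂ rfl
      simp [Code.look, Code.child, levels, level] at this ⊢
      refine .of_call this ?_
      simp [trie, Ends]
    · simp [Code.look, Code.child, levels, level] at this ⊢
      refine .of_call this ?_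
      interval_cases d <;> simp [trie, Ends]

namespace Ctx

variable {N : ℕ} {G : Ctx N}

/-- The entry of a table for a chain. -/
def atChain (τ : Tab N) (ds : List ℕ) : SExp :=
  encPiece (τ (ofBits (level 0 ds)) (ofBits (level 1 ds)) (ofBits (level 2 ds))
    (ofBits (level 3 ds)) (ofBits (level 4 ds)) (ofBits (level 5 ds)))

theorem ofBits_level_subset {C : Finset (Fin N)} {ds : List ℕ} (h : Fits (bits C) ds) {i : ℕ}
    (hi : i < 6) : ofBits (level i ds) ⊆ C := by
  intro j hj
  have hl : ds.length = N := by simpa using h.length_eq.symm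
  have hj' : j.1 < ds.length := by omega
  have h₁ : ds[j.1] ≤ i := by simpa [ofBits, level, hj'] using hj
  have h₂ := (List.forall₂_iff_get.1 h).2 j.1 (by simp) hj'
  by_contra hjC
  have h₃ := h₂.2 (by simp [bits, hjC])
  simp at h₃
  omega

/-- A cover element multiplies the number of leaves by seven and any other element leaves it
unchanged; `rest.length` pays for the calls above the leaves. -/
theorem call_build {l : List SExp} {tabs : List (Tab N)} (h : G.RepresentsAll l tabs)
    (htabs : tabs.length ≤ N) (rest cb : List Bool) (ds : List ℕ) (hd : Fits cb ds)
    (hrest : bits G.C = rest.reverse ++ cb) :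
    Calls Code.iBuild (lst (encBits rest :: lst l :: G.enc :: levels ds))
      (trie (atChain (G.entry tabs)) rest ds)
      (7 ^ rest.count true * (G.entryCost + 1 + rest.length)) := by
  induction rest generalizing cb ds with
  | nil =>
    obtain rfl : bits G.C = cb := by simpa using hrest
    have hl : ds.length = N := by simpa using hd.length_eq.symm
    have he := call_entry h htabs (A := ofBits (level 0 ds)) (A' := ofBits (level 1 ds))
      (U := ofBits (level 2 ds)) (ofBits_level_subset hd (i := 5) (by omega))
      (ofBits_level_subset hd (i := 4) (by omega)) (ofBits_level_subset hd (i := 3) (by omega))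
    have hb : ∀ i, encSet (ofBits (level i ds) : Finset (Fin N)) = encBits (level i ds) := fun i => by
      rw [encSet_eq, bits_ofBits (by simp [level, hl])]
    simp only [hb] at he
    refine .of_wp (e := Code.build) rfl ?_
    simp [Code.build]
    exact .of_call he ⟨rfl, by simp⟩
  | cons b rest ih =>
    have ih := fun d (h₁ : d ≤ 6) (h₂ : b = false → d = 6) =>
      ih (b :: cb) (d :: ds) (.cons ⟨h₁, h₂⟩ hd) (by simp [hrest])
    have h₀ : 1 ≤ 7 ^ rest.count true := Nat.one_le_pow _ _ (by omega)
    refine .of_wp (e := Code.build) rfl ?_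
    cases b
    · have h₆ := ih 6 (by omega) (by simp)
      simp [Code.build, Code.buildChild, levels, level] at h₆ ⊢
      refine .of_call h₆ ⟨by simp [trie], ?_⟩
      nlinarith
    · have h₁ := ih 0 (by omega) (by simp)
      have h₂ := ih 1 (by omega) (by simp)
      have h₃ := ih 2 (by omega) (by simp)
      have h₄ := ih 3 (by omega) (by simp)
      have h₅ := ih 4 (by omega) (by simp)
      have h₆ := ih 5 (by omega) (by simp)
      have h₇ := ih 6 (by omega) (by simp)
      simp [Code.build, Code.buildChild, levels, level] at h₁ h₂ h₃ h₄ h₅ h₆ h₇ ⊢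
      refine .of_call h₁ (.of_call h₂ (.of_call h₃ (.of_call h₄ (.of_call h₅ (.of_call h₆
        (.of_call h₇ ⟨by simp [trie], ?_⟩))))))
      rw [pow_succ]
      nlinarith

theorem represents_trie {τ : Tab N}
    (hτ : ∀ ⦃A A' U U' c B⦄, A ⊆ A' → U ⊆ U' → U' ⊆ c → c ⊆ B → c ⊆ G.C →
      (τ A A' U U' c B).length ≤ N) :
    G.Represents (trie (atChain τ) (bits G.C).reverse []) τ := by
  intro A A' U U' c B h₁ h₂ h₃ h₄ h₅ hB
  refine ⟨?_, hτ h₁ h₃ h₄ h₅ (h₅.trans hB)⟩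
  -- `f j` is the number of sets of the chain that miss `j`; the sets are recovered as its sublevel
  -- sets.
  let f : Fin N → ℕ := fun j => if j ∈ A then 0 else if j ∈ A' then 1 else if j ∈ U then 2 else
    if j ∈ U' then 3 else if j ∈ c then 4 else if j ∈ B then 5 else 6
  have hf : ∀ (j : Fin N), f j = 6 ∨ (j ∈ B ∧ f j ≤ 5) := by
    intro j
    have := @h₁ j; have := @h₂ j; have := @h₃ j; have := @h₄ j; have := @h₅ j
    simp only [f]
    split_ifs <;> simp_all
  have hl : ∀ (X : Finset (Fin N)) i, (∀ j, f j ≤ i ↔ j ∈ X) → level i (List.ofFn f) = bits X := by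
    intro X i hX
    simp [level, bits, List.map_ofFn, Function.comp_def, hX]
  have l₀ : level 0 (List.ofFn f) = bits A := hl A 0 fun j => by
    simp only [f]; split_ifs <;> simp_all
  have l₁ : level 1 (List.ofFn f) = bits A' := hl A' 1 fun j => by
    have := @h₁ j; simp only [f]; split_ifs <;> simp_all
  have l₂ : level 2 (List.ofFn f) = bits U := hl U 2 fun j => by
    have := @h₁ j; have := @h₂ j; simp only [f]; split_ifs <;> simp_all
  have l₃ : level 3 (List.ofFn f) = bits U' := hl U' 3 fun j => by
    have := @h₁ j; have := @h₂ j; have := @h₃ j; simp only [f]; split_ifs <;> simp_all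
  have l₄ : level 4 (List.ofFn f) = bits c := hl c 4 fun j => by
    have := @h₁ j; have := @h₂ j; have := @h₃ j; have := @h₄ j; simp only [f]; split_ifs <;> simp_all
  have l₅ : level 5 (List.ofFn f) = bits B := hl B 5 fun j => by
    have := @h₁ j; have := @h₂ j; have := @h₃ j; have := @h₄ j; have := @h₅ j
    simp only [f]; split_ifs <;> simp_all
  have hfit : Fits (bits G.C) (List.ofFn f) := by
    refine List.forall₂_iff_get.2 ⟨by simp, fun i hi hi' => ?_⟩
    have hi : i < N := by simpa using hi
    rcases hf ⟨i, hi⟩ with h | ⟨h, h'⟩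
    · simp [h]
    · simp [bits, hB h]; omega
  have := call_look (atChain τ) (all := bits G.C) (rest := []) (by simp) hfit
  simp only [levels, l₀, l₁, l₂, l₃, l₄, l₅, trie, atChain, ofBits_bits, List.length_ofFn] at this
  exact this.mono (by have := le_unit N; omega)

theorem length_entry_le {tabs : List (Tab N)} (h : TablesOK G tabs) (htabs : tabs.length < N)
    ⦃A A' U U' c B : Finset (Fin N)⦄ (h₁ : A ⊆ A') (h₂ : U ⊆ U') (h₃ : U' ⊆ c) (h₄ : c ⊆ B)
    (h₅ : c ⊆ G.C) : (G.entry tabs A A' U U' c B).length ≤ N := by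
  rcases hp : G.entry tabs A A' U U' c B with _ | ⟨z, zs⟩
  · simp
  · have := (tableOK_entry h h₁ h₂ h₃ h₄ h₅ hp).2.1
    simp
    omega

variable (G) in
/-- A bound on the number of function calls for one table. -/
def tableCost : ℕ := 7 ^ G.C.card * (G.entryCost + 1 + N)

theorem call_rounds (k L : ℕ) (hL : L + k ≤ N) {l : List SExp}
    (h : G.RepresentsAll l (G.tables L)) : ∃ l', G.RepresentsAll l' (G.tables (L + k)) ∧
      Calls Code.iRounds (lst [G.enc, unary k, lst l]) (lst l') (k * (G.tableCost + 1) + 1) := by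
  induction k generalizing L l with
  | zero =>
    refine ⟨l, h, .of_wp (e := Code.rounds) rfl ?_⟩
    simp [Code.rounds, Ends]
  | succ k ih =>
    have hlen : (G.tables L).length = L := length_tables L
    have hb := call_build h (by omega) (bits G.C).reverse [] [] .nil (by simp)
    rw [List.count_reverse, ← card_eq_count_bits, List.length_reverse, length_bits] at hb
    have hr : G.RepresentsAll (trie (atChain (G.entry (G.tables L))) (bits G.C).reverse [] :: l)
        (G.tables (L + 1)) :=
      .cons (represents_trie (length_entry_le (tablesOK_tables L) (by omega))) h
    obtain ⟨l', h₁, h₂⟩ := ih (L + 1) (by omega) hr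
    rw [show L + (k + 1) = L + 1 + k by omega]
    refine ⟨l', h₁, .of_wp (e := Code.rounds) rfl ?_⟩
    simp [Code.rounds]
    rw [show G.enc.tl.tl.tl.tl.hd = encBits (bits G.C).reverse from rfl]
    refine .of_call hb (.of_call h₂ ⟨rfl, ?_⟩)
    rw [tableCost]
    linarith

end Ctx

/-! ### Subsets -/

/-- The characteristic vectors of the subsets. -/
def subVectors : List Bool → List (List Bool)
  | [] => [[]]
  | true :: l => (subVectors l).map (List.cons false) ++ (subVectors l).map (List.cons true)
  | false :: l => (subVectors l).map (List.cons false)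

theorem length_subVectors (l : List Bool) : (subVectors l).length = 2 ^ l.count true := by
  induction l with
  | nil => simp [subVectors]
  | cons b l ih => cases b <;> simp [subVectors, ih, pow_succ]; omega

theorem mem_subVectors {l l' : List Bool} :
    l' ∈ subVectors l ↔ List.Forall₂ (fun a b => a = true → b = true) l' l := by
  induction l generalizing l' with
  | nil => simp [subVectors]
  | cons b l ih =>
    rcases l' with _ | ⟨a, l'⟩
    · cases b <;> simp [subVectors]
    · cases b <;> cases a <;> simp [subVectors, ih]

theorem call_subsets (l : List Bool) :
    Calls Code.iSubsets (encBits l) (encList encBits (subVectors l))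
      (l.length * (2 * 2 ^ l.count true + 3) + 1) := by
  induction l with
  | nil =>
    refine .of_wp (e := Code.subsets) rfl ?_
    simp [Code.subsets, Ends, subVectors]
  | cons b l ih =>
    have e : ∀ L : List (List Bool), encList encBits L = lst (L.map encBits) := encList_eq_lst _
    have hm : ∀ (b : Bool) (L : List (List Bool)), (L.map encBits).map (SExp.cons (encBool b)) =
        (L.map (List.cons b)).map encBits := fun b L => by simp [Function.comp_def]
    have h₁ := call_mapCons (encBool true) ((subVectors l).map encBits) []
    have h₂ := call_mapCons (encBool false) ((subVectors l).map encBits) []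
    have h₃ := call_mapCons (encBool false) ((subVectors l).map encBits)
      (((subVectors l).map encBits).map (SExp.cons (encBool true)))
    simp only [List.append_nil, List.length_map, length_subVectors] at h₁ h₂ h₃
    refine .of_wp (e := Code.subsets) rfl ?_
    cases b
    · simp [Code.subsets]
      refine .of_call ih ?_
      rw [e]
      refine .of_call h₂ ⟨?_, ?_⟩
      · rw [hm, e, subVectors]
      · generalize 2 ^ l.count true = q
        linarith
    · simp [Code.subsets]
      refine .of_call ih ?_
      rw [e]
      refine .of_call h₁ (.of_call h₃ ⟨?_, ?_⟩)
      · rw [hm, hm, e, subVectors, List.map_append]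
      · rw [pow_succ]
        generalize 2 ^ l.count true = q
        nlinarith

/-- The list of the subsets of a set. -/
def subsetList {N : ℕ} (C : Finset (Fin N)) : List (Finset (Fin N)) :=
  (subVectors (bits C)).map ofBits

theorem length_subsetList {N : ℕ} (C : Finset (Fin N)) :
    (subsetList C).length = 2 ^ C.card := by
  rw [subsetList, List.length_map, length_subVectors, ← card_eq_count_bits]

theorem mem_subsetList {N : ℕ} {C X : Finset (Fin N)} (h : X ⊆ C) : X ∈ subsetList C := by
  refine List.mem_map.2 ⟨bits X, mem_subVectors.2 ?_, ofBits_bits X⟩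
  refine List.forall₂_iff_get.2 ⟨by simp, fun i hi hi' => ?_⟩
  simpa [bits] using fun hX => h hX

theorem call_subsets_set {N : ℕ} (C : Finset (Fin N)) :
    Calls Code.iSubsets (encSet C) (encPiece (subsetList C))
      (N * (2 * 2 ^ C.card + 3) + 1) := by
  have := call_subsets (bits C)
  rw [length_bits, ← card_eq_count_bits] at this
  have e : encPiece (subsetList C) = encList encBits (subVectors (bits C)) := by
    unfold subsetList encPiece
    rw [encList_eq_lst, encList_eq_lst, List.map_map]
    refine congrArg lst (List.map_congr_left fun l hl => ?_)
    have := (mem_subVectors.1 hl).length_eq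
    rw [Function.comp_apply, encSet_eq, bits_ofBits (by simpa using this)]
  rw [e]
  exact this

/-! ### Vertex covers -/

section

variable {N : ℕ}

/-- A vertex cover of the comparability graph. -/
def Covers (R : Fin N → Fin N → Bool) (X : Finset (Fin N)) : Prop :=
  ∀ i j, R i j = true → i ∈ X ∨ j ∈ X

/-- A set, or `nil`. -/
def encOption : Option (Finset (Fin N)) → SExp
  | none => .nil
  | some X => encSet X

theorem firstElems_one {X : Finset (Fin N)} (h : X.Nonempty) : ∃ v ∈ X, firstElems X 1 = {v} := by
  have h₁ : (firstElems X 1).card = 1 := by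
    rw [card_firstElems]
    have := h.card_pos
    omega
  obtain ⟨v, hv⟩ := card_eq_one.1 h₁
  exact ⟨v, firstElems_subset X 1 (by simp [hv]), hv⟩

theorem encSet_ne_nil (hN : 0 < N) (X : Finset (Fin N)) : encSet X ≠ .nil := by
  rw [encSet_eq, encBits, Ne, encList_eq_nil, ← List.length_eq_zero_iff, length_bits]
  omega

/-- A bounded search tree: every cover contains an end of the uncovered edge `v w`, and either
choice uses up one unit of `f`. The summand `13 * unit N` on the left is slack: adding the bounds of
both branches frees one such summand, which pays for the work at the node. -/
theorem exists_call_cover (hN : 0 < N) (R : Fin N → Fin N → Bool) (f : ℕ) (X : Finset (Fin N)) :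
    ∃ (r : Option (Finset (Fin N))) (c : ℕ),
      Calls Code.iCover (lst [unary f, encMatrix R, encSet X]) (encOption r) c ∧
      c + 13 * unit N ≤ 2 ^ f * (26 * unit N) ∧
      (∀ Y, r = some Y → X ⊆ Y ∧ Covers R Y ∧ Y.card ≤ X.card + f) ∧
      ∀ D, X ⊆ D → Covers R D → D.card ≤ X.card + f → r ≠ none := by
  have hu := le_unit N
  induction f generalizing X with
  | zero =>
    have h₁ := call_preceding_le R Xᶜ
    by_cases hX : ((univ.filter fun v => ∃ j ∈ Xᶜ, R v j = true) \ X) = ∅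
    · refine ⟨some X, 13 * unit N, ?_, by omega, ?_, by simp⟩
      · refine .of_wp (e := Code.cover) rfl ?_
        simp [Code.cover]
        refine .of_call (call_compl X) (.of_call h₁ (.of_call (call_diff _ _) (.of_call
          (call_nonempty _) (.decide (fun h => absurd hX h) fun _ => ⟨rfl, by omega⟩))))
      · rintro Y ⟨⟩
        refine ⟨subset_rfl, fun i j h => ?_, by simp⟩
        by_contra! hc
        have : i ∈ ((univ.filter fun v => ∃ j ∈ Xᶜ, R v j = true) \ X) := by
          simpa [hc.1] using ⟨j, hc.2, h⟩
        rw [hX] at this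
        exact absurd this (notMem_empty i)
    · refine ⟨none, 13 * unit N, ?_, by omega, by simp, ?_⟩
      · refine .of_wp (e := Code.cover) rfl ?_
        simp [Code.cover]
        refine .of_call (call_compl X) (.of_call h₁ (.of_call (call_diff _ _) (.of_call
          (call_nonempty _) (.decide (fun _ => ⟨rfl, by omega⟩) fun h => absurd hX h))))
      · intro D hD hc hcard
        obtain rfl := eq_of_subset_of_card_le hD hcard
        obtain ⟨i, hi⟩ := nonempty_iff_ne_empty.2 hX
        simp only [mem_sdiff, mem_filter, mem_univ, true_and, mem_compl] at hi
        obtain ⟨⟨j, hj, hij⟩, hi⟩ := hi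
        exact absurd (hc i j hij) (by tauto)
  | succ f ih =>
    have h₁ := call_preceding_le R Xᶜ
    by_cases hX : ((univ.filter fun v => ∃ j ∈ Xᶜ, R v j = true) \ X) = ∅
    · refine ⟨some X, 13 * unit N, ?_, ?_, ?_, by simp⟩
      · refine .of_wp (e := Code.cover) rfl ?_
        simp [Code.cover]
        refine .of_call (call_compl X) (.of_call h₁ (.of_call (call_diff _ _) (.of_call
          (call_nonempty _) (.decide (fun h => absurd hX h) fun _ => ⟨rfl, by omega⟩))))
      · have := Nat.one_le_pow (f + 1) 2 (by omega)
        nlinarith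
      · rintro Y ⟨⟩
        refine ⟨subset_rfl, fun i j h => ?_, by simp⟩
        by_contra! hc
        have : i ∈ ((univ.filter fun v => ∃ j ∈ Xᶜ, R v j = true) \ X) := by
          simpa [hc.1] using ⟨j, hc.2, h⟩
        rw [hX] at this
        exact absurd this (notMem_empty i)
    · obtain ⟨v, hv, hve⟩ := firstElems_one (nonempty_iff_ne_empty.2 hX)
      simp only [mem_sdiff, mem_filter, mem_univ, true_and, mem_compl] at hv
      obtain ⟨⟨j, hj, hvj⟩, hvX⟩ := hv
      obtain ⟨w, hw, hwe⟩ := firstElems_one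
        (X := (∅ ∪ univ.filter fun y => ∃ i ∈ ({v} : Finset (Fin N)), R i y = true) \ X)
        ⟨j, by simp [hj, hvj]⟩
      simp only [empty_union, mem_sdiff, mem_filter, mem_univ, true_and, mem_singleton,
        exists_eq_left] at hw
      obtain ⟨hvw, hwX⟩ := hw
      have hcX : ∀ y, y ∉ X → (X ∪ {y}).card = X.card + 1 := fun y hy => by
        rw [card_union_of_disjoint (by simpa using hy), card_singleton]
      obtain ⟨r₁, c₁, hr₁, hc₁, hs₁, ht₁⟩ := ih (X ∪ {v})
      obtain ⟨r₂, c₂, hr₂, hc₂, hs₂, ht₂⟩ := ih (X ∪ {w})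
      have ht := call_firstElems ((univ.filter fun v => ∃ j ∈ Xᶜ, R v j = true) \ X) 1
      have ht' := call_firstElems
        ((∅ ∪ univ.filter fun y => ∃ i ∈ ({v} : Finset (Fin N)), R i y = true) \ X) 1
      rw [hve] at ht
      rw [hwe] at ht'
      refine ⟨r₁.or r₂, c₁ + c₂ + 13 * unit N, ?_, ?_, ?_, ?_⟩
      · refine .of_wp (e := Code.cover) rfl ?_
        simp [Code.cover]
        refine .of_call (call_compl X) (.of_call h₁ (.of_call (call_diff _ _) (.of_call
          (call_nonempty _) (.decide (fun _ => ?_) fun h => absurd hX h))))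
        refine .of_call ht (.of_call (call_union _ _) (.of_call hr₁ ?_))
        cases r₁ with
        | some Y => exact .of_ne (encSet_ne_nil hN Y) ⟨rfl, by omega⟩
        | none =>
          refine .of_eq rfl (.of_call (call_zeros _) (.of_call (call_rows_le R _ _) (.of_call
            (call_diff _ _) (.of_call ht' (.of_call (call_union _ _) (.of_call hr₂
            ⟨by simp, by omega⟩))))))
      · rw [pow_succ]
        nlinarith
      · intro Y hY
        cases r₁ with
        | some Z =>
          obtain rfl : Z = Y := by simpa using hY
          obtain ⟨h₁, h₂, h₃⟩ := hs₁ _ rfl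
          exact ⟨subset_union_left.trans h₁, h₂, by rw [hcX v hvX] at h₃; omega⟩
        | none =>
          obtain ⟨h₁, h₂, h₃⟩ := hs₂ Y (by simpa using hY)
          exact ⟨subset_union_left.trans h₁, h₂, by rw [hcX w hwX] at h₃; omega⟩
      · intro D hD hc hcard hn
        simp only [Option.or_eq_none_iff] at hn
        rcases hc v w hvw with h | h
        · exact ht₁ D (union_subset hD (by simpa using h)) hc (by rw [hcX v hvX]; omega) hn.1
        · exact ht₂ D (union_subset hD (by simpa using h)) hc (by rw [hcX w hwX]; omega) hn.2

/-- The allowed size grows until the search succeeds, which happens at the latest at the size of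
`D`; `k` bounds the number of increments still needed. -/
theorem exists_call_minCover (hN : 0 < N) (R : Fin N → Fin N → Bool) {X D : Finset (Fin N)}
    (hD : X ⊆ D) (hc : Covers R D) {f k : ℕ} (hk : D.card ≤ X.card + k + f) :
    ∃ Y, X ⊆ Y ∧ Covers R Y ∧ Y.card ≤ X.card + k + f ∧
      Calls Code.iMinCover (lst [unary f, encMatrix R, encSet X]) (encSet Y)
        ((k + 1) * (2 ^ (k + f) * (26 * unit N))) := by
  have hu := le_unit N
  induction k generalizing f with
  | zero =>
    obtain ⟨r, c, hr, hcost, hs, ht⟩ := exists_call_cover hN R f X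
    obtain ⟨Y, rfl⟩ := Option.ne_none_iff_exists'.1 (ht D hD hc (by omega))
    obtain ⟨h₁, h₂, h₃⟩ := hs Y rfl
    refine ⟨Y, h₁, h₂, by omega, .of_wp (e := Code.minCover) rfl ?_⟩
    simp [Code.minCover]
    exact .of_call hr (.of_ne (encSet_ne_nil hN Y) ⟨rfl, by omega⟩)
  | succ k ih =>
    obtain ⟨r, c, hr, hcost, hs, ht⟩ := exists_call_cover hN R f X
    have hp : 2 ^ f ≤ 2 ^ (k + 1 + f) := Nat.pow_le_pow_right (by omega) (by omega)
    have hp' := Nat.mul_le_mul_right (26 * unit N) hp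
    cases r with
    | some Y =>
      obtain ⟨h₁, h₂, h₃⟩ := hs Y rfl
      refine ⟨Y, h₁, h₂, by omega, .of_wp (e := Code.minCover) rfl ?_⟩
      simp [Code.minCover]
      exact .of_call hr (.of_ne (encSet_ne_nil hN Y) ⟨rfl, by nlinarith⟩)
    | none =>
      obtain ⟨Y, h₁, h₂, h₃, h₄⟩ := ih (f := f + 1) (by omega)
      refine ⟨Y, h₁, h₂, by omega, .of_wp (e := Code.minCover) rfl ?_⟩
      simp [Code.minCover]
      refine .of_call hr (.of_eq rfl (.of_call h₄ ⟨rfl, ?_⟩))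
      rw [show k + (f + 1) = k + 1 + f by omega]
      nlinarith

end

/-! ### Solving an instance with a minimum and a maximum -/

/-- A bound on the number of function calls of the dynamic program. -/
def solveCost (N k : ℕ) : ℕ := 56 ^ k * (5000 * (N + 2) ^ 5)

/-- `7 ^ k` entries per table and `(2 ^ k + 1) ^ 3 ≤ 8 * 8 ^ k` combinations per entry make `56 ^
k`. The rounds, the cut positions and the set operations are polynomial. -/
theorem rounds_cost_le {N : ℕ} (G : Ctx N) (h : G.subs.length = 2 ^ G.C.card) :
    N * (G.tableCost + 1) + 1 ≤ 56 ^ G.C.card * (4100 * (N + 2) ^ 5) := by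
  unfold Ctx.tableCost Ctx.entryCost unit
  rw [h]
  generalize G.C.card = k
  have h₁ : (2 ^ k + 1) ^ 3 ≤ 8 * 8 ^ k := by
    have : 1 ≤ 2 ^ k := Nat.one_le_pow _ _ (by omega)
    calc (2 ^ k + 1) ^ 3 ≤ (2 * 2 ^ k) ^ 3 := Nat.pow_le_pow_left (by omega) 3
      _ = 8 * (2 ^ 3) ^ k := by rw [mul_pow, ← pow_mul, ← pow_mul, mul_comm k]; norm_num
      _ = _ := by norm_num
  have h₂ : (56 : ℕ) ^ k = 7 ^ k * 8 ^ k := by rw [← mul_pow]; norm_num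
  have h₃ : 1 ≤ 7 ^ k := Nat.one_le_pow _ _ (by omega)
  have h₄ : 1 ≤ 8 ^ k := Nat.one_le_pow _ _ (by omega)
  rw [h₂]
  generalize (7 : ℕ) ^ k = a at *
  generalize (8 : ℕ) ^ k = b at *
  generalize (2 ^ k + 1) ^ 3 = s at *
  obtain ⟨D, hD⟩ : ∃ D, D = N + 2 := ⟨_, rfl⟩
  rw [← hD]
  calc N * (a * ((N + 1) * (s * (500 * (D * D))) + 1 + N) + 1) + 1
      ≤ D * (a * (D * ((8 * b) * (500 * (D * D))) + D) + 1) + D := by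
        rw [add_assoc _ 1 N]
        gcongr <;> omega
    _ = a * b * (4000 * D ^ 4) + a * D ^ 2 + 2 * D := by ring
    _ ≤ a * b * (4000 * D ^ 4 * D) + a * b * (D ^ 2 * D ^ 3) + a * b * (2 * (D * D ^ 4)) := by
        have hab : 1 ≤ a * b := Nat.mul_le_mul h₃ h₄
        have : ∀ i, 1 ≤ D ^ i := fun i => Nat.one_le_pow _ _ (by omega)
        have hD1 : 1 ≤ D := by omega
        refine Nat.add_le_add (Nat.add_le_add ?_ ?_) ?_
        · exact Nat.mul_le_mul_left _ (Nat.le_mul_of_pos_right _ (by omega))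
        · exact Nat.mul_le_mul (Nat.le_mul_of_pos_right _ (by omega))
            (Nat.le_mul_of_pos_right _ (this 3))
        · exact (Nat.mul_le_mul_left 2 (Nat.le_mul_of_pos_right _ (this 4))).trans
            (Nat.le_mul_of_pos_left _ hab)
    _ ≤ a * b * (4100 * D ^ 5) := by ring_nf; omega

theorem exists_call_solve {N : ℕ} (R : Fin (N + 2) → Fin (N + 2) → Bool)
    (r : Fin N → Fin N → Bool) (m T : ℕ) (hT : T ≤ N + 2) {k : ℕ} {D : Finset (Fin (N + 2))}
    (hD : {0, 1} ⊆ D) (hc : Covers R D) (hk : D.card = k + 2) :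
    ∃ C, {0, 1} ⊆ C ∧ Covers R C ∧
      Calls Code.iSolve (lst [encMatrix R, unary m, unary T, encMatrix r])
        (encPiece (Ctx.answer ⟨R, m, C, subsetList C⟩ T 0 1)) (solveCost (N + 2) (k + 2)) := by
  have h01 : ({0, 1} : Finset (Fin (N + 2))).card = 2 := rfl
  obtain ⟨C, h₀, h₁, h₂, h₃⟩ := exists_call_minCover (by omega) R hD hc (f := 0) (k := k) (by omega)
  refine ⟨C, h₀, h₁, ?_⟩
  set G : Ctx (N + 2) := ⟨R, m, C, subsetList C⟩ with hG
  have hsubs : G.subs.length = 2 ^ G.C.card := length_subsetList C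
  obtain ⟨l, hl, hrounds⟩ := Ctx.call_rounds (G := G) T 0 (by omega) .nil
  rw [zero_add] at hl
  have hu := le_unit (N + 2)
  have hclose := Ctx.call_closeAt hl (V := ∅) (V' := {0}) (U := G.C \ {1}) (U' := G.C) subset_rfl
  have hsub := call_subsets_set C
  have hconst := call_const .nil ((List.ofFn (row r)).map encSet)
  rw [← encList_eq_lst, List.length_map, List.length_ofFn] at hconst
  have hrev := call_revApp ((bits C).map encBool) []
  rw [← encList_eq_lst, List.length_map, length_bits, List.append_nil, ← List.map_reverse,
    ← encList_eq_lst] at hrev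
  have hnil : lst (List.replicate N .nil) = encBits (List.ofFn fun _ : Fin N => false) := by
    rw [encBits, encList_eq_lst, List.map_ofFn, Function.comp_def, List.ofFn_const]
    rfl
  -- The vectors written out in `solve`: job `0` is the minimum, job `1` the maximum, and the other
  -- `N` entries are zero.
  have b₀ : SExp.cons .nil (.cons .nil (lst (List.replicate N .nil))) =
      encSet (∅ : Finset (Fin (N + 2))) := by
    rw [encSet, List.ofFn_succ, List.ofFn_succ, hnil]
    simp
  have b₁ : SExp.cons (encBool true) (.cons .nil (lst (List.replicate N .nil))) =
      encSet ({0} : Finset (Fin (N + 2))) := by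
    rw [encSet, List.ofFn_succ, List.ofFn_succ, hnil]
    simp [Fin.ext_iff]
  have b₂ : SExp.cons .nil (.cons (encBool true) (lst (List.replicate N .nil))) =
      encSet ({1} : Finset (Fin (N + 2))) := by
    rw [encSet, List.ofFn_succ, List.ofFn_succ, hnil]
    simp [Fin.ext_iff]
  have b₃ : SExp.cons (encBool true) (.cons (encBool true) (lst (List.replicate N .nil))) =
      encSet ({0, 1} : Finset (Fin (N + 2))) := by
    rw [encSet, List.ofFn_succ, List.ofFn_succ, hnil]
    simp [Fin.ext_iff]
  refine .of_wp (e := Code.solve) rfl ?_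
  simp only [Code.solve, Code.mk, Code.ent, Code.arg, Code.drops, wp_bind, wp_call, wp_cons, wp_nil,
    wp_hd, wp_tl, wp_var_zero, wp_var_one, wp_var_two, wp_var_three, lst_cons, lst_nil, hd_cons,
    tl_cons, wp_bool, Code.diff, Code.bitop, wp_table]
  refine .of_call hconst ?_
  rw [b₀, b₁, b₂, b₃]
  refine .of_call h₃ (.of_call hsub (.of_call hrev (.of_call hrounds (.of_call (call_diff C {1})
    (.of_call hclose ⟨rfl, ?_⟩)))))
  have hr := rounds_cost_le G hsubs
  have hCk : G.C.card ≤ k + 2 := h₂.trans (by omega)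
  have hkN : k ≤ N := by
    have := card_le_univ D
    rw [hk, Fintype.card_fin] at this
    omega
  have hTr := Nat.mul_le_mul_right (G.tableCost + 1) hT
  have hq : 56 ^ G.C.card ≤ 56 ^ (k + 2) := Nat.pow_le_pow_right (by omega) hCk
  have hq' : 2 ^ C.card ≤ 56 ^ (k + 2) :=
    (Nat.pow_le_pow_left (by omega) C.card).trans hq
  have hq'' : 2 ^ k ≤ 56 ^ (k + 2) := (Nat.pow_le_pow_left (by omega) k).trans
    (Nat.pow_le_pow_right (by omega) (by omega))
  have hq₁ : 1 ≤ 56 ^ (k + 2) := Nat.one_le_pow _ _ (by omega)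
  have hr' := hr.trans (Nat.mul_le_mul_right (4100 * (N + 2 + 2) ^ 5) hq)
  rw [hsubs, show G.C = C from rfl, add_zero, unit, solveCost]
  generalize (56 : ℕ) ^ (k + 2) = q at *
  generalize (2 : ℕ) ^ C.card = c at *
  generalize (2 : ℕ) ^ k = a at *
  obtain ⟨E, hE⟩ : ∃ E, E = N + 2 + 2 := ⟨_, rfl⟩
  rw [← hE] at hr' ⊢
  have hpow : ∀ i ≤ 5, E ^ i ≤ q * E ^ 5 := fun i hi =>
    (Nat.pow_le_pow_right (by omega) hi).trans (Nat.le_mul_of_pos_left _ hq₁)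
  have h₁' := hpow 0 (by omega)
  have h₂' := hpow 1 (by omega)
  have h₃' : q * E ^ 3 ≤ q * E ^ 5 := Nat.mul_le_mul_left q (Nat.pow_le_pow_right (by omega) (by omega))
  have h₄' : q * E ^ 2 ≤ q * E ^ 5 := Nat.mul_le_mul_left q (Nat.pow_le_pow_right (by omega) (by omega))
  have h₅' : q * E ^ 1 ≤ q * E ^ 5 := Nat.mul_le_mul_left q (Nat.pow_le_pow_right (by omega) (by omega))
  have e₁ : (k + 1) * (a * (26 * (E * E))) ≤ 26 * (q * E ^ 3) := calc
    _ ≤ E * (q * (26 * (E * E))) := by gcongr; omega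
    _ = _ := by ring
  have e₂ : (N + 2) * (2 * c + 3) ≤ 5 * (q * E ^ 1) := calc
    _ ≤ E * (2 * q + 3 * q) := by gcongr <;> omega
    _ = _ := by ring
  have e₃ : (c + 1) * (50 * (E * E)) ≤ 100 * (q * E ^ 2) := calc
    _ ≤ (q + q) * (50 * (E * E)) := by gcongr
    _ = _ := by ring
  rw [pow_zero] at h₁'
  rw [pow_one] at h₂'
  have e₄ : q * (5000 * E ^ 5) = 5000 * (q * E ^ 5) := by ring
  have e₅ : q * (4100 * E ^ 5) = 4100 * (q * E ^ 5) := by ring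
  rw [e₄]
  rw [e₅] at hr'
  generalize q * E ^ 5 = Q at *
  omega

/-! ### Padding -/

section

/-- Add a job at the front, with the same relation to all other jobs. -/
def addJob (rb cb : Bool) {n : ℕ} (r : Fin n → Fin n → Bool) : Fin (n + 1) → Fin (n + 1) → Bool :=
  Fin.cons (Fin.cons false fun _ => rb) fun i => Fin.cons cb (r i)

/-- Add isolated jobs. -/
def addPads {n : ℕ} (r : Fin n → Fin n → Bool) : (q : ℕ) → Fin (n + q) → Fin (n + q) → Bool
  | 0 => r
  | q + 1 => addJob false false (addPads r q)

/-- Add isolated jobs, a maximum and a minimum. -/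
def padded {n : ℕ} (r : Fin n → Fin n → Bool) (q : ℕ) : Fin (n + q + 2) → Fin (n + q + 2) → Bool :=
  addJob true false (addJob false true (addPads r q))

variable {n : ℕ} {r : Fin n → Fin n → Bool}

theorem addPads_addNat (q : ℕ) (i j : Fin n) :
    addPads r q (i.addNat q) (j.addNat q) = r i j := by
  induction q with
  | zero => rfl
  | succ q ih => exact ih

theorem addPads_eq_true {q : ℕ} {a b : Fin (n + q)} (h : addPads r q a b = true) :
    ∃ i j, a = i.addNat q ∧ b = j.addNat q ∧ r i j = true := by
  induction q with
  | zero => exact ⟨a, b, rfl, rfl, h⟩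
  | succ q ih =>
    cases a using Fin.cases with
    | zero => cases b using Fin.cases <;> simp [addPads, addJob] at h
    | succ a =>
      cases b using Fin.cases with
      | zero => simp [addPads, addJob] at h
      | succ b =>
        obtain ⟨i, j, rfl, rfl, hij⟩ := ih (by simpa [addPads, addJob] using h)
        exact ⟨i, j, rfl, rfl, hij⟩

/-- The original jobs in the padded instance. -/
def shift (q : ℕ) (i : Fin n) : Fin (n + q + 2) := (i.addNat q).succ.succ

theorem shift_injective (q : ℕ) : Function.Injective (shift (n := n) q) := fun i j h => by
  simpa [shift] using h

theorem padded_shift (q : ℕ) (i j : Fin n) : padded r q (shift q i) (shift q j) = r i j := by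
  simpa [padded, addJob, shift] using addPads_addNat q i j

theorem padded_zero (q : ℕ) (v : Fin (n + q + 2)) (hv : v ≠ 0) : padded r q 0 v = true := by
  cases v using Fin.cases with
  | zero => exact absurd rfl hv
  | succ v => simp [padded, addJob]

theorem padded_one (q : ℕ) (v : Fin (n + q + 2)) (hv : v ≠ 1) : padded r q v 1 = true := by
  rw [← Fin.succ_zero_eq_one'] at *
  cases v using Fin.cases with
  | zero => simp [padded, addJob]
  | succ v =>
    cases v using Fin.cases with
    | zero => exact absurd rfl hv
    | succ v => simp [padded, addJob]

theorem padded_eq_true {q : ℕ} {a b : Fin (n + q + 2)} (h : padded r q a b = true) :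
    (a = 0 ∧ b ≠ 0) ∨ (b = 1 ∧ a ≠ 1) ∨ ∃ i j, a = shift q i ∧ b = shift q j ∧ r i j = true := by
  rw [← Fin.succ_zero_eq_one'] at *
  cases a using Fin.cases with
  | zero =>
    cases b using Fin.cases with
    | zero => simp [padded, addJob] at h
    | succ b => exact .inl ⟨rfl, Fin.succ_ne_zero b⟩
  | succ a =>
    cases b using Fin.cases with
    | zero => simp [padded, addJob] at h
    | succ b =>
      cases b using Fin.cases with
      | zero =>
        cases a using Fin.cases with
        | zero => simp [padded, addJob] at h
        | succ a => exact .inr (.inl ⟨rfl, fun h => absurd (Fin.succ_injective _ h) (Fin.succ_ne_zero a)⟩)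
      | succ b =>
        cases a using Fin.cases with
        | zero => simp [padded, addJob] at h
        | succ a =>
          obtain ⟨i, j, rfl, rfl, hij⟩ := addPads_eq_true (by simpa [padded, addJob] using h)
          exact .inr (.inr ⟨i, j, rfl, rfl, hij⟩)

theorem encMatrix_addJob (rb cb : Bool) (r : Fin n → Fin n → Bool) :
    encMatrix (addJob rb cb r) = .cons (encBits (false :: List.replicate n rb))
      (lst ((List.ofFn (row r)).map fun X => .cons (encBool cb) (encSet X))) := by
  have h : ∀ {k : ℕ} (R : Fin k → Fin k → Bool),
      encMatrix R = lst (List.ofFn fun i => encBits (List.ofFn (R i))) := by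
    intro k R
    rw [encMatrix, encList_eq_lst, List.map_ofFn]
    refine congrArg (fun f => lst (List.ofFn f)) (funext fun i => ?_)
    rw [Function.comp_apply, encSet_eq, bits]
    simp [row]
  rw [h, List.ofFn_succ, List.map_ofFn, lst_cons]
  have : ∀ i, encSet (row r i) = encBits (List.ofFn (r i)) := fun i => by
    rw [encSet_eq, bits]; simp [row]
  simp [addJob, Function.comp_def, this, List.ofFn_succ, List.ofFn_const]

theorem call_addJob (rb cb : Bool) (r : Fin n → Fin n → Bool) :
    Calls Code.iAddJob (lst [encBool rb, encBool cb, encMatrix r]) (encMatrix (addJob rb cb r))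
      (2 * n + 3) := by
  have h₁ := call_const (encBool rb) ((List.ofFn (row r)).map encSet)
  have h₂ := call_mapCons (encBool cb) ((List.ofFn (row r)).map encSet) []
  rw [← encList_eq_lst, List.length_map, List.length_ofFn] at h₁ h₂
  refine .of_wp (e := Code.addJob) rfl ?_
  simp [Code.addJob]
  refine .of_call h₁ (.of_call h₂ ⟨?_, by omega⟩)
  rw [encMatrix_addJob, List.append_nil, List.map_map, encBits, encList_cons, encList_eq_lst encBool,
    List.map_replicate]
  rfl

theorem call_addPads (q : ℕ) (r : Fin n → Fin n → Bool) :
    Calls Code.iAddPads (lst [unary q, encMatrix r]) (encMatrix (addPads r q))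
      (q * (2 * (n + q) + 4) + 1) := by
  induction q with
  | zero =>
    refine .of_wp (e := Code.addPads) rfl ?_
    simp [Code.addPads, Ends, addPads]
  | succ q ih =>
    refine .of_wp (e := Code.addPads) rfl ?_
    simp [Code.addPads]
    exact .of_call ih (.of_call (call_addJob false false (addPads r q)) ⟨rfl, by nlinarith⟩)

end

/-! ### Schedules of the padded instance -/

namespace Instance

variable (I : Instance)

/-- The padded instance for `T` slots on `m` machines, with a vertex cover. -/
def ctx (m q : ℕ) (C : Finset (Fin (I.n + q + 2))) : Ctx (I.n + q + 2) :=
  ⟨padded I.prec q, m, C, subsetList C⟩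

variable {I}

theorem bounded_ctx {m q : ℕ} {C : Finset (Fin (I.n + q + 2))} (h : {0, 1} ⊆ C)
    (hC : Covers (padded I.prec q) C) : (I.ctx m q C).Bounded 0 1 where
  cover := hC
  bot_mem := h (by simp)
  top_mem := h (by simp)
  bot_R := padded_zero (r := I.prec) q
  R_top := padded_one (r := I.prec) q

/-- The slot of the given instance for a slot of the padded instance. -/
def unpad {n : ℕ} (q : ℕ) (z : Finset (Fin (n + q + 2))) : Finset (Fin n) :=
  univ.filter fun i => shift q i ∈ z

/-- The schedule that is obtained from a solution of the padded instance. -/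
def unpadAll {n : ℕ} (q : ℕ) (p : Piece (n + q + 2)) : List (Finset (Fin n)) :=
  (p.tail.map (unpad q)).reverse

theorem isSchedule_of_answer {m q T : ℕ} {C : Finset (Fin (I.n + q + 2))} (h : {0, 1} ⊆ C)
    (hC : Covers (padded I.prec q) C) (hm : m ≤ I.m) (ha : (I.ctx m q C).answer T 0 1 ≠ []) :
    ∃ S : Fin T → Finset (Fin I.n), I.IsSchedule S ∧
      List.ofFn S = unpadAll q ((I.ctx m q C).answer T 0 1) := by
  obtain ⟨z, p, hp⟩ := List.exists_cons_of_ne_nil ha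
  obtain ⟨hlen, hjobs, hpair, hslot⟩ := Ctx.answer_sound (bounded_ctx h hC) hp
  rw [hp, unpadAll, List.tail_cons]
  have hmem : ∀ v, v ∈ jobs p ↔ ∃ w ∈ p, v ∈ w := by
    intro v
    clear hp hlen hjobs hpair hslot
    induction p with
    | nil => simp
    | cons w p ih => simp [ih]
  have hl : (p.map (unpad q)).reverse.length = T := by simpa using hlen
  let S : Fin T → Finset (Fin I.n) := fun t => (p.map (unpad q)).reverse[t.1]
  -- Pieces list the last slot first, whence the index `T - 1 - t`.
  have hS : ∀ (t : Fin T) i, i ∈ S t ↔ shift q i ∈ p[T - 1 - t.1] := by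
    intro t i
    have := t.2
    simp [S, unpad, hlen]
  refine ⟨S, ⟨?_, ?_, ?_⟩, ?_⟩
  · intro j
    have hj : shift q j ∈ jobs p := (hjobs _).2 (by simp [shift, Fin.ext_iff])
    obtain ⟨w, hw, hjw⟩ := (hmem _).1 hj
    obtain ⟨k, hk, rfl⟩ := List.getElem_of_mem hw
    refine ⟨⟨T - 1 - k, by omega⟩, (hS _ _).2 ?_, fun t ht => ?_⟩
    · simpa [show T - 1 - (T - 1 - k) = k by omega] using hjw
    · have ht := (hS t j).1 ht
      have := t.2
      rw [List.pairwise_iff_getElem] at hpair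
      ext
      by_contra hne
      simp only at hne
      rcases lt_or_gt_of_ne (show T - 1 - t.1 ≠ k by omega) with hlt | hlt
      · exact disjoint_left.1 (hpair _ _ (by omega) hk hlt).1 ht hjw
      · exact disjoint_left.1 (hpair _ _ hk (by omega) hlt).1 hjw ht
  · intro t
    have := t.2
    have h₁ : (S t).map ⟨shift q, shift_injective q⟩ ⊆ p[T - 1 - t.1] := by
      intro v hv
      obtain ⟨i, hi, rfl⟩ := mem_map.1 hv
      exact (hS t i).1 hi
    have h₂ := card_le_card h₁
    rw [card_map] at h₂
    exact h₂.trans ((hslot _ (List.getElem_mem _)).1.trans hm)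
  · intro i j t t' hij hi hj
    have := t.2
    have := t'.2
    have hi := (hS t i).1 hi
    have hj := (hS t' j).1 hj
    rw [← padded_shift (r := I.prec) q] at hij
    by_contra hle
    rw [not_lt, Fin.le_def] at hle
    rcases eq_or_lt_of_le hle with he | hlt
    · have e : p[T - 1 - t'.1] = p[T - 1 - t.1] := by simp [he]
      rw [e] at hj
      have := (hslot _ (List.getElem_mem _)).2 _ hi _ hj
      rw [show (I.ctx m q C).R = padded I.prec q from rfl, hij] at this
      simp at this
    · rw [List.pairwise_iff_getElem] at hpair
      have := (hpair (T - 1 - t.1) (T - 1 - t'.1) (by omega) (by omega) (by omega)).2 _ hi _ hj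
      rw [show (I.ctx m q C).R = padded I.prec q from rfl, hij] at this
      simp at this
  · exact List.ext_getElem (by simp [hlen]) fun i h₁ h₂ => by simp [S]

/-- The isolated jobs are as many as the idle places, and `E` distributes them there without any
constraint. Truncation in `m * T - n` does no harm, as a schedule gives `n ≤ m * T`. -/
theorem exists_fullSchedule {T m q : ℕ} {S : Fin T → Finset (Fin I.n)} (hS : I.IsSchedule S)
    (hm : ∀ t, (S t).card ≤ m) (hq : q = m * T - I.n) (C : Finset (Fin (I.n + q + 2))) :
    ∃ σ, (I.ctx m q C).FullSchedule 0 1 T σ := by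
  choose slot hslot huniq using hS.partition
  have hfib : ∀ t, univ.filter (fun i => slot i = t) = S t := fun t => by
    ext i
    simp only [mem_filter, mem_univ, true_and]
    exact ⟨fun h => h ▸ hslot i, fun h => (huniq i t h).symm⟩
  have hsum : ∑ t, (S t).card = I.n := by
    have := card_eq_sum_card_fiberwise (s := (univ : Finset (Fin I.n))) (f := slot) (t := univ)
      (fun _ _ => by simp)
    simpa [hfib] using this.symm
  have hsum' : ∑ t, (m - (S t).card) = q := by
    have h : ∑ t, (m - (S t).card) + ∑ t, (S t).card = m * T := by
      rw [← sum_add_distrib, sum_congr rfl fun t _ => Nat.sub_add_cancel (hm t)]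
      simp [mul_comm]
    omega
  let E : Fin q ≃ Σ t, Fin (m - (S t).card) :=
    (finCongr hsum'.symm).trans finSigmaFinEquiv.symm
  let e : Fin q ⊕ Fin I.n ≃ Fin (I.n + q) := finSumFinEquiv.trans (finCongr (add_comm q I.n))
  have he : ∀ i, e (.inr i) = i.addNat q := fun i => by
    ext; simp [e, add_comm]
  let f : Fin q ⊕ Fin I.n → Fin T := Sum.elim (fun k => (E k).1) slot
  let g : Fin (I.n + q) → ℕ := fun a => (f (e.symm a)).1 + 1
  let σ : Fin (I.n + q + 2) → ℕ := Fin.cons 0 (Fin.cons (T + 1) g)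
  have hg : ∀ a, 0 < g a ∧ g a < T + 1 := fun a => ⟨by simp [g], by simp [g]⟩
  have hσ₀ : σ 0 = 0 := rfl
  have hσ₁ : σ 1 = T + 1 := rfl
  have hσ₂ : ∀ a : Fin (I.n + q), σ a.succ.succ = g a := fun a => rfl
  have hcases : ∀ v : Fin (I.n + q + 2), v = 0 ∨ v = 1 ∨ ∃ a : Fin (I.n + q), v = a.succ.succ := by
    intro v
    cases v using Fin.cases with
    | zero => exact .inl rfl
    | succ v =>
      cases v using Fin.cases with
      | zero => exact .inr (.inl rfl)
      | succ v => exact .inr (.inr ⟨v, rfl⟩)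
  refine ⟨σ, ?_, ?_, ?_, ?_, ?_⟩
  · intro a b hab
    rcases padded_eq_true hab with ⟨rfl, hb⟩ | ⟨rfl, ha⟩ | ⟨i, j, rfl, rfl, hij⟩
    · rcases hcases b with rfl | rfl | ⟨b, rfl⟩
      · exact absurd rfl hb
      · omega
      · have := hg b
        rw [hσ₂]
        omega
    · rcases hcases a with rfl | rfl | ⟨a, rfl⟩
      · omega
      · exact absurd rfl ha
      · have := hg a
        rw [hσ₂]
        omega
    · have := hS.order i j _ _ hij (hslot i) (hslot j)
      rw [shift, shift, hσ₂, hσ₂, ← he, ← he]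
      simpa [g, f] using this
  · intro v
    rcases hcases v with rfl | rfl | ⟨a, rfl⟩
    · simp [hσ₀]
    · simp [hσ₁]
    · have := hg a
      rw [hσ₂]
      simp
  · intro v
    rcases hcases v with rfl | rfl | ⟨a, rfl⟩
    · simp [hσ₀]
    · simp [hσ₁]
    · have := hg a
      rw [hσ₂, ← Fin.succ_zero_eq_one']
      simp only [Fin.succ_inj, Fin.succ_ne_zero, iff_false]
      omega
  · intro v
    rcases hcases v with rfl | rfl | ⟨a, rfl⟩
    · omega
    · omega
    · have := hg a
      rw [hσ₂]
      omega
  · intro t ht htT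
    obtain ⟨t, rfl⟩ : ∃ s, t = s + 1 := ⟨t - 1, by omega⟩
    let s : Fin T := ⟨t, by omega⟩
    rw [card_filter, Fin.sum_univ_succ, Fin.sum_univ_succ, Fin.succ_zero_eq_one', hσ₀, hσ₁,
      if_neg (by omega), if_neg (by omega), zero_add, zero_add]
    simp only [hσ₂]
    rw [← e.sum_comp, Fintype.sum_sum_type]
    have h₁ : ∑ k, (if g (e (.inl k)) = t + 1 then 1 else 0) = m - (S s).card := by
      have : ∀ k, (if g (e (.inl k)) = t + 1 then 1 else 0) = if (E k).1 = s then 1 else 0 := by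
        intro k
        simp [g, f, Fin.ext_iff, s]
      rw [sum_congr rfl fun k _ => this k,
        E.sum_comp (fun x : Σ t, Fin (m - (S t).card) => if x.1 = s then 1 else 0),
        Fintype.sum_sigma, sum_eq_single s (fun x _ h => by simp [h]) (by simp)]
      simp
    have h₂ : ∑ i, (if g (e (.inr i)) = t + 1 then 1 else 0) = (S s).card := by
      rw [← hfib s, card_filter]
      refine sum_congr rfl fun i _ => ?_
      simp [g, f, Fin.ext_iff, s]
    rw [h₁, h₂]
    exact Nat.sub_add_cancel (hm s)

variable (I) in
-- Sorting by the number of predecessors, with ties broken by the index, is a linear extension;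
-- running one job per slot shows that the optimum is at most `n`.
theorem exists_isSchedule : ∃ S : Fin I.n → Finset (Fin I.n), I.IsSchedule S := by
  let key : Fin I.n → ℕ := fun i => (univ.filter fun j => I.prec j i = true).card * I.n + i
  have hkey : Function.Injective key := by
    intro i j h
    have h' := congrArg (· % I.n) h
    simp only [key, Nat.mul_add_mod_self_right, Nat.mod_eq_of_lt i.2,
      Nat.mod_eq_of_lt j.2] at h'
    exact Fin.ext h'
  have hprec : ∀ i j, I.prec i j = true → key i < key j := by
    intro i j hij
    have : (univ.filter fun k => I.prec k i = true).card <
        (univ.filter fun k => I.prec k j = true).card := by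
      refine card_lt_card ((ssubset_iff_of_subset fun k hk => ?_).2 ⟨i, by simpa, ?_⟩)
      · simp only [mem_filter, mem_univ, true_and] at hk ⊢
        exact I.trans k i j hk hij
      · simpa using I.irrefl i
    have h := Nat.mul_le_mul_right I.n this
    have := i.2
    simp only [key]
    rw [Nat.succ_mul] at h
    omega
  let rank : Fin I.n → ℕ := fun i => (univ.filter fun j => key j < key i).card
  have hmono : ∀ i j, key i < key j → rank i < rank j := by
    intro i j hij
    refine card_lt_card ((ssubset_iff_of_subset fun k hk => ?_).2 ⟨i, by simpa, by simp⟩)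
    simp only [mem_filter, mem_univ, true_and] at hk ⊢
    omega
  have hlt : ∀ i, rank i < I.n := by
    intro i
    have : rank i < (univ : Finset (Fin I.n)).card :=
      card_lt_card ((ssubset_iff_of_subset (subset_univ _)).2 ⟨i, mem_univ i, by simp⟩)
    simpa using this
  have hinj : ∀ i j, rank i = rank j → i = j := by
    intro i j h
    by_contra hne
    rcases lt_or_gt_of_ne (fun h => hne (hkey h)) with h' | h'
    · exact absurd h (hmono _ _ h').ne
    · exact absurd h (hmono _ _ h').ne'
  refine ⟨fun t => univ.filter fun i => rank i = t, fun j => ⟨⟨rank j, hlt j⟩, by simp, ?_⟩, ?_, ?_⟩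
  · intro t ht
    ext
    simpa using (mem_filter.1 ht).2.symm
  · intro t
    refine (card_le_one.2 fun i hi j hj => ?_).trans I.m_pos
    simp only [mem_filter, mem_univ, true_and] at hi hj
    exact hinj i j (hi.trans hj.symm)
  · intro i j t t' hij hi hj
    simp only [mem_filter, mem_univ, true_and] at hi hj
    rw [Fin.lt_def, ← hi, ← hj]
    exact hmono i j (hprec i j hij)

theorem exists_covers {D : Finset (Fin I.n)}
    (hD : I.compGraph.IsVertexCover (D : Set (Fin I.n))) (q : ℕ) :
    ∃ D' : Finset (Fin (I.n + q + 2)), {0, 1} ⊆ D' ∧ Covers (padded I.prec q) D' ∧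
      D'.card = D.card + 2 := by
  refine ⟨{0, 1} ∪ D.map ⟨shift q, shift_injective q⟩, subset_union_left, fun a b h => ?_, ?_⟩
  · rcases padded_eq_true h with ⟨rfl, -⟩ | ⟨rfl, -⟩ | ⟨i, j, rfl, rfl, hij⟩
    · simp
    · simp
    · have hadj : I.compGraph.Adj i j := .inl hij
      rcases hD hadj with h | h
      · exact .inl (mem_union_right _ (mem_map_of_mem _ h))
      · exact .inr (mem_union_right _ (mem_map_of_mem _ h))
  · rw [card_union_of_disjoint, card_map, add_comm]
    · rfl
    · rw [disjoint_left]
      intro v hv hv'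
      obtain ⟨i, -, rfl⟩ := mem_map.1 hv'
      revert hv
      simp [shift, Fin.ext_iff]

/-- The number of machines that can be used. -/
def machines (I : Instance) : ℕ := min (I.n + 1) I.m

/-- The result is existential because the cover computed by the program need not come from `D`; only
the cost refers to `D`. -/
theorem exists_call_solve_padded {D : Finset (Fin I.n)}
    (hD : I.compGraph.IsVertexCover (D : Set (Fin I.n))) {T : ℕ} (hT : T ≤ I.n) :
    ∃ a : Piece (I.n + (I.machines * T - I.n) + 2),
      ((∃ S : Fin T → Finset (Fin I.n), I.IsSchedule S) → a ≠ []) ∧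
      (a ≠ [] → ∃ S : Fin T → Finset (Fin I.n), I.IsSchedule S ∧ List.ofFn S = unpadAll _ a) ∧
      Calls Code.iSolve (lst [encMatrix (padded I.prec (I.machines * T - I.n)), unary I.machines,
        unary T, encMatrix (addPads I.prec (I.machines * T - I.n))]) (encPiece a)
        (solveCost (I.n + (I.machines * T - I.n) + 2) (D.card + 2)) := by
  generalize hq : I.machines * T - I.n = q
  obtain ⟨D', h₁, h₂, h₃⟩ := exists_covers hD q
  obtain ⟨C, hC, hcov, hcall⟩ := exists_call_solve (padded I.prec q) (addPads I.prec q) I.machines T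
    (by omega) h₁ h₂ h₃
  have hpos := I.m_pos
  refine ⟨(I.ctx I.machines q C).answer T 0 1, ?_, ?_, hcall⟩
  · rintro ⟨S, hS⟩
    have hcap : ∀ t, (S t).card ≤ I.machines := fun t => by
      have h₁ := hS.capacity t
      have h₂ := card_le_univ (S t)
      rw [Fintype.card_fin] at h₂
      unfold machines
      omega
    obtain ⟨σ, hσ⟩ := exists_fullSchedule hS hcap hq.symm C
    refine Ctx.answer_ne_nil (bounded_ctx hC hcov) hσ ?_ fun X hX => mem_subsetList hX
    show 0 < I.machines
    unfold machines
    omega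
  · exact isSchedule_of_answer hC hcov (min_le_right _ _)

end Instance

/-! ### The main loop -/

theorem iterate_tl_unary (j k : ℕ) : SExp.tl^[j] (unary k) = unary (k - j) := by
  induction j generalizing k with
  | zero => rfl
  | succ j ih => rw [Function.iterate_succ_apply, tl_unary, ih, Nat.sub_sub, add_comm]

theorem iterate_tl_encBits (j : ℕ) (l : List Bool) :
    SExp.tl^[j] (encBits l) = encBits (l.drop j) := by
  induction j generalizing l with
  | zero => rfl
  | succ j ih =>
    rw [Function.iterate_succ_apply]
    cases l with
    | nil => exact (ih []).trans (by simp)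
    | cons b l => exact ih l

theorem drop_bits {n : ℕ} (q : ℕ) (z : Finset (Fin (n + q + 2))) :
    (bits z).drop (q + 2) = bits (Instance.unpad q z) := by
  refine List.ext_getElem (by simp) fun i h₁ h₂ => ?_
  simp only [List.getElem_drop, bits, List.getElem_ofFn, Instance.unpad, mem_filter, mem_univ,
    true_and]
  refine decide_eq_decide.2 (iff_of_eq (congrArg (· ∈ z) ?_))
  ext
  simp [shift]
  omega

theorem call_strip {n : ℕ} (q : ℕ) (p : Piece (n + q + 2)) (acc : List (Finset (Fin n))) :
    Calls Code.iStrip (lst [unary (q + 2), encPiece p, encList encSet acc])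
      (encList encSet ((p.map (Instance.unpad q)).reverse ++ acc)) (p.length * (q + 4) + 1) := by
  induction p generalizing acc with
  | nil =>
    refine .of_wp (e := Code.strip) rfl ?_
    simp [Code.strip, Ends]
  | cons z p ih =>
    have hd := call_drop (List.replicate (q + 2) .nil) (encSet z)
    rw [← unary_eq_lst, List.length_replicate, encSet_eq, iterate_tl_encBits, drop_bits] at hd
    refine .of_wp (e := Code.strip) rfl ?_
    simp [Code.strip]
    refine .of_call hd (.of_call (ih (Instance.unpad q z :: acc)) ⟨by simp, ?_⟩)
    linarith

namespace Instance

variable {I : Instance}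

/-- A bound on the number of function calls for one number of slots. -/
def stepCost (n k : ℕ) : ℕ := 56 ^ (k + 2) * (5100 * ((n + 2) ^ 2 + 2) ^ 5)

theorem call_loop_step {T : ℕ} {q c : ℕ} (hq : I.machines * T - I.n = q)
    {a : Piece (I.n + q + 2)}
    (ha : Calls Code.iSolve (lst [encMatrix (padded I.prec q), unary I.machines, unary T,
      encMatrix (addPads I.prec q)]) (encPiece a) c) {y : SExp} {d : ℕ}
    (h₁ : a ≠ [] → a.length = T + 1 ∧ y = encList encSet (unpadAll q a))
    (h₂ : a = [] → Calls Code.iLoop (lst [encMatrix I.prec, unary I.machines, unary (T + 1),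
      unary (I.machines * (T + 1))]) y d) :
    Calls Code.iLoop (lst [encMatrix I.prec, unary I.machines, unary T, unary (I.machines * T)]) y
      (I.n + 1 + (q * (2 * (I.n + q) + 4) + 1) + (4 * (I.n + q) + 8) + c + (T * (q + 4) + 1) +
        (I.machines + 1) + d + 1) := by
  have hdrop := call_drop ((List.ofFn (row I.prec)).map encSet) (unary (I.machines * T))
  rw [← encList_eq_lst, List.length_map, List.length_ofFn, iterate_tl_unary, hq] at hdrop
  have hj₁ := call_addJob false true (addPads I.prec q)
  have hj₂ := call_addJob true false (addJob false true (addPads I.prec q))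
  have hrev := call_revApp (List.replicate I.machines .nil) (List.replicate (I.machines * T) .nil)
  rw [← unary_eq_lst, ← unary_eq_lst, List.reverse_replicate, ← List.replicate_add, ← unary_eq_lst,
    List.length_replicate, show I.machines + I.machines * T = I.machines * (T + 1) by ring] at hrev
  refine .of_wp (e := Code.loop) rfl ?_
  simp only [Code.loop, Code.mk, Code.ent, Code.arg, Code.drops, wp_bind, wp_call, wp_cons, wp_nil,
    wp_hd, wp_tl, wp_var_zero, wp_var_one, wp_var_two, wp_var_three, lst_cons, lst_nil, hd_cons,
    tl_cons, wp_bool, wp_cond]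
  refine .of_call hdrop (.of_call (call_addPads q I.prec) (.of_call hj₁ (.of_call hj₂
    (.of_call ha (.piece (fun h => ?_) fun h => ?_)))))
  · obtain ⟨hl, rfl⟩ := h₁ h
    obtain ⟨z, p, rfl⟩ := List.exists_cons_of_ne_nil h
    refine .of_call (call_strip q p []) ⟨by simp [unpadAll], ?_⟩
    obtain rfl : p.length = T := by simpa using hl
    omega
  · exact .of_call hrev (.of_call (h₂ h) ⟨rfl, by omega⟩)

/-- From `m * T ≤ (n + 1) * n` the padded instance has fewer than `(n + 2) ^ 2` jobs, so padding
keeps all costs polynomial in `n` apart from the power of `56`. -/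
theorem step_cost_le {n m q k T : ℕ} (hm : m ≤ n + 1) (hT : T ≤ n) (hq : m * T - n = q) :
    n + 1 + (q * (2 * (n + q) + 4) + 1) + (4 * (n + q) + 8) + solveCost (n + q + 2) (k + 2) +
      (T * (q + 4) + 1) + (m + 1) + 1 ≤ stepCost n k := by
  have hmT : m * T ≤ (n + 1) * n := Nat.mul_le_mul hm hT
  obtain ⟨E, hE⟩ : ∃ E, E = (n + 2) ^ 2 + 2 := ⟨_, rfl⟩
  have hqE : n + q + 4 ≤ E := by nlinarith [Nat.sub_le (m * T) n]
  have h₁ : 1 ≤ 56 ^ (k + 2) := Nat.one_le_pow _ _ (by omega)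
  rw [solveCost, stepCost, ← hE]
  generalize (56 : ℕ) ^ (k + 2) = c at *
  have hs : c * (5000 * (n + q + 2 + 2) ^ 5) ≤ c * (5000 * E ^ 5) := by gcongr
  have h₂ : q * (2 * (n + q) + 4) ≤ E * (2 * E) := Nat.mul_le_mul (by omega) (by omega)
  have h₃ : T * (q + 4) ≤ E * E := Nat.mul_le_mul (by omega) (by omega)
  have h₄ : E * E ≤ c * E ^ 5 := by
    rw [← pow_two]
    exact (Nat.pow_le_pow_right (by omega) (by omega)).trans (Nat.le_mul_of_pos_left _ h₁)
  have h₅ : E ≤ E * E := Nat.le_mul_of_pos_left _ (by omega)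
  have e₁ : c * (5000 * E ^ 5) = 5000 * (c * E ^ 5) := by ring
  have e₂ : c * (5100 * E ^ 5) = 5100 * (c * E ^ 5) := by ring
  have e₃ : E * (2 * E) = 2 * (E * E) := by ring
  rw [e₁] at hs
  rw [e₂]
  rw [e₃] at h₂
  generalize c * E ^ 5 = Q at *
  generalize E * E = F at *
  omega

/-- The loop finds a schedule with the least possible number of slots. -/
theorem exists_call_loop {D : Finset (Fin I.n)}
    (hD : I.compGraph.IsVertexCover (D : Set (Fin I.n))) {T₀ : ℕ} (hT₀ : T₀ ≤ I.n)
    (hex : ∃ S : Fin T₀ → Finset (Fin I.n), I.IsSchedule S)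
    (hmin : ∀ T < T₀, ¬∃ S : Fin T → Finset (Fin I.n), I.IsSchedule S) :
    ∃ S : Fin T₀ → Finset (Fin I.n), I.IsSchedule S ∧ ∀ j ≤ T₀,
      Calls Code.iLoop (lst [encMatrix I.prec, unary I.machines, unary (T₀ - j),
        unary (I.machines * (T₀ - j))]) (encSchedule S) ((j + 1) * stepCost I.n D.card) := by
  obtain ⟨a, h₁, h₂, h₃⟩ := exists_call_solve_padded hD hT₀
  obtain ⟨S, hS, hSa⟩ := h₂ (h₁ hex)
  refine ⟨S, hS, fun j hj => ?_⟩
  -- The induction runs backwards from the successful `T₀`; `j` failures precede it.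
  induction j with
  | zero =>
    refine (call_loop_step rfl h₃ (d := 0) (fun h => ⟨?_, ?_⟩) fun h => absurd h (h₁ hex)).mono ?_
    · have := congrArg List.length hSa
      have := List.length_pos_of_ne_nil h
      simp [unpadAll] at *
      omega
    · rw [encSchedule, hSa]
    · have := step_cost_le (k := D.card) (min_le_left (I.n + 1) I.m) hT₀ rfl
      unfold machines
      omega
  | succ j ih =>
    obtain ⟨b, -, hb, hcall⟩ := exists_call_solve_padded hD (T := T₀ - (j + 1)) (by omega)
    have hT : T₀ - (j + 1) + 1 = T₀ - j := by omega
    refine (call_loop_step rfl hcall (d := (j + 1) * stepCost I.n D.card) (fun h => ?_)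
      fun h => ?_).mono ?_
    · obtain ⟨S', hS', -⟩ := hb h
      exact absurd ⟨S', hS'⟩ (hmin _ (by omega))
    · rw [hT]
      exact ih (by omega)
    · have := step_cost_le (k := D.card) (min_le_left (I.n + 1) I.m)
        (show T₀ - (j + 1) ≤ I.n by omega) rfl
      rw [Nat.succ_mul (j + 1)]
      unfold machines
      omega

/-! ### The main theorem -/

theorem le_size_encList {α : Type} (enc : α → SExp) (l : List α) :
    l.length ≤ (encList enc l).size := by
  induction l with
  | nil => simp
  | cons a l ih => simp [SExp.size]; omega

theorem enc_eq (I : Instance) : I.enc = .cons (encBits I.m.bits) (encMatrix I.prec) := by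
  rw [Instance.enc, encNat, encMatrix, encList_eq_lst (encList encBool), encList_eq_lst encSet,
    List.map_ofFn, List.map_ofFn]
  refine congrArg (fun f => SExp.cons _ (lst (List.ofFn f))) (funext fun i => ?_)
  rw [Function.comp_apply, Function.comp_apply, encSet_eq, bits]
  simp [row]

/-- The cost is stated for the minimum size `k` of a vertex cover, so that one run is bounded in
terms of all covers at once. -/
theorem exists_call_main (I : Instance) : ∃ (T : ℕ) (S : Fin T → Finset (Fin I.n)),
    I.IsOptimal S ∧ ∃ k, (∀ D : Finset (Fin I.n),
      I.compGraph.IsVertexCover (D : Set (Fin I.n)) → k ≤ D.card) ∧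
      Calls 0 I.enc (encSchedule S) (I.enc.size * (2 * I.enc.size + 5) + 3 +
        (I.enc.size + 1) * stepCost I.enc.size k) := by
  classical
  have hex : ∃ T, ∃ S : Fin T → Finset (Fin I.n), I.IsSchedule S := ⟨_, I.exists_isSchedule⟩
  obtain ⟨D, hD, hDmin⟩ := exists_min_image
    (univ.filter fun D : Finset (Fin I.n) => I.compGraph.IsVertexCover (D : Set (Fin I.n)))
    card ⟨univ, by simp [SimpleGraph.IsVertexCover]⟩
  have hTn : Nat.find hex ≤ I.n := Nat.find_min' hex I.exists_isSchedule
  obtain ⟨S, hS, hcall⟩ := exists_call_loop (mem_filter.1 hD).2 hTn (Nat.find_spec hex)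
    fun T hT => Nat.find_min hex hT
  refine ⟨_, S, ⟨hS, fun T' S' hS' => Nat.find_min' hex ⟨S', hS'⟩⟩, D.card,
    fun D' hD' => hDmin D' (by simpa using hD'), ?_⟩
  have hloop := hcall _ le_rfl
  rw [Nat.sub_self, mul_zero] at hloop
  have hun := call_unary I.m.bits (.nil :: (List.ofFn (row I.prec)).map encSet)
  rw [lst_cons (encBits _), lst_cons (lst _), lst_cons .nil, ← encList_eq_lst, binary_bits,
    List.length_cons, List.length_map, List.length_ofFn] at hun
  have hs₁ : I.m.bits.length ≤ I.enc.size := by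
    have : _ ≤ (encBits I.m.bits).size := le_size_encList encBool I.m.bits
    rw [enc_eq, SExp.size]
    omega
  have hs₂ : I.n + 1 ≤ I.enc.size := by
    have := le_size_encList encSet (List.ofFn (row I.prec))
    rw [List.length_ofFn] at this
    rw [enc_eq, SExp.size, encMatrix]
    omega
  have hc₁ : I.m.bits.length * (2 * (I.n + 1) + 3) ≤ I.enc.size * (2 * I.enc.size + 5) :=
    Nat.mul_le_mul hs₁ (by omega)
  have hc₂ : (Nat.find hex + 1) * stepCost I.n D.card ≤
      (I.enc.size + 1) * stepCost I.enc.size D.card := by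
    unfold stepCost
    gcongr <;> omega
  generalize (I.enc.size + 1) * stepCost I.enc.size D.card = K at *
  generalize I.enc.size * (2 * I.enc.size + 5) = K' at *
  rw [enc_eq]
  refine .of_wp (e := Code.main) rfl ?_
  simp [Code.main]
  exact .of_call hun (.of_call hloop ⟨rfl, by omega⟩)

end Instance

end PrecSched

theorem theorem2 :
    ∃ (P : PrecSched.Program) (p : Polynomial ℕ), ∀ I : PrecSched.Instance,
      ∃ (T : ℕ) (S : Fin T → Finset (Fin I.n)) (t : ℕ),
        I.IsOptimal S ∧
        PrecSched.RunsIn P I.enc (PrecSched.encSchedule S) t ∧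
        ∀ C : Finset (Fin I.n), I.compGraph.IsVertexCover (C : Set (Fin I.n)) →
          t ≤ p.eval I.enc.size * 169 ^ C.card := by
  -- `width` converts function calls into steps; `56 ^ 2` is the price of the minimum and the
  -- maximum, which belong to every cover used.
  refine ⟨PrecSched.scheduler, .C (PrecSched.width PrecSched.scheduler) *
    (.X * (2 * .X + 5) + 3 + (.X + 1) * (56 ^ 2 * (5100 * ((.X + 2) ^ 2 + 2) ^ 5))), fun I => ?_⟩
  obtain ⟨T, S, hS, k, hk, e, t, he, ht, hcost⟩ := I.exists_call_main
  refine ⟨T, S, t, hS, ⟨e, he, ht⟩, fun C hC => hcost.trans ?_⟩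
  -- The base `7 * 8 = 56` is smaller than `169`, and `k` is at most the size of any vertex cover.
  have h₁ : 56 ^ k ≤ 169 ^ C.card :=
    (Nat.pow_le_pow_left (by omega) k).trans (Nat.pow_le_pow_right (by omega) (hk C hC))
  have h₂ : 1 ≤ 169 ^ C.card := Nat.one_le_pow _ _ (by omega)
  have h₃ : Polynomial.eval I.enc.size (.C (PrecSched.width PrecSched.scheduler) *
      (.X * (2 * .X + 5) + 3 + (.X + 1) * (56 ^ 2 * (5100 * ((.X + 2) ^ 2 + 2) ^ 5)))) =
      PrecSched.width PrecSched.scheduler * (I.enc.size * (2 * I.enc.size + 5) + 3 +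
        (I.enc.size + 1) * (56 ^ 2 * (5100 * ((I.enc.size + 2) ^ 2 + 2) ^ 5))) := by
    simp
  rw [h₃, mul_assoc]
  refine Nat.mul_le_mul_left _ ?_
  rw [PrecSched.Instance.stepCost, pow_add]
  generalize I.enc.size * (2 * I.enc.size + 5) + 3 = a
  generalize 5100 * ((I.enc.size + 2) ^ 2 + 2) ^ 5 = b
  rw [add_mul a]
  refine Nat.add_le_add (Nat.le_mul_of_pos_right a h₂) ?_
  calc (I.enc.size + 1) * (56 ^ k * 56 ^ 2 * b) ≤ (I.enc.size + 1) * (169 ^ C.card * 56 ^ 2 * b) := by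
        gcongr
    _ = _ := by ring
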